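/- **Setting.** Let $n\ge 2$, let $\tau,c_0,b,\nu>0$ with $b\nu<2c_0$, let $\alpha\in[0,1/2)$, $j\in\{0,1,2\}$, and let $s\in\mathbb R$ satisfy $s=j-2$ or $s\ge 0$. Consider the linear Cauchy problem on $\mathbb R^n$ $$(\tau\partial_t+1)\big(\varphi_{tt}-c_0^2\Delta\varphi+b\nu(-\Delta)^{\alpha}\varphi_t\big)=0\ (t>0),\qquad (\varphi,\varphi_t,\varphi_{tt})|_{t=0}=(\varphi_0,\varphi_1,\varphi_2),$$ where $(-\Delta)^\alpha$ is the Fourier multiplier with symbol $|\xi|^{2\alpha}$ and $\hat f(\xi)=\int_{\mathbb R^n} e^{-ix\cdot\xi}f(x)\,dx$. A (Sobolev) solution is a function $\varphi\in C^2([0,\infty),H^r(\mathbb R^n))$, for some $r\in\mathbb R$, that attains the data and for which $\varphi_{tt}-c_0^2\Delta\varphi+b\nu(-\Delta)^{\alpha}\varphi_t$ is differentiable in $t>0$ with values in $H^{r-2}$ and satisfies the equation. The data are taken in $$\mathcal A^{(1)}_{s,j}=(H^{s+\max\{1,2-j\}}\cap L^1)\times(H^{s+1}\cap L^1)\times(H^{s}\cap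 L^1)$$ with its natural norm (the sum of the Sobolev and the $L^1$ norms of the components). Write $P_f=\int_{\mathbb R^n}f(x)\,dx$, $\|u\|_{\dot H^\sigma}=\|\mathcal F^{-1}(|\xi|^\sigma\hat u)\|_{L^2}$, and $$\kappa=(j+1)+\frac{2s+n-2j}{2(2-2\alpha)}.$$ Let $\varepsilon_0>0$, let $\chi\in C^\infty(\mathbb R^n)$ satisfy $\chi=1$ on $\{|\xi|\le\varepsilon_0/2\}$ and $\chi=0$ on $\{|\xi|>\varepsilon_0\}$, and put $$\mathcal G_{1,j}(t,\cdot)=\mathcal F^{-1}\Big(\chi(\xi)\tfrac1{b\nu}|\xi|^{-2\alpha}\,\partial_t^j e^{-\frac{1}{b\nu}c_0^2|\xi|^{2-2\alpha}t}\Big).$$ **Proposition.** 1. (Upper bound.) There is a constant $C>0$, depending only on $n,\tau,c_0,b,\nu,\alpha,j,s$, such that for all data in $\mathcal A^{(1)}_{s,j}$ every solution satisfies $$\|\partial_t^j\varphi(t,\cdot)\|_{\dot H^{s+2-j}}\le C(1+t)^{-\kappa}\,\|(\varphi_0,\varphi_1,\varphi_2)\|_{\mathcal A^{(1)}_{s,j}}\qquad(t\ge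 0).$$ In parts 2 and 3 assume in addition, only if $\alpha=0$, that $P_{\varphi_0+\tau\varphi_1}=0$. 2. (Asymptotic profile.) For all data in $\mathcal A^{(1)}_{s,j}$ every solution satisfies $$\big\|\partial_t^j\varphi(t,\cdot)-P_{\varphi_1+\tau\varphi_2}\,\mathcal G_{1,j}(t,\cdot)\big\|_{\dot H^{s+2-j}}=o(t^{-\kappa})\qquad(t\to\infty).$$ 3. (Lower bound.) There is a constant $c>0$, depending only on $n,\tau,c_0,b,\nu,\alpha,j,s$, such that for all data in $\mathcal A^{(1)}_{s,j}$ with $P_{\varphi_1+\tau\varphi_2}\ne0$ every solution satisfies $$\|\partial_t^j\varphi(t,\cdot)\|_{\dot H^{s+2-j}}\ge c\,t^{-\kappa}\,|P_{\varphi_1+\tau\varphi_2}|$$ for all sufficiently large $t$ (how large may depend on the solution). -/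

import Mathlib

open MeasureTheory Filter Topology FourierTransform TemperedDistribution
open scoped SchwartzMap ENNReal ContDiff Laplacian

noncomputable section

namespace Cattaneo

/-- Euclidean space `ℝⁿ`. -/
abbrev Rn (n : ℕ) := EuclideanSpace ℝ (Fin n)

/-! ### Sobolev norms -/

/-- The norm of `u` in the Sobolev space `H^r(ℝⁿ)`, i.e. the `L²` norm of the Bessel potential
`J^r u`; it is `⊤` exactly if `u ∉ H^r`.  (Mathlib's Bessel potential is
`(1 - (2π)⁻² Δ)^(r/2)`, which gives the usual norm up to equivalence.) -/
def sobolevNorm {n : ℕ} (r : ℝ) (u : 𝓢'(Rn n, ℂ)) : ℝ≥0∞ :=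
  ⨅ (f : Lp ℂ 2 (volume : Measure (Rn n))) (_ : besselPotential (Rn n) ℂ r u = f), ‖f‖ₑ

/-- The (Mathlib-normalised) Fourier transform of the tempered distribution `u` is the function
`g`.  In the angular normalisation `û(ξ) = ∫ exp(-i x·ξ) u(x) dx` this says `û(2πη) = g(η)`.
Such a `g` is unique up to null sets. -/
def HasFourierFunction {n : ℕ} (u : 𝓢'(Rn n, ℂ)) (g : Rn n → ℂ) : Prop :=
  ∀ w : 𝓢(Rn n, ℂ), Integrable (fun η => w η * g η) ∧ (𝓕 u) w = ∫ η, w η * g η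

/-- The homogeneous norm `‖u‖_{Ḣ^σ} = ‖|D|^σ u‖_{L²}` where `|D|^σ` has the symbol `|ξ|^σ`
with respect to the angular frequency `ξ = 2πη`; it is `⊤` if `û` is not a function or if
`|ξ|^σ û` is not square integrable. -/
def homSobolevNorm {n : ℕ} (σ : ℝ) (u : 𝓢'(Rn n, ℂ)) : ℝ≥0∞ :=
  ⨅ (g : Rn n → ℂ) (_ : HasFourierFunction u g),
    eLpNorm (fun η => (((2 * Real.pi * ‖η‖) ^ σ : ℝ) : ℂ) * g η) 2 volume

/-- `w = (-Δ)^α u`: the Fourier multiplier with the symbol `|ξ|^{2α}`, `ξ = 2πη`. -/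
def IsFracLaplacian {n : ℕ} (α : ℝ) (u w : 𝓢'(Rn n, ℂ)) : Prop :=
  ∃ g : Rn n → ℂ, HasFourierFunction u g ∧
    HasFourierFunction w (fun η => (((2 * Real.pi * ‖η‖) ^ (2 * α) : ℝ) : ℂ) * g η)

/-! ### The linearized Cauchy problem -/

/-- `φ` is a Sobolev solution with time derivatives `D j = ∂_t^j φ` (`j = 0, 1, 2`, so `D 0 = φ`)
of the linearized Cauchy problem
`(τ ∂_t + 1) (φ_tt - c₀² Δφ + b ν (-Δ)^α φ_t) = 0` for `t > 0`,
`φ(0) = φ₀`, `φ_t(0) = φ₁`, `φ_tt(0) = φ₂`.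
For some real `r` (of any size) `φ` lies in `C²([0,∞), H^r)`, which is expressed by the isomorphism
`J^r : H^r → L²`, and the equation holds in `H^(r-2)`. -/
structure IsSolution {n : ℕ} (τ c₀ b ν α : ℝ) (φ₀ φ₁ φ₂ : 𝓢'(Rn n, ℂ))
    (D : Fin 3 → ℝ → 𝓢'(Rn n, ℂ)) : Prop where
  initial₀ : D 0 0 = φ₀
  initial₁ : D 1 0 = φ₁
  initial₂ : D 2 0 = φ₂
  regular_and_equation : ∃ r : ℝ,
    (∃ V : ℝ → Lp ℂ 2 (volume : Measure (Rn n)),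
      ContDiffOn ℝ 2 V (Set.Ici 0) ∧
      ∀ j : Fin 3, ∀ t : ℝ, 0 ≤ t →
        besselPotential (Rn n) ℂ r (D j t) = (iteratedDerivWithin j V (Set.Ici 0) t : Lp ℂ 2 _)) ∧
    (∃ v : ℝ → 𝓢'(Rn n, ℂ), ∃ W : ℝ → Lp ℂ 2 (volume : Measure (Rn n)),
      ∀ t : ℝ, 0 < t →
        IsFracLaplacian α (D 1 t) (v t) ∧
        besselPotential (Rn n) ℂ (r - 2)
          (D 2 t - ((c₀ ^ 2 : ℝ) : ℂ) • Δ (D 0 t) + ((b * ν : ℝ) : ℂ) • v t) = W t ∧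
        DifferentiableAt ℝ W t ∧
        τ • deriv W t + W t = 0)

/-! ### The data space -/

/-- `(φ₀, φ₁, φ₂) ∈ (H^{s+max{1,2-j}} ∩ L¹) × (H^{s+1} ∩ L¹) × (H^s ∩ L¹)`, for data in `L¹`. -/
def MemData {n : ℕ} (s : ℝ) (j : Fin 3) (φ₀ φ₁ φ₂ : Lp ℂ 1 (volume : Measure (Rn n))) : Prop :=
  MemSobolev (s + max 1 (2 - (j : ℝ))) 2 (φ₀ : 𝓢'(Rn n, ℂ)) ∧
  MemSobolev (s + 1) 2 (φ₁ : 𝓢'(Rn n, ℂ)) ∧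
  MemSobolev s 2 (φ₂ : 𝓢'(Rn n, ℂ))

/-- The norm of the data space. -/
def dataNorm {n : ℕ} (s : ℝ) (j : Fin 3) (φ₀ φ₁ φ₂ : Lp ℂ 1 (volume : Measure (Rn n))) : ℝ≥0∞ :=
  (sobolevNorm (s + max 1 (2 - (j : ℝ))) (φ₀ : 𝓢'(Rn n, ℂ)) + ‖φ₀‖ₑ) +
  (sobolevNorm (s + 1) (φ₁ : 𝓢'(Rn n, ℂ)) + ‖φ₁‖ₑ) +
  (sobolevNorm s (φ₂ : 𝓢'(Rn n, ℂ)) + ‖φ₂‖ₑ)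

/-- `P_f = ∫ f(x) dx`. -/
def mass {n : ℕ} (f : Lp ℂ 1 (volume : Measure (Rn n))) : ℂ := ∫ x, f x

/-! ### The asymptotic profile -/

/-- A low-frequency cut-off: smooth, supported in `{|ξ| ≤ ε₀}` and equal to `1` on
`{|ξ| ≤ ε₀ / 2}`. -/
structure IsLowFreqCutoff {n : ℕ} (ε₀ : ℝ) (χ : Rn n → ℝ) : Prop where
  smooth : ContDiff ℝ ∞ χ
  eq_one : ∀ ξ, ‖ξ‖ ≤ ε₀ / 2 → χ ξ = 1
  eq_zero : ∀ ξ, ε₀ < ‖ξ‖ → χ ξ = 0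

/-- `χ(ξ) (bν)⁻¹ |ξ|^{-2α} ∂_t^j exp(-(bν)⁻¹ c₀² |ξ|^{2-2α} t)`. -/
def profileSymbol {n : ℕ} (c₀ b ν α : ℝ) (χ : Rn n → ℝ) (j : ℕ) (t : ℝ) (ξ : Rn n) : ℝ :=
  χ ξ * (1 / (b * ν)) * ‖ξ‖ ^ (-(2 * α)) *
    iteratedDeriv j
      (fun t' : ℝ => Real.exp (-(1 / (b * ν)) * c₀ ^ 2 * ‖ξ‖ ^ (2 - 2 * α) * t')) t

open Classical in
/-- The tempered distribution given by an integrable function. -/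
def ofIntegrable {n : ℕ} (g : Rn n → ℂ) : 𝓢'(Rn n, ℂ) :=
  if h : Integrable g then ((h.toL1 g : Lp ℂ 1 (volume : Measure (Rn n))) : 𝓢'(Rn n, ℂ)) else 0

/-- The profile `𝒢_{1,j}(t, ·)`: the inverse Fourier transform
`(2π)⁻ⁿ ∫ exp(i x·ξ) m(ξ) dξ = ∫ exp(2πi x·η) m(2πη) dη` of the symbol `m` above
(an integrable function, see `integrable_profileSymbol`). -/
def profile {n : ℕ} (c₀ b ν α : ℝ) (χ : Rn n → ℝ) (j : ℕ) (t : ℝ) : 𝓢'(Rn n, ℂ) :=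
  𝓕⁻ (ofIntegrable fun η : Rn n =>
    ((profileSymbol c₀ b ν α χ j t ((2 * Real.pi) • η) : ℝ) : ℂ))

theorem integrable_profileSymbol {n : ℕ} (hn : 2 ≤ n) (c₀ b ν α : ℝ) (hα : α < 1 / 2)
    {ε₀ : ℝ} {χ : Rn n → ℝ} (hχ : IsLowFreqCutoff ε₀ χ) (j : ℕ) (t : ℝ) :
    Integrable (fun η : Rn n =>
      ((profileSymbol c₀ b ν α χ j t ((2 * Real.pi) • η) : ℝ) : ℂ)) := by
  have key : Integrable (profileSymbol c₀ b ν α χ j t) := by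
    set h : Rn n → ℝ := fun ξ => χ ξ * (1 / (b * ν)) *
      ((-(1 / (b * ν)) * c₀ ^ 2 * ‖ξ‖ ^ (2 - 2 * α)) ^ j *
        Real.exp (-(1 / (b * ν)) * c₀ ^ 2 * ‖ξ‖ ^ (2 - 2 * α) * t)) with hh
    have hcont : Continuous h := by
      have h1 : Continuous χ := hχ.smooth.continuous
      have h2 : Continuous fun ξ : Rn n => ‖ξ‖ ^ (2 - 2 * α) :=
        continuous_norm.rpow_const fun _ => Or.inr (by linarith)
      fun_prop
    have hsupp : HasCompactSupport h := by
      refine HasCompactSupport.intro (isCompact_closedBall (0 : Rn n) ε₀) fun ξ hξ => ?_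
      have : ε₀ < ‖ξ‖ := by simpa using hξ
      simp [hh, hχ.eq_zero ξ this]
    obtain ⟨C, hC⟩ := hcont.bounded_above_of_compact_support hsupp
    have hdim : Module.finrank ℝ (Rn n) = n := by simp
    have : Nontrivial (Rn n) := Module.nontrivial_of_finrank_pos (R := ℝ) (by omega)
    have hball : Integrable (fun ξ : Rn n =>
        (Set.Iic ε₀).indicator (fun y : ℝ => y ^ (-(2 * α))) ‖ξ‖) := by
      rw [integrable_fun_norm_addHaar volume
        (f := (Set.Iic ε₀).indicator (fun y : ℝ => y ^ (-(2 * α))))]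
      have h0 : IntegrableOn (fun y : ℝ => y ^ ((n : ℝ) - 1 - 2 * α)) (Set.Ioc 0 (max ε₀ 0)) := by
        rw [← intervalIntegrable_iff_integrableOn_Ioc_of_le (le_max_right _ _)]
        refine intervalIntegral.intervalIntegrable_rpow' ?_
        have : (2 : ℝ) ≤ n := by exact_mod_cast hn
        linarith
      have h1 : IntegrableOn ((Set.Ioc 0 (max ε₀ 0)).indicator
          (fun y : ℝ => y ^ ((n : ℝ) - 1 - 2 * α))) (Set.Ioi 0) :=
        ((integrable_indicator_iff measurableSet_Ioc).2 h0).integrableOn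
      refine h1.congr_fun (fun y hy => ?_) measurableSet_Ioi
      have hy : 0 < y := hy
      by_cases hyε : y ≤ ε₀
      · have e1 : y ∈ Set.Ioc 0 (max ε₀ 0) := ⟨hy, le_max_of_le_left hyε⟩
        have e2 : y ∈ Set.Iic ε₀ := hyε
        simp only [Set.indicator_of_mem e1, Set.indicator_of_mem e2, hdim, smul_eq_mul]
        rw [← Real.rpow_natCast, ← Real.rpow_add hy, Nat.cast_sub (by omega)]
        congr 1
        push_cast
        ring
      · have e1 : y ∉ Set.Ioc 0 (max ε₀ 0) := fun hm => by
          rcases le_max_iff.1 hm.2 with h | h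
          · exact hyε h
          · linarith
        have e2 : y ∉ Set.Iic ε₀ := hyε
        simp [Set.indicator_of_notMem e1, Set.indicator_of_notMem e2]
    have hprod := hball.bdd_mul hcont.aestronglyMeasurable (Filter.Eventually.of_forall hC)
    refine hprod.congr (Filter.Eventually.of_forall fun ξ => ?_)
    have hder : iteratedDeriv j (fun t' : ℝ =>
        Real.exp (-(1 / (b * ν)) * c₀ ^ 2 * ‖ξ‖ ^ (2 - 2 * α) * t')) t =
        (-(1 / (b * ν)) * c₀ ^ 2 * ‖ξ‖ ^ (2 - 2 * α)) ^ j *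
        Real.exp (-(1 / (b * ν)) * c₀ ^ 2 * ‖ξ‖ ^ (2 - 2 * α) * t) := by
      exact congrFun (iteratedDeriv_exp_const_mul j _) t
    by_cases hξ : ‖ξ‖ ≤ ε₀
    · have e2 : ‖ξ‖ ∈ Set.Iic ε₀ := hξ
      simp only [profileSymbol, hder, hh, Set.indicator_of_mem e2]
      ring
    · simp [profileSymbol, hh, hχ.eq_zero ξ (not_le.1 hξ)]
  exact (key.comp_smul (by positivity : (2 * Real.pi : ℝ) ≠ 0)).ofReal

/-- The exponent `(j+1) + (2s+n-2j) / (2(2-2α))` of the decay rate. -/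
def rate (n : ℕ) (α s : ℝ) (j : Fin 3) : ℝ :=
  ((j : ℝ) + 1) + (2 * s + n - 2 * (j : ℝ)) / (2 * (2 - 2 * α))

end Cattaneo

end

/-! On the Fourier side put ρ = |ξ|, β = bνρ^{2α}, a = c₀²ρ². Each frequency obeys the ODE
(τ∂ₜ+1)(y''+βy'+ay) = 0. The two factors commute, so ψ = y+τy' solves ψ''+βψ'+aψ = 0, and y is
recovered from ψ by Duhamel's formula with the kernel τ⁻¹e^{-(t-r)/τ}. With the roots λ₁, λ₂ of
λ²+βλ+a this gives `solSymbol`: the term e^{-t/τ}F_j plus one mode for each root. The amplitudes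
contain the data only through F₀+τF₁ and F₁+τF₂, which is why the masses of φ₀+τφ₁ and φ₁+τφ₂
appear.

For small ρ, α < 1/2 makes the roots real, with λ₁ ≈ -(c₀²/bν)ρ^{2-2α} and λ₂ ≈ -bνρ^{2α}. The
transforms of L¹ data are bounded, so the slow mode is at most of size
ρ^{(2-2α)j-2α}e^{-cρ^{2-2α}t}. With the weight ρ^{s+2-j}, the scaling ρ ~ t^{-1/(2-2α)} in dimension
n produces exactly t^{-κ} (`exists_eLpNorm_slowSymbol_le`). Everything else decays strictly faster
(`exists_eLpNorm_remainder_le`): the λ₂-mode because 2α < 2-2α, the term e^{-t/τ}F_j trivially, and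
frequencies away from zero exponentially, since Re λ is bounded away from 0 there. For large ρ the
roots are nearly ±ic₀ρ and the Duhamel kernel gains a factor 1/|1+τλ|; this gain makes the Sobolev
orders of the data sufficient.

For the profile the slow mode is rescaled parabolically. The transforms of the data converge to
their masses, and dominated convergence gives the limit (`tendsto_eLpNorm_slowSymbol_sub`). The
contribution of F₀+τF₁ carries the factor λ₂, which vanishes in the limit if α > 0 but tends to -bν
if α = 0; hence the extra condition in that case. The lower bound compares with the profile, whose
rescaled norm stays away from zero (`exists_le_eLpNorm_lowProfile`).

That every Sobolev solution is given by `solSymbol` is `IsSolution.hasFourierFunction`: restricted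
to a ball of frequencies all symbols are bounded, and the equation becomes an ODE in L² with
commuting bounded multiplication operators (`evolution_formula`). -/

noncomputable section

namespace Cattaneo

variable {n : ℕ} {u v : 𝓢'(Rn n, ℂ)} {g h : Rn n → ℂ}

/-! ### Distributions whose Fourier transform is a function -/

/-- Test against a bump function that equals 1 near the point. -/
theorem HasFourierFunction.locallyIntegrable (hu : HasFourierFunction u g) :
    LocallyIntegrable g := by
  intro x
  let f : ContDiffBump x := ⟨1, 2, one_pos, one_lt_two⟩
  have h1 : HasCompactSupport (Complex.ofRealCLM ∘ f) := f.hasCompactSupport.comp_left rfl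
  have h2 : ContDiff ℝ ∞ (Complex.ofRealCLM ∘ f) := Complex.ofRealCLM.contDiff.comp f.contDiff
  refine ⟨Metric.closedBall x 1, Metric.closedBall_mem_nhds x one_pos, ?_⟩
  refine ((hu (h1.toSchwartzMap h2)).1.integrableOn).congr_fun (fun y hy => ?_)
    measurableSet_closedBall
  have : f y = 1 := f.one_of_mem_closedBall hy
  simp [this]

/-- Fundamental lemma of the calculus of variations. This uniqueness turns identities between
distributions into pointwise identities of symbols. -/
theorem HasFourierFunction.ae_eq (hg : HasFourierFunction u g) (hh : HasFourierFunction u h) :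
    g =ᵐ[volume] h := by
  have := ae_eq_zero_of_integral_contDiff_smul_eq_zero (μ := (volume : Measure (Rn n)))
    (f := fun x => g x - h x) (hg.locallyIntegrable.sub hh.locallyIntegrable) (by
      intro f f_smooth f_cpt
      have h1 : HasCompactSupport (Complex.ofRealCLM ∘ f) := f_cpt.comp_left rfl
      have h2 : ContDiff ℝ ∞ (Complex.ofRealCLM ∘ f) := Complex.ofRealCLM.contDiff.comp f_smooth
      have e1 := hg (h1.toSchwartzMap h2)
      have e2 := hh (h1.toSchwartzMap h2)
      have := integral_sub e1.1 e2.1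
      rw [← e1.2, ← e2.2, sub_self] at this
      rw [← this]
      refine integral_congr_ae (Eventually.of_forall fun y => ?_)
      simp [mul_sub])
  filter_upwards [this] with x hx
  exact sub_eq_zero.1 hx

theorem HasFourierFunction.congr (hu : HasFourierFunction u g) (hg : g =ᵐ[volume] h) :
    HasFourierFunction u h := fun w => by
  have : (fun η => w η * g η) =ᵐ[volume] fun η => w η * h η := by
    filter_upwards [hg] with η hη
    rw [hη]
  exact ⟨(hu w).1.congr this, (hu w).2.trans (integral_congr_ae this)⟩

theorem HasFourierFunction.add (hu : HasFourierFunction u g) (hv : HasFourierFunction v h) :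
    HasFourierFunction (u + v) (fun η => g η + h η) := fun w => by
  have e : (fun η => w η * (g η + h η)) = fun η => w η * g η + w η * h η := by
    funext η; ring
  refine ⟨e ▸ (hu w).1.add (hv w).1, ?_⟩
  rw [e, integral_add (hu w).1 (hv w).1, ← (hu w).2, ← (hv w).2, FourierTransform.fourier_add]
  rfl

theorem HasFourierFunction.smul (c : ℂ) (hu : HasFourierFunction u g) :
    HasFourierFunction (c • u) (fun η => c * g η) := fun w => by
  have e : (fun η => w η * (c * g η)) = fun η => c * (w η * g η) := by
    funext η; ring
  refine ⟨e ▸ (hu w).1.const_mul c, ?_⟩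
  rw [e, integral_const_mul, ← (hu w).2, FourierTransform.fourier_smul]
  rfl

theorem HasFourierFunction.sub (hu : HasFourierFunction u g) (hv : HasFourierFunction v h) :
    HasFourierFunction (u - v) (fun η => g η - h η) := by
  have := hu.add (hv.smul (-1))
  have e : u + (-1 : ℂ) • v = u - v := by
    ext w
    simp [sub_eq_add_neg]
  rw [e] at this
  refine this.congr (Eventually.of_forall fun η => ?_)
  simp only
  ring

/-! ### Fourier multipliers, Plancherel and the transform of L¹ functions. -/

theorem HasFourierFunction.smulLeft {m : Rn n → ℂ} (hu : HasFourierFunction u g)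
    (hm : m.HasTemperateGrowth) (hv : 𝓕 v = smulLeftCLM ℂ m (𝓕 u)) :
    HasFourierFunction v (fun η => m η * g η) := fun w => by
  have := hu (SchwartzMap.smulLeftCLM ℂ m w)
  have e : (fun η => SchwartzMap.smulLeftCLM ℂ m w η * g η) = fun η => w η * (m η * g η) := by
    funext η
    rw [SchwartzMap.smulLeftCLM_apply_apply hm, smul_eq_mul]
    ring
  rw [e] at this
  rw [hv]
  exact this

theorem hasFourierFunction_of_fourier_eq {p : ℝ≥0∞} [Fact (1 ≤ p)]
    {f : Lp ℂ p (volume : Measure (Rn n))} (hu : 𝓕 u = (f : 𝓢'(Rn n, ℂ))) :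
    HasFourierFunction u f := fun w => by
  constructor
  -- A Schwartz function lies in the conjugate Lebesgue space, so Hölder's inequality applies.
  · have := ENNReal.HolderConjugate.inv_one_sub_inv' (Fact.out : 1 ≤ p)
    have := (w.memLp ((1 - p⁻¹)⁻¹) volume).integrable_mul (Lp.memLp f)
    exact this
  · rw [hu, Lp.toTemperedDistribution_apply]
    rfl

theorem hasFourierFunction_toTemperedDistribution (f : Lp ℂ 2 (volume : Measure (Rn n))) :
    HasFourierFunction (f : 𝓢'(Rn n, ℂ)) (𝓕 f : Lp ℂ 2 (volume : Measure (Rn n))) :=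
  hasFourierFunction_of_fourier_eq (Lp.fourier_toTemperedDistribution_eq f)

/-- The weight `(1 + |η|²)^(r/2)`. -/
def bessel (r : ℝ) (η : Rn n) : ℝ := (1 + ‖η‖ ^ 2) ^ (r / 2)

theorem bessel_pos (r : ℝ) (η : Rn n) : 0 < bessel r η := by unfold bessel; positivity

theorem bessel_add (r r' : ℝ) (η : Rn n) : bessel (r + r') η = bessel r η * bessel r' η := by
  rw [bessel, bessel, bessel, ← Real.rpow_add (by positivity)]
  congr 1
  ring

theorem bessel_mul_neg (r : ℝ) (η : Rn n) : bessel (-r) η * bessel r η = 1 := by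
  rw [← bessel_add]
  simp [bessel]

theorem hasTemperateGrowth_bessel (r : ℝ) :
    (fun η : Rn n => ((bessel r η : ℝ) : ℂ)).HasTemperateGrowth := by
  unfold bessel
  fun_prop

theorem HasFourierFunction.besselPotential (r : ℝ) (hu : HasFourierFunction u g) :
    HasFourierFunction (besselPotential (Rn n) ℂ r u) (fun η => (bessel r η : ℂ) * g η) :=
  hu.smulLeft (hasTemperateGrowth_bessel r)
    (fourier_besselPotential_eq_smulLeftCLM_fourier_apply r u)

/-- `J^{-r}` inverts `J^r`. Membership in some H^r, of whatever order, therefore already makes the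
Fourier transform a function. -/
theorem hasFourierFunction_of_besselPotential_eq {r : ℝ} {f : Lp ℂ 2 (volume : Measure (Rn n))}
    (hu : TemperedDistribution.besselPotential (Rn n) ℂ r u = f) :
    HasFourierFunction u
      (fun η => (bessel (-r) η : ℂ) * (𝓕 f : Lp ℂ 2 (volume : Measure (Rn n))) η) := by
  have h := (hasFourierFunction_toTemperedDistribution f).besselPotential (-r)
  rwa [← hu, besselPotential_besselPotential_apply, add_neg_cancel, besselPotential_zero] at h

theorem HasFourierFunction.laplacian (hu : HasFourierFunction u g) :
    HasFourierFunction (Δ u) (fun η => -((2 * Real.pi * ‖η‖) ^ 2 : ℝ) * g η) := by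
  have hm : (fun η : Rn n => ((‖η‖ ^ 2 : ℝ) : ℂ)).HasTemperateGrowth := by fun_prop
  have h := (hu.smulLeft (v := fourierMultiplierCLM ℂ (fun η : Rn n => ((‖η‖ ^ 2 : ℝ) : ℂ)) u) hm
    (by simp [fourierMultiplierCLM_apply])).smul (-(2 * Real.pi) ^ 2 : ℝ)
  rw [laplacian_eq_fourierMultiplierCLM]
  have e : ((-(2 * Real.pi) ^ 2 : ℝ) : ℂ) •
      fourierMultiplierCLM ℂ (fun η : Rn n => ((‖η‖ ^ 2 : ℝ) : ℂ)) u =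
      -(2 * Real.pi) ^ 2 • fourierMultiplierCLM ℂ (fun η : Rn n => ((‖η‖ ^ 2 : ℝ) : ℂ)) u := by
    ext w
    simp
  rw [← e]
  refine h.congr (Eventually.of_forall fun η => ?_)
  push_cast
  ring

/-- The multiplication formula ∫ ŵ f = ∫ w f̂. It makes the bounded continuous representative of the
transform available, which can be evaluated at frequency zero. -/
theorem hasFourierFunction_integral (f : Lp ℂ 1 (volume : Measure (Rn n))) :
    HasFourierFunction (f : 𝓢'(Rn n, ℂ)) (𝓕 (f : Rn n → ℂ)) := fun w => by
  have hf : Integrable (f : Rn n → ℂ) := L1.integrable_coeFn f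
  have hc : Continuous (𝓕 (f : Rn n → ℂ)) :=
    VectorFourier.fourierIntegral_continuous Real.continuous_fourierChar
      (by exact continuous_inner) hf
  constructor
  · refine w.integrable.mul_bdd (c := ∫ x, ‖f x‖) hc.aestronglyMeasurable
      (Eventually.of_forall fun η => ?_)
    exact VectorFourier.norm_fourierIntegral_le_integral_norm _ _ _ _ _
  · rw [TemperedDistribution.fourier_apply, Lp.toTemperedDistribution_apply]
    have := VectorFourier.integral_fourierIntegral_smul_eq_flip (L := innerₗ (Rn n))
      (μ := volume) (ν := volume) Real.continuous_fourierChar (by exact continuous_inner)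
      w.integrable hf
    simpa [SchwartzMap.fourier_coe] using! this

theorem hasFourierFunction_fourierInv_ofIntegrable (hg : Integrable g) :
    HasFourierFunction (𝓕⁻ (ofIntegrable g)) g := by
  have h : HasFourierFunction (𝓕⁻ (ofIntegrable g)) (hg.toL1 g) :=
    hasFourierFunction_of_fourier_eq (by rw [fourier_fourierInv_eq, ofIntegrable, dif_pos hg])
  exact h.congr hg.coeFn_toL1

/-! ### Norms and masses read off from the Fourier transform. -/

theorem homSobolevNorm_eq (hu : HasFourierFunction u g) (σ : ℝ) :
    homSobolevNorm σ u =
      eLpNorm (fun η => (((2 * Real.pi * ‖η‖) ^ σ : ℝ) : ℂ) * g η) 2 volume := by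
  refine le_antisymm (iInf₂_le g hu) (le_iInf₂ fun g' hg' => le_of_eq (eLpNorm_congr_ae ?_))
  filter_upwards [hu.ae_eq hg'] with η hη
  rw [hη]

theorem eLpNorm_bessel_mul_le (hu : HasFourierFunction u g) (r : ℝ) :
    eLpNorm (fun η => (bessel r η : ℂ) * g η) 2 volume ≤ sobolevNorm r u := by
  refine le_iInf₂ fun f hf => le_of_eq ?_
  have h1 := hu.besselPotential r
  rw [hf] at h1
  rw [eLpNorm_congr_ae (h1.ae_eq (hasFourierFunction_toTemperedDistribution f)),
    ← Lp.enorm_def, ← ofReal_norm, ← ofReal_norm, Lp.norm_fourier_eq]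

theorem norm_fourier_le (f : Lp ℂ 1 (volume : Measure (Rn n))) (η : Rn n) :
    ‖𝓕 (f : Rn n → ℂ) η‖ ≤ ‖f‖ := by
  rw [L1.norm_eq_integral_norm]
  exact VectorFourier.norm_fourierIntegral_le_integral_norm _ _ _ _ _

theorem continuous_fourier (f : Lp ℂ 1 (volume : Measure (Rn n))) :
    Continuous (𝓕 (f : Rn n → ℂ)) :=
  VectorFourier.fourierIntegral_continuous Real.continuous_fourierChar
    (by exact continuous_inner) (L1.integrable_coeFn f)

theorem fourier_zero_eq_mass (f : Lp ℂ 1 (volume : Measure (Rn n))) :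
    𝓕 (f : Rn n → ℂ) 0 = mass f := by
  simp [Real.fourier_eq, mass]

theorem mass_add_smul (f g : Lp ℂ 1 (volume : Measure (Rn n))) (c : ℂ) :
    mass (f + c • g) = mass f + c * mass g := by
  unfold mass
  rw [← integral_const_mul, ← integral_add (L1.integrable_coeFn f)
    ((L1.integrable_coeFn g).const_mul c)]
  refine integral_congr_ae ?_
  filter_upwards [Lp.coeFn_add f (c • g), Lp.coeFn_smul c g] with x h1 h2
  rw [h1, Pi.add_apply, h2, Pi.smul_apply, smul_eq_mul]

/-! ### Bounded multiplication operators on `L²` -/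

section Multiplication

variable {X : Type*} [MeasurableSpace X] {μ : Measure X}

/-- `m` is bounded and measurable. -/
def IsBddMeas (m : X → ℂ) : Prop := Measurable m ∧ ∃ C : ℝ, ∀ x, ‖m x‖ ≤ C

theorem IsBddMeas.memLp {m : X → ℂ} (hm : IsBddMeas m) : MemLp m ∞ μ :=
  memLp_top_of_bound hm.1.aestronglyMeasurable hm.2.choose
    (Eventually.of_forall hm.2.choose_spec)

theorem IsBddMeas.mul {m m' : X → ℂ} (hm : IsBddMeas m) (hm' : IsBddMeas m') :
    IsBddMeas (fun x => m x * m' x) := by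
  obtain ⟨h1, C, hC⟩ := hm
  obtain ⟨h2, C', hC'⟩ := hm'
  refine ⟨h1.mul h2, C * C', fun x => ?_⟩
  rw [norm_mul]
  exact mul_le_mul (hC x) (hC' x) (norm_nonneg _) ((norm_nonneg _).trans (hC x))

theorem IsBddMeas.add {m m' : X → ℂ} (hm : IsBddMeas m) (hm' : IsBddMeas m') :
    IsBddMeas (fun x => m x + m' x) := by
  obtain ⟨h1, C, hC⟩ := hm
  obtain ⟨h2, C', hC'⟩ := hm'
  exact ⟨h1.add h2, C + C', fun x => (norm_add_le _ _).trans (add_le_add (hC x) (hC' x))⟩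

theorem isBddMeas_const (c : ℂ) : IsBddMeas (fun _ : X => c) :=
  ⟨measurable_const, ‖c‖, fun _ => le_rfl⟩

theorem IsBddMeas.neg {m : X → ℂ} (hm : IsBddMeas m) : IsBddMeas (fun x => -m x) := by
  simpa using (isBddMeas_const (-1)).mul hm

theorem IsBddMeas.exp {m : X → ℂ} (hm : IsBddMeas m) : IsBddMeas (fun x => Complex.exp (m x)) := by
  obtain ⟨h1, C, hC⟩ := hm
  refine ⟨Complex.measurable_exp.comp h1, Real.exp C, fun x => ?_⟩
  rw [Complex.norm_exp]
  exact Real.exp_le_exp.2 ((Complex.re_le_norm _).trans (hC x))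

variable (μ) in
open Classical in
/-- Multiplication by a bounded measurable function, as an operator on `L²`. -/
def mulOp (m : X → ℂ) : Lp ℂ 2 μ →L[ℝ] Lp ℂ 2 μ :=
  if hm : MemLp m ∞ μ then
    (ContinuousLinearMap.lsmul ℝ ℂ (E := ℂ)).holderL μ ∞ 2 2 (hm.toLp m)
  else 0

theorem coeFn_mulOp {m : X → ℂ} (hm : IsBddMeas m) (f : Lp ℂ 2 μ) :
    mulOp μ m f =ᵐ[μ] fun x => m x * f x := by
  rw [mulOp, dif_pos hm.memLp]
  have h := (ContinuousLinearMap.lsmul ℝ ℂ (E := ℂ)).coeFn_holder (r := 2)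
    (hm.memLp.toLp m : Lp ℂ ∞ μ) f
  filter_upwards [h, hm.memLp.coeFn_toLp (μ := μ)] with x h1 h2
  rw [h2] at h1
  exact h1

theorem mulOp_eq_of_ae {m : X → ℂ} (hm : IsBddMeas m) {f g : Lp ℂ 2 μ}
    (h : ∀ᵐ x ∂μ, g x = m x * f x) : mulOp μ m f = g := by
  refine Lp.ext ?_
  filter_upwards [coeFn_mulOp hm f, h] with x h1 h2
  rw [h1, h2]

theorem mulOp_mulOp {m m' : X → ℂ} (hm : IsBddMeas m) (hm' : IsBddMeas m') (f : Lp ℂ 2 μ) :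
    mulOp μ m (mulOp μ m' f) = mulOp μ (fun x => m x * m' x) f := by
  refine mulOp_eq_of_ae hm ?_
  filter_upwards [coeFn_mulOp (hm.mul hm') f, coeFn_mulOp hm' f] with x h1 h2
  rw [h1, h2, mul_assoc]

theorem mulOp_one (f : Lp ℂ 2 μ) : mulOp μ (fun _ => 1) f = f :=
  mulOp_eq_of_ae (isBddMeas_const 1) (Eventually.of_forall fun x => by simp)

theorem mulOp_zero (f : Lp ℂ 2 μ) : mulOp μ (fun _ => 0) f = 0 := by
  refine mulOp_eq_of_ae (isBddMeas_const 0) ?_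
  filter_upwards [Lp.coeFn_zero ℂ 2 μ] with x h1
  rw [h1, Pi.zero_apply, zero_mul]

theorem mulOp_smul_fun {m : X → ℂ} (hm : IsBddMeas m) (c : ℝ) (f : Lp ℂ 2 μ) :
    mulOp μ (fun x => c * m x) f = c • mulOp μ m f := by
  refine mulOp_eq_of_ae ((isBddMeas_const _).mul hm) ?_
  filter_upwards [coeFn_mulOp hm f, Lp.coeFn_smul c (mulOp μ m f)] with x h1 h2
  rw [h2, Pi.smul_apply, h1, Complex.real_smul, mul_assoc]

theorem mulOp_add_fun {m m' : X → ℂ} (hm : IsBddMeas m) (hm' : IsBddMeas m') (f : Lp ℂ 2 μ) :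
    mulOp μ (fun x => m x + m' x) f = mulOp μ m f + mulOp μ m' f := by
  refine mulOp_eq_of_ae (hm.add hm') ?_
  filter_upwards [coeFn_mulOp hm f, coeFn_mulOp hm' f,
    Lp.coeFn_add (mulOp μ m f) (mulOp μ m' f)] with x h1 h2 h3
  rw [h3, Pi.add_apply, h1, h2, add_mul]

theorem mulOp_neg_fun {m : X → ℂ} (hm : IsBddMeas m) (f : Lp ℂ 2 μ) :
    mulOp μ (fun x => -m x) f = -mulOp μ m f := by
  have := mulOp_smul_fun hm (-1) f
  simpa using this

/-- Shaped for the truncated equation: `p` and `q` become the damping and stiffness symbols, `m` and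
`m'` the Bessel weights that are removed. -/
theorem mulOp_eq_add_mulOp_add_mulOp {m m' p q : X → ℂ} (hm : IsBddMeas m) (hm' : IsBddMeas m')
    (hp : IsBddMeas p) (hq : IsBddMeas q) {f f₀ f₁ f₂ : Lp ℂ 2 μ}
    (h : ∀ᵐ x ∂μ, m x * f x = m' x * f₂ x + p x * (m' x * f₁ x) + q x * (m' x * f₀ x)) :
    mulOp μ m f = mulOp μ m' f₂ + mulOp μ p (mulOp μ m' f₁) + mulOp μ q (mulOp μ m' f₀) := by
  refine mulOp_eq_of_ae hm ?_
  filter_upwards [h, coeFn_mulOp hm' f₀, coeFn_mulOp hm' f₁, coeFn_mulOp hm' f₂,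
    coeFn_mulOp hp (mulOp μ m' f₁), coeFn_mulOp hq (mulOp μ m' f₀),
    Lp.coeFn_add (mulOp μ m' f₂ + mulOp μ p (mulOp μ m' f₁)) (mulOp μ q (mulOp μ m' f₀)),
    Lp.coeFn_add (mulOp μ m' f₂) (mulOp μ p (mulOp μ m' f₁))] with x h1 h2 h3 h4 h5 h6 h7 h8
  rw [h7, Pi.add_apply, h8, Pi.add_apply, h5, h6, h2, h3, h4, h1]

theorem norm_le_of_ae_bound_top {f : Lp ℂ ∞ μ} {C : ℝ} (hC : 0 ≤ C)
    (h : ∀ᵐ x ∂μ, ‖f x‖ ≤ C) : ‖f‖ ≤ C := by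
  rw [Lp.norm_def, eLpNorm_exponent_top]
  exact ENNReal.toReal_le_of_le_ofReal hC (eLpNormEssSup_le_of_ae_bound h)

/-- A locally uniform bound on the second time derivative makes the Taylor remainder O((r-t)²)
uniformly in `x`. This gives differentiability in L^∞, hence in operator norm. -/
theorem hasDerivAt_mulOp {m m' m'' : ℝ → X → ℂ} (hm : ∀ t, IsBddMeas (m t))
    (hm' : ∀ t, IsBddMeas (m' t)) (h1 : ∀ t x, HasDerivAt (fun r => m r x) (m' t x) t)
    (h2 : ∀ t x, HasDerivAt (fun r => m' r x) (m'' t x) t)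
    (hb : ∀ R : ℝ, ∃ C : ℝ, ∀ t, |t| ≤ R → ∀ x, ‖m'' t x‖ ≤ C) (t : ℝ) :
    HasDerivAt (fun r => mulOp μ (m r)) (mulOp μ (m' t)) t := by
  obtain ⟨C, hC⟩ := hb (|t| + 1)
  have key : HasDerivAt (fun r => (hm r).memLp.toLp (m r) : ℝ → Lp ℂ ∞ μ)
      ((hm' t).memLp.toLp (m' t)) t := by
    rw [hasDerivAt_iff_isLittleO]
    refine Asymptotics.IsBigO.trans_isLittleO (g := fun r => (r - t) ^ 2) ?_ ?_
    · refine Asymptotics.IsBigO.of_bound (max C 0) ?_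
      filter_upwards [Metric.ball_mem_nhds t one_pos] with r hr
      have hr : |r - t| < 1 := hr
      rw [Real.norm_of_nonneg (sq_nonneg _)]
      have hseg : ∀ y ∈ segment ℝ t r, |y| ≤ |t| + 1 ∧ |y - t| ≤ |r - t| := by
        rintro y ⟨a, b, ha, hb, hab, rfl⟩
        have : a • t + b • r - t = b * (r - t) := by
          simp only [smul_eq_mul]
          linear_combination t * hab
        have h3 : |a • t + b • r - t| ≤ |r - t| := by
          rw [this, abs_mul, abs_of_nonneg hb]
          exact mul_le_of_le_one_left (abs_nonneg _) (by linarith)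
        refine ⟨?_, h3⟩
        calc |a • t + b • r| = |t + (a • t + b • r - t)| := by congr 1; ring
          _ ≤ |t| + |a • t + b • r - t| := abs_add_le _ _
          _ ≤ _ := by linarith
      -- Two applications of the mean value inequality: to `m'`, and then to `y ↦ m y x - y • m' t
      -- x`, whose derivative the first one bounds.
      have hpt : ∀ x, ‖m r x - m t x - (r - t) • m' t x‖ ≤ max C 0 * (r - t) ^ 2 := by
        intro x
        have e1 : ∀ y ∈ segment ℝ t r, ‖m' y x - m' t x‖ ≤ max C 0 * |r - t| := by
          intro y hy
          have := (convex_segment t r).norm_image_sub_le_of_norm_hasDerivWithin_le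
            (f := fun y => m' y x) (f' := fun y => m'' y x) (C := max C 0)
            (fun z _ => (h2 z x).hasDerivWithinAt)
            (fun z hz => (hC z (hseg z hz).1 x).trans (le_max_left _ _))
            (left_mem_segment ℝ t r) hy
          exact this.trans (mul_le_mul_of_nonneg_left (hseg y hy).2 (le_max_right _ _))
        have := (convex_segment t r).norm_image_sub_le_of_norm_hasDerivWithin_le
            (f := fun y => m y x - y • m' t x) (f' := fun y => m' y x - m' t x)
            (C := max C 0 * |r - t|)
            (fun z _ => by
              have := ((h1 z x).sub ((hasDerivAt_id z).smul_const (m' t x))).hasDerivWithinAt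
                (s := segment ℝ t r)
              simpa using! this)
            e1 (left_mem_segment ℝ t r) (right_mem_segment ℝ t r)
        calc ‖m r x - m t x - (r - t) • m' t x‖
            = ‖(m r x - r • m' t x) - (m t x - t • m' t x)‖ := by
              congr 1; rw [sub_smul]; ring
          _ ≤ max C 0 * |r - t| * ‖r - t‖ := this
          _ = _ := by rw [Real.norm_eq_abs, mul_assoc, ← sq, sq_abs]
      refine norm_le_of_ae_bound_top (by positivity) ?_
      · filter_upwards [Lp.coeFn_sub ((hm r).memLp.toLp (m r) - (hm t).memLp.toLp (m t))
          ((r - t) • (hm' t).memLp.toLp (m' t) : Lp ℂ ∞ μ),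
          Lp.coeFn_sub ((hm r).memLp.toLp (m r)) ((hm t).memLp.toLp (m t) : Lp ℂ ∞ μ),
          Lp.coeFn_smul (r - t) ((hm' t).memLp.toLp (m' t) : Lp ℂ ∞ μ),
          (hm r).memLp.coeFn_toLp (μ := μ), (hm t).memLp.coeFn_toLp (μ := μ),
          (hm' t).memLp.coeFn_toLp (μ := μ)] with x a1 a2 a3 a4 a5 a6
        rw [a1, Pi.sub_apply, a2, Pi.sub_apply, a3, Pi.smul_apply, a4, a5, a6]
        exact hpt x
    · have : (fun r => (r - t) ^ 2) = fun r => (r - t) * (r - t) := by funext r; ring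
      rw [this]
      simpa using! (Asymptotics.isBigO_refl (fun r : ℝ => r - t) (𝓝 t)).mul_isLittleO
        ((Asymptotics.isLittleO_one_iff ℝ).2
          (by simpa using (continuous_id.sub continuous_const).tendsto (f := fun r => r - t) t))
  -- L^∞ maps continuously and linearly into the operators on L², so the derivative in L^∞ passes to
  -- the operators.
  have := ((ContinuousLinearMap.lsmul ℝ ℂ (E := ℂ)).holderL μ ∞ 2 2).hasFDerivAt.comp_hasDerivAt t
    key
  convert! this using 1
  · funext r
    simp [mulOp, (hm r).memLp]
  · simp [mulOp, (hm' t).memLp]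

/-! ### Linear evolution equations with multiplication operators -/

/-- Continuity at 0 connects the equation, which is only available for t > 0, to the initial data.
-/
theorem eq_of_hasDerivAt_zero {E : Type*} [NormedAddCommGroup E] [NormedSpace ℝ E]
    [CompleteSpace E] {f : ℝ → E} (hc : ContinuousOn f (Set.Ici 0))
    (hd : ∀ t, 0 < t → HasDerivAt f 0 t) {t : ℝ} (ht : 0 ≤ t) : f t = f 0 := by
  have := intervalIntegral.integral_eq_sub_of_hasDerivAt_of_le ht (f' := fun _ => (0 : E))
    (hc.mono Set.Icc_subset_Ici_self) (fun x hx => hd x hx.1) (by simp)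
  rw [intervalIntegral.integral_zero] at this
  exact (sub_eq_zero.1 this.symm)

theorem hasDerivAt_mulOp_exp {l : X → ℂ} (hl : IsBddMeas l) (t : ℝ) :
    HasDerivAt (fun r : ℝ => mulOp μ (fun x => Complex.exp (r * l x)))
      (mulOp μ (fun x => l x * Complex.exp (t * l x))) t := by
  have hb : ∀ t : ℝ, IsBddMeas (fun x => Complex.exp (t * l x)) := fun t =>
    ((isBddMeas_const _).mul hl).exp
  have hd : ∀ (t : ℝ) (x : X), HasDerivAt (fun r : ℝ => Complex.exp (r * l x))
      (l x * Complex.exp (t * l x)) t := fun t x => by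
    have := ((Complex.ofRealCLM.hasDerivAt (x := t)).mul_const (l x)).cexp
    simpa [mul_comm] using! this
  refine hasDerivAt_mulOp hb (fun t => hl.mul (hb t)) hd
    (m'' := fun t x => l x * (l x * Complex.exp (t * l x)))
    (fun t x => (hd t x).const_mul _) (fun R => ?_) t
  obtain ⟨-, C, hC⟩ := hl
  refine ⟨C * (C * Real.exp (R * C)), fun t ht x => ?_⟩
  have h0 : 0 ≤ C := (norm_nonneg _).trans (hC x)
  rw [norm_mul, norm_mul, Complex.norm_exp]
  gcongr
  · exact hC x
  · exact hC x
  · refine (Complex.re_le_norm _).trans ?_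
    rw [norm_mul, Complex.norm_real]
    exact mul_le_mul ht (hC x) (norm_nonneg _) ((abs_nonneg _).trans ht)

/-- The integrating factor e^{-tl} makes e^{-tl}Y constant. -/
theorem eq_mulOp_exp {l : X → ℂ} (hl : IsBddMeas l) {Y : ℝ → Lp ℂ 2 μ}
    (hc : ContinuousOn Y (Set.Ici 0)) (hd : ∀ t, 0 < t → HasDerivAt Y (mulOp μ l (Y t)) t)
    {t : ℝ} (ht : 0 ≤ t) : Y t = mulOp μ (fun x => Complex.exp (t * l x)) (Y 0) := by
  have hb : ∀ t : ℝ, IsBddMeas (fun x => Complex.exp (t * l x)) := fun t =>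
    ((isBddMeas_const _).mul hl).exp
  have hb' : ∀ t : ℝ, IsBddMeas (fun x => Complex.exp (t * -l x)) := fun t =>
    ((isBddMeas_const _).mul hl.neg).exp
  have h := eq_of_hasDerivAt_zero (f := fun r => mulOp μ (fun x => Complex.exp (r * -l x)) (Y r))
    (fun r hr => ((hasDerivAt_mulOp_exp hl.neg r).continuousAt.continuousWithinAt.clm_apply
      (hc r hr))) (fun r hr => by
      have h1 := (hasDerivAt_mulOp_exp (μ := μ) hl.neg r).clm_apply (hd r hr)
      rw [mulOp_mulOp (hb' r) hl, ← mulOp_add_fun (hl.neg.mul (hb' r)) ((hb' r).mul hl)] at h1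
      convert h1 using 1
      rw [← mulOp_zero (Y r)]
      congr 2
      funext x
      ring) ht
  have h2 := congrArg (mulOp μ (fun x => Complex.exp (t * l x))) h
  simp only [Complex.ofReal_zero, zero_mul, Complex.exp_zero, mulOp_one] at h2
  rw [← h2, mulOp_mulOp (hb t) (hb' t)]
  conv_lhs => rw [← mulOp_one (Y t)]
  congr 2
  funext x
  rw [← Complex.exp_add]
  simp

/-- `∫₀ᵗ exp(zr) dr`. -/
def expInt (z : ℂ) (t : ℝ) : ℂ := ∫ r in (0 : ℝ)..t, Complex.exp (r * z)

/-- `τ⁻¹ ∫₀ᵗ exp(-(t-r)/τ) exp(zr) dr`. -/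
def duhamel (τ : ℝ) (z : ℂ) (t : ℝ) : ℂ :=
  (Real.exp (-(t / τ)) * (1 / τ) : ℝ) * expInt (z + (1 / τ : ℝ)) t

/-- The integral form stays regular when the exponent vanishes. For `duhamel` this is the resonance
1+τz = 0, where the quotient in `duhamel_eq` has no meaning. -/
theorem continuous_expInt (t : ℝ) : Continuous fun z => expInt z t := by
  unfold expInt
  apply intervalIntegral.continuous_parametric_intervalIntegral_of_continuous'
  fun_prop

theorem hasDerivAt_expInt (z : ℂ) (t : ℝ) :
    HasDerivAt (fun r => expInt z r) (Complex.exp (t * z)) t := by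
  have hc : Continuous fun r : ℝ => Complex.exp (r * z) := by fun_prop
  exact intervalIntegral.integral_hasDerivAt_right (hc.intervalIntegrable _ _)
    hc.aestronglyMeasurable.stronglyMeasurableAtFilter hc.continuousAt

theorem isBddMeas_expInt {l : X → ℂ} (hl : IsBddMeas l) (t : ℝ) :
    IsBddMeas (fun x => expInt (l x) t) := by
  refine ⟨(continuous_expInt t).measurable.comp hl.1, Real.exp (|t| * hl.2.choose) * |t - 0|,
    fun x => ?_⟩
  refine intervalIntegral.norm_integral_le_of_norm_le_const fun r hr => ?_
  rw [Complex.norm_exp]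
  refine Real.exp_le_exp.2 ((Complex.re_le_norm _).trans ?_)
  rw [norm_mul, Complex.norm_real]
  refine mul_le_mul ?_ (hl.2.choose_spec x) (norm_nonneg _) (abs_nonneg _)
  rw [Real.norm_eq_abs]
  rcases Set.mem_uIoc.1 hr with ⟨h1, h2⟩ | ⟨h1, h2⟩
  · rw [abs_of_pos h1]; exact h2.trans (le_abs_self _)
  · rw [abs_of_nonpos h2, abs_of_neg (h1.trans_le h2)]; linarith

theorem isBddMeas_duhamel {l : X → ℂ} (hl : IsBddMeas l) (τ t : ℝ) :
    IsBddMeas (fun x => duhamel τ (l x) t) :=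
  (isBddMeas_const _).mul (isBddMeas_expInt (hl.add (isBddMeas_const _)) t)

theorem hasDerivAt_mulOp_expInt {l : X → ℂ} (hl : IsBddMeas l) (t : ℝ) :
    HasDerivAt (fun r : ℝ => mulOp μ (fun x => expInt (l x) r))
      (mulOp μ (fun x => Complex.exp (t * l x))) t := by
  have hb : ∀ t : ℝ, IsBddMeas (fun x => Complex.exp (t * l x)) := fun t =>
    ((isBddMeas_const _).mul hl).exp
  refine hasDerivAt_mulOp (isBddMeas_expInt hl) hb (fun t x => hasDerivAt_expInt _ t)
    (m'' := fun t x => l x * Complex.exp (t * l x)) (fun t x => ?_) (fun R => ?_) t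
  · have := ((Complex.ofRealCLM.hasDerivAt (x := t)).mul_const (l x)).cexp
    simpa [mul_comm] using! this
  · obtain ⟨-, C, hC⟩ := hl
    refine ⟨C * Real.exp (R * C), fun t ht x => ?_⟩
    have h0 : 0 ≤ C := (norm_nonneg _).trans (hC x)
    rw [norm_mul, Complex.norm_exp]
    gcongr
    · exact hC x
    · refine (Complex.re_le_norm _).trans ?_
      rw [norm_mul, Complex.norm_real]
      exact mul_le_mul ht (hC x) (norm_nonneg _) ((abs_nonneg _).trans ht)

/-- With the integrating factor e^{t/τ}, the function e^{t/τ}Z minus the primitive of the forcing is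
constant. -/
theorem eq_mulOp_duhamel {τ : ℝ} (hτ : 0 < τ) {l₁ l₂ : X → ℂ} (h₁ : IsBddMeas l₁)
    (h₂ : IsBddMeas l₂) {Z Z' : ℝ → Lp ℂ 2 μ} (A B : Lp ℂ 2 μ)
    (hc : ContinuousOn Z (Set.Ici 0)) (hd : ∀ t, 0 < t → HasDerivAt Z (Z' t) t)
    (he : ∀ t, 0 < t → τ • Z' t + Z t =
      mulOp μ (fun x => Complex.exp (t * l₁ x)) A - mulOp μ (fun x => Complex.exp (t * l₂ x)) B)
    {t : ℝ} (ht : 0 ≤ t) :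
    Z t = Real.exp (-(t / τ)) • Z 0 + mulOp μ (fun x => duhamel τ (l₁ x) t) A -
      mulOp μ (fun x => duhamel τ (l₂ x) t) B := by
  have hk₁ := h₁.add (isBddMeas_const ((1 / τ : ℝ) : ℂ))
  have hk₂ := h₂.add (isBddMeas_const ((1 / τ : ℝ) : ℂ))
  -- The integrating factor is absorbed into the exponent as the shift by 1/τ.
  have hexp : ∀ {l : X → ℂ} (_ : IsBddMeas l) (r : ℝ) (f : Lp ℂ 2 μ),
      mulOp μ (fun x => Complex.exp (r * (l x + (1 / τ : ℝ)))) f =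
        Real.exp (r / τ) • mulOp μ (fun x => Complex.exp (r * l x)) f := fun hl r f => by
    rw [← mulOp_smul_fun ((isBddMeas_const _).mul hl).exp]
    congr 2
    funext x
    rw [Complex.ofReal_exp, ← Complex.exp_add]
    congr 1
    push_cast
    ring
  have hdE : ∀ r : ℝ, HasDerivAt (fun r : ℝ => Real.exp (r / τ)) (Real.exp (r / τ) * (1 / τ)) r :=
    fun r => ((hasDerivAt_id r).div_const τ).exp
  have h := eq_of_hasDerivAt_zero (f := fun r => Real.exp (r / τ) • Z r -
      (1 / τ) • (mulOp μ (fun x => expInt (l₁ x + (1 / τ : ℝ)) r) A -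
        mulOp μ (fun x => expInt (l₂ x + (1 / τ : ℝ)) r) B))
    (fun r hr => ((hdE r).continuousAt.continuousWithinAt.smul (hc r hr)).sub
      ((((hasDerivAt_mulOp_expInt hk₁ r).continuousAt.continuousWithinAt.clm_apply
        continuousWithinAt_const).sub
      ((hasDerivAt_mulOp_expInt hk₂ r).continuousAt.continuousWithinAt.clm_apply
        continuousWithinAt_const)).fun_const_smul _)) (fun r hr => by
      have h1 := ((hdE r).smul (hd r hr)).sub
        ((((hasDerivAt_mulOp_expInt (μ := μ) hk₁ r).clm_apply (hasDerivAt_const r A)).sub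
        ((hasDerivAt_mulOp_expInt (μ := μ) hk₂ r).clm_apply (hasDerivAt_const r B))).const_smul
          (1 / τ))
      convert! h1 using 1
      rw [hexp h₁, hexp h₂, map_zero, map_zero, add_zero, add_zero, ← smul_sub, ← he r hr]
      have : 1 / τ * Real.exp (r / τ) * τ = Real.exp (r / τ) := by field_simp
      rw [smul_add, smul_add, smul_smul, smul_smul, smul_smul, this,
        mul_comm (Real.exp (r / τ)) (1 / τ)]
      abel) ht
  have hz : ∀ z, expInt z 0 = 0 := fun z => by simp [expInt]
  simp only [hz, mulOp_zero, zero_div, Real.exp_zero, one_smul, sub_zero, smul_zero] at h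
  have h3 : Z t = Real.exp (-(t / τ)) • (Z 0 +
      (1 / τ) • (mulOp μ (fun x => expInt (l₁ x + (1 / τ : ℝ)) t) A -
        mulOp μ (fun x => expInt (l₂ x + (1 / τ : ℝ)) t) B)) := by
    rw [← h, sub_add_cancel, smul_smul, ← Real.exp_add]
    simp
  unfold duhamel
  rw [h3, mulOp_smul_fun (isBddMeas_expInt hk₁ t), mulOp_smul_fun (isBddMeas_expInt hk₂ t),
    smul_add, smul_smul, smul_sub]
  abel

end Multiplication

/-! ### Characteristic roots of `λ² + βλ + a` -/

/-- A square root of the discriminant `β² / 4 - a`. -/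
def sqrtDisc (β a : ℝ) : ℂ := √(β ^ 2 / 4 - a) + √(a - β ^ 2 / 4) * Complex.I

def root₁ (β a : ℝ) : ℂ := -(β / 2 : ℝ) + sqrtDisc β a

def root₂ (β a : ℝ) : ℂ := -(β / 2 : ℝ) - sqrtDisc β a

/-- `Real.sqrt` is 0 at negative arguments, so one of the two summands of `sqrtDisc` always
vanishes. No branch of the complex square root is needed. -/
theorem sqrtDisc_sq (β a : ℝ) : sqrtDisc β a ^ 2 = (β ^ 2 / 4 - a : ℝ) := by
  rcases le_total a (β ^ 2 / 4) with h | h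
  · rw [sqrtDisc, Real.sqrt_eq_zero_of_nonpos (x := a - β ^ 2 / 4) (by linarith)]
    rw [Complex.ofReal_zero, zero_mul, add_zero, ← Complex.ofReal_pow,
      Real.sq_sqrt (by linarith)]
  · rw [sqrtDisc, Real.sqrt_eq_zero_of_nonpos (x := β ^ 2 / 4 - a) (by linarith)]
    rw [Complex.ofReal_zero, zero_add, mul_pow, ← Complex.ofReal_pow,
      Real.sq_sqrt (by linarith), Complex.I_sq]
    push_cast
    ring

theorem root₁_add_root₂ (β a : ℝ) : root₁ β a + root₂ β a = -β := by
  simp only [root₁, root₂]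
  push_cast
  ring

theorem root₁_sub_root₂ (β a : ℝ) : root₁ β a - root₂ β a = 2 * sqrtDisc β a := by
  simp only [root₁, root₂]
  ring

theorem root₁_mul_root₂ (β a : ℝ) : root₁ β a * root₂ β a = a := by
  have : root₁ β a * root₂ β a = ((β / 2 : ℝ) : ℂ) ^ 2 - sqrtDisc β a ^ 2 := by
    simp only [root₁, root₂]
    ring
  rw [this, sqrtDisc_sq]
  push_cast
  ring

section

variable {Ω : Type*} [MeasurableSpace Ω] {μ : Measure Ω} {β a : Ω → ℝ}

theorem isBddMeas_sqrtDisc (hβ : IsBddMeas (fun x => (β x : ℂ)))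
    (ha : IsBddMeas (fun x => (a x : ℂ))) : IsBddMeas (fun x => sqrtDisc (β x) (a x)) := by
  have hβm : Measurable β := Complex.measurable_re.comp hβ.1
  have ham : Measurable a := Complex.measurable_re.comp ha.1
  have hm : Measurable (fun x => sqrtDisc (β x) (a x)) := by
    unfold sqrtDisc
    fun_prop
  obtain ⟨-, C, hC⟩ := hβ
  obtain ⟨-, C', hC'⟩ := ha
  have hb : ∀ x, ‖sqrtDisc (β x) (a x)‖ ≤ √(C ^ 2 + C') := by
    intro x
    refine Real.le_sqrt_of_sq_le ?_
    have h1 := hC x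
    have h2 := hC' x
    rw [Complex.norm_real, Real.norm_eq_abs] at h1 h2
    have h3 : |β x| ^ 2 ≤ C ^ 2 := pow_le_pow_left₀ (abs_nonneg _) h1 2
    rw [sq_abs] at h3
    rw [← norm_pow, sqrtDisc_sq, Complex.norm_real, Real.norm_eq_abs]
    refine (abs_sub _ _).trans (add_le_add ?_ h2)
    rw [abs_of_nonneg (by positivity)]
    linarith [sq_nonneg (β x)]
  exact ⟨hm, _, hb⟩

theorem isBddMeas_root₁ (hβ : IsBddMeas (fun x => (β x : ℂ)))
    (ha : IsBddMeas (fun x => (a x : ℂ))) : IsBddMeas (fun x => root₁ (β x) (a x)) := by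
  have h := ((isBddMeas_const (-(1 / 2))).mul hβ).add (isBddMeas_sqrtDisc hβ ha)
  convert h using 2 with x
  simp only [root₁]
  push_cast
  ring

theorem isBddMeas_root₂ (hβ : IsBddMeas (fun x => (β x : ℂ)))
    (ha : IsBddMeas (fun x => (a x : ℂ))) : IsBddMeas (fun x => root₂ (β x) (a x)) := by
  have h := ((isBddMeas_const (-(1 / 2))).mul hβ).add (isBddMeas_sqrtDisc hβ ha).neg
  convert h using 2 with x
  simp only [root₂]
  push_cast
  ring

theorem IsBddMeas.pow {m : Ω → ℂ} (hm : IsBddMeas m) (j : ℕ) : IsBddMeas (fun x => m x ^ j) := by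
  induction j with
  | zero => simpa using isBddMeas_const 1
  | succ k ih => simpa [pow_succ] using ih.mul hm

/-- The solution formula for `(τ∂_t + 1)(X_tt + βX_t + aX) = 0` with bounded multiplication
operators `β`, `a` on `L²`. -/
theorem evolution_formula {τ : ℝ} (hτ : 0 < τ) (hβ : IsBddMeas (fun x => (β x : ℂ)))
    (ha : IsBddMeas (fun x => (a x : ℂ))) {X : Fin 3 → ℝ → Lp ℂ 2 μ}
    {Y Y' : ℝ → Lp ℂ 2 μ} (hc : ∀ j, ContinuousOn (X j) (Set.Ici 0))
    (hd₀ : ∀ t, 0 < t → HasDerivAt (X 0) (X 1 t) t)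
    (hd₁ : ∀ t, 0 < t → HasDerivAt (X 1) (X 2 t) t)
    (hY : ∀ t, 0 < t → Y t = X 2 t + mulOp μ (fun x => (β x : ℂ)) (X 1 t) +
      mulOp μ (fun x => (a x : ℂ)) (X 0 t))
    (hYd : ∀ t, 0 < t → HasDerivAt Y (Y' t) t) (hYe : ∀ t, 0 < t → τ • Y' t + Y t = 0)
    (j : Fin 3) {t : ℝ} (ht : 0 ≤ t) :
    ∀ᵐ x ∂μ, (root₁ (β x) (a x) - root₂ (β x) (a x)) * X j t x =
      Real.exp (-(t / τ)) * ((root₁ (β x) (a x) - root₂ (β x) (a x)) * X j 0 x) +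
      duhamel τ (root₁ (β x) (a x)) t * (root₁ (β x) (a x) ^ (j : ℕ) *
        ((X 1 0 x + τ * X 2 0 x) - root₂ (β x) (a x) * (X 0 0 x + τ * X 1 0 x))) -
      duhamel τ (root₂ (β x) (a x)) t * (root₂ (β x) (a x) ^ (j : ℕ) *
        ((X 1 0 x + τ * X 2 0 x) - root₁ (β x) (a x) * (X 0 0 x + τ * X 1 0 x))) := by
  have b₁ := isBddMeas_root₁ hβ ha
  have b₂ := isBddMeas_root₂ hβ ha
  set l₁ : _ → ℂ := fun x => root₁ (β x) (a x) with hl₁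
  set l₂ : _ → ℂ := fun x => root₂ (β x) (a x) with hl₂
  have hsum : ∀ f, mulOp μ (fun x => (β x : ℂ)) f = -(mulOp μ l₁ f) - mulOp μ l₂ f := fun f => by
    rw [← mulOp_neg_fun b₁, sub_eq_add_neg, ← mulOp_neg_fun b₂, ← mulOp_add_fun b₁.neg b₂.neg]
    congr 2
    funext x
    have := root₁_add_root₂ (β x) (a x)
    simp only [hl₁, hl₂]
    linear_combination this
  have hprod : ∀ f, mulOp μ (fun x => (a x : ℂ)) f = mulOp μ l₁ (mulOp μ l₂ f) := fun f => by
    rw [mulOp_mulOp b₁ b₂]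
    congr 2
    funext x
    exact (root₁_mul_root₂ (β x) (a x)).symm
  have hcomm : ∀ {m m' : _ → ℂ} (_ : IsBddMeas m) (_ : IsBddMeas m') (f : Lp ℂ 2 μ),
      mulOp μ m (mulOp μ m' f) = mulOp μ m' (mulOp μ m f) := fun hm hm' f => by
    rw [mulOp_mulOp hm hm', mulOp_mulOp hm' hm]
    congr 2
    funext x
    exact mul_comm _ _
  -- the second derivative is differentiable
  have hd₂ : ∀ t, 0 < t → HasDerivAt (X 2)
      (Y' t - mulOp μ (fun x => (β x : ℂ)) (X 2 t) - mulOp μ (fun x => (a x : ℂ)) (X 1 t)) t := by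
    intro t ht
    have h1 := ((hYd t ht).sub ((mulOp μ (fun x => (β x : ℂ))).hasFDerivAt.comp_hasDerivAt t
      (hd₁ t ht))).sub ((mulOp μ (fun x => (a x : ℂ))).hasFDerivAt.comp_hasDerivAt t (hd₀ t ht))
    refine h1.congr_of_eventuallyEq ?_
    filter_upwards [lt_mem_nhds ht] with r hr
    change X 2 r = Y r - mulOp μ (fun x => (β x : ℂ)) (X 1 r) - mulOp μ (fun x => (a x : ℂ)) (X 0 r)
    rw [hY r hr]
    abel
  -- Commuting τ∂ₜ+1 past the second-order factor leaves ψ''+βψ'+aψ = 0 for ψ = X+τX'.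
  set ψ : ℝ → Lp ℂ 2 μ := fun t => X 0 t + τ • X 1 t with hψ
  set ψ' : ℝ → Lp ℂ 2 μ := fun t => X 1 t + τ • X 2 t with hψ'
  have hψc : ContinuousOn ψ (Set.Ici 0) := (hc 0).add ((hc 1).const_smul τ)
  have hψ'c : ContinuousOn ψ' (Set.Ici 0) := (hc 1).add ((hc 2).const_smul τ)
  have hψd : ∀ t, 0 < t → HasDerivAt ψ (ψ' t) t := fun t ht =>
    (hd₀ t ht).add ((hd₁ t ht).const_smul τ)
  have hψ'd : ∀ t, 0 < t → HasDerivAt ψ'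
      (-mulOp μ (fun x => (β x : ℂ)) (ψ' t) - mulOp μ (fun x => (a x : ℂ)) (ψ t)) t := by
    intro t ht
    refine ((hd₁ t ht).add ((hd₂ t ht).const_smul τ)).congr_deriv (Eq.symm ?_)
    have h1 := hYe t ht
    rw [hY t ht] at h1
    have h2 : τ • Y' t = -(X 2 t + mulOp μ (fun x => (β x : ℂ)) (X 1 t) +
      mulOp μ (fun x => (a x : ℂ)) (X 0 t)) := eq_neg_of_add_eq_zero_left h1
    simp only [hψ, hψ', map_add, map_smul, smul_sub, h2]
    abel
  -- The factorisation (∂ₜ-m)(∂ₜ-m')ψ = 0: the function ψ'-m'ψ solves a first-order equation. It is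
  -- used with the two roots in both orders.
  have key : ∀ {m m' : _ → ℂ} (hm : IsBddMeas m) (hm' : IsBddMeas m')
      (_ : ∀ f, mulOp μ (fun x => (β x : ℂ)) f = -(mulOp μ m f) - mulOp μ m' f)
      (_ : ∀ f, mulOp μ (fun x => (a x : ℂ)) f = mulOp μ m (mulOp μ m' f)) (t : ℝ) (_ : 0 ≤ t),
      ψ' t - mulOp μ m' (ψ t) =
        mulOp μ (fun x => Complex.exp (t * m x)) (ψ' 0 - mulOp μ m' (ψ 0)) := by
    intro m m' hm hm' h1 h2 t ht
    refine eq_mulOp_exp hm (Y := fun t => ψ' t - mulOp μ m' (ψ t))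
      (hψ'c.sub ((mulOp μ m').continuous.comp_continuousOn hψc)) (fun r hr => ?_) ht
    convert! (hψ'd r hr).sub ((mulOp μ m').hasFDerivAt.comp_hasDerivAt r (hψd r hr)) using 1
    rw [h1, h2, map_sub]
    abel
  have hR₁ := key b₁ b₂ hsum hprod
  have hR₂ := key b₂ b₁ (fun f => by rw [hsum]; abel) (fun f => by rw [hprod, hcomm b₁ b₂])
  set R₁ := ψ' 0 - mulOp μ l₂ (ψ 0) with hR₁0
  set R₂ := ψ' 0 - mulOp μ l₁ (ψ 0) with hR₂0
  have be₁ : ∀ t : ℝ, IsBddMeas (fun x => Complex.exp (t * l₁ x)) := fun t =>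
    ((isBddMeas_const _).mul b₁).exp
  have be₂ : ∀ t : ℝ, IsBddMeas (fun x => Complex.exp (t * l₂ x)) := fun t =>
    ((isBddMeas_const _).mul b₂).exp
  -- the inhomogeneous first order equation
  have main : mulOp μ l₁ (X j t) - mulOp μ l₂ (X j t) =
      Real.exp (-(t / τ)) • (mulOp μ l₁ (X j 0) - mulOp μ l₂ (X j 0)) +
        mulOp μ (fun x => duhamel τ (l₁ x) t) (mulOp μ (fun x => l₁ x ^ (j : ℕ)) R₁) -
        mulOp μ (fun x => duhamel τ (l₂ x) t) (mulOp μ (fun x => l₂ x ^ (j : ℕ)) R₂) := by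
    -- With Rᵢ(t) the first-order quantities above, (l₁-l₂)∂ₜʲψ = l₁ʲR₁(t) - l₂ʲR₂(t). Multiplying
    -- by l₁-l₂ instead of dividing keeps the operators bounded and allows double roots.
    have aux : ∀ Xd : ℝ → Lp ℂ 2 μ, (∀ t, 0 < t → HasDerivAt (X j) (Xd t) t) →
        (∀ t, 0 < t → mulOp μ l₁ (X j t + τ • Xd t) - mulOp μ l₂ (X j t + τ • Xd t) =
          mulOp μ (fun x => l₁ x ^ (j : ℕ)) (ψ' t - mulOp μ l₂ (ψ t)) -
          mulOp μ (fun x => l₂ x ^ (j : ℕ)) (ψ' t - mulOp μ l₁ (ψ t))) →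
        mulOp μ l₁ (X j t) - mulOp μ l₂ (X j t) =
      Real.exp (-(t / τ)) • (mulOp μ l₁ (X j 0) - mulOp μ l₂ (X j 0)) +
        mulOp μ (fun x => duhamel τ (l₁ x) t) (mulOp μ (fun x => l₁ x ^ (j : ℕ)) R₁) -
        mulOp μ (fun x => duhamel τ (l₂ x) t) (mulOp μ (fun x => l₂ x ^ (j : ℕ)) R₂) := by
      intro Xd h1 h2
      refine eq_mulOp_duhamel hτ b₁ b₂ (Z := fun t => mulOp μ l₁ (X j t) - mulOp μ l₂ (X j t))
        (Z' := fun t => mulOp μ l₁ (Xd t) - mulOp μ l₂ (Xd t)) _ _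
        (((mulOp μ l₁).continuous.comp_continuousOn (hc j)).sub
          ((mulOp μ l₂).continuous.comp_continuousOn (hc j)))
        (fun r hr => ((mulOp μ l₁).hasFDerivAt.comp_hasDerivAt r (h1 r hr)).sub
          ((mulOp μ l₂).hasFDerivAt.comp_hasDerivAt r (h1 r hr))) (fun r hr => ?_) ht
      rw [hcomm (be₁ r) (b₁.pow _), hcomm (be₂ r) (b₂.pow _), ← hR₁ r hr.le, ← hR₂ r hr.le,
        ← h2 r hr]
      simp only [map_add, map_smul, smul_sub]
      abel
    fin_cases j
    · refine aux (X 1) hd₀ fun t ht => ?_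
      simp only [Fin.zero_eta, pow_zero, mulOp_one]
      change mulOp μ l₁ (ψ t) - mulOp μ l₂ (ψ t) = _
      abel
    · refine aux (X 2) hd₁ fun t ht => ?_
      simp only [Fin.mk_one, pow_one]
      change mulOp μ l₁ (ψ' t) - mulOp μ l₂ (ψ' t) = _
      rw [map_sub, map_sub, hcomm b₁ b₂]
      abel
    -- For j = 2 the third derivative of X is needed. It comes from `hd₂`, and ψ'' is eliminated by
    -- the equation.
    · refine aux _ hd₂ fun t ht => ?_
      have h1 := hYe t ht
      rw [hY t ht] at h1
      have h2 : τ • Y' t = -(X 2 t + mulOp μ (fun x => (β x : ℂ)) (X 1 t) +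
        mulOp μ (fun x => (a x : ℂ)) (X 0 t)) := eq_neg_of_add_eq_zero_left h1
      have h3 : X 2 t + τ • (Y' t - mulOp μ (fun x => (β x : ℂ)) (X 2 t) -
          mulOp μ (fun x => (a x : ℂ)) (X 1 t)) =
          -mulOp μ (fun x => (β x : ℂ)) (ψ' t) - mulOp μ (fun x => (a x : ℂ)) (ψ t) := by
        simp only [hψ, hψ', map_add, map_smul, smul_sub, h2]
        abel
      have h4 : ∀ {m : _ → ℂ} (_ : IsBddMeas m) (f : Lp ℂ 2 μ),
          mulOp μ (fun x => m x ^ 2) f = mulOp μ m (mulOp μ m f) := fun hm f => by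
        rw [mulOp_mulOp hm hm]
        simp only [sq]
      simp only [Fin.reduceFinMk]
      rw [h3]
      change _ = mulOp μ (fun x => l₁ x ^ 2) _ - mulOp μ (fun x => l₂ x ^ 2) _
      rw [h4 b₁, h4 b₂]
      simp only [hsum, hprod, map_sub, map_neg, hcomm b₁ b₂]
      abel
  have ex : ∀ f g : Lp ℂ 2 μ, ∀ᵐ x ∂μ, (f - g : Lp ℂ 2 μ) x = f x - g x := fun f g => by
    filter_upwards [Lp.coeFn_sub f g] with x hx
    rw [hx, Pi.sub_apply]
  have ea : ∀ f g : Lp ℂ 2 μ, ∀ᵐ x ∂μ, (f + g : Lp ℂ 2 μ) x = f x + g x := fun f g => by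
    filter_upwards [Lp.coeFn_add f g] with x hx
    rw [hx, Pi.add_apply]
  have em : ∀ (c : ℝ) (f : Lp ℂ 2 μ), ∀ᵐ x ∂μ, (c • f : Lp ℂ 2 μ) x = c * f x := fun c f => by
    filter_upwards [Lp.coeFn_smul c f] with x hx
    rw [hx, Pi.smul_apply, Complex.real_smul]
  filter_upwards [ex (mulOp μ l₁ (X j t)) (mulOp μ l₂ (X j t)), coeFn_mulOp b₁ (X j t),
    coeFn_mulOp b₂ (X j t), ex (Real.exp (-(t / τ)) • (mulOp μ l₁ (X j 0) - mulOp μ l₂ (X j 0)) +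
        mulOp μ (fun x => duhamel τ (l₁ x) t) (mulOp μ (fun x => l₁ x ^ (j : ℕ)) R₁))
        (mulOp μ (fun x => duhamel τ (l₂ x) t) (mulOp μ (fun x => l₂ x ^ (j : ℕ)) R₂)),
    ea (Real.exp (-(t / τ)) • (mulOp μ l₁ (X j 0) - mulOp μ l₂ (X j 0)))
        (mulOp μ (fun x => duhamel τ (l₁ x) t) (mulOp μ (fun x => l₁ x ^ (j : ℕ)) R₁)),
    em (Real.exp (-(t / τ))) (mulOp μ l₁ (X j 0) - mulOp μ l₂ (X j 0)),
    ex (mulOp μ l₁ (X j 0)) (mulOp μ l₂ (X j 0)), coeFn_mulOp b₁ (X j 0), coeFn_mulOp b₂ (X j 0),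
    coeFn_mulOp (isBddMeas_duhamel b₁ τ t) (mulOp μ (fun x => l₁ x ^ (j : ℕ)) R₁),
    coeFn_mulOp (isBddMeas_duhamel b₂ τ t) (mulOp μ (fun x => l₂ x ^ (j : ℕ)) R₂),
    coeFn_mulOp (b₁.pow j) R₁, coeFn_mulOp (b₂.pow j) R₂, ex (ψ' 0) (mulOp μ l₂ (ψ 0)),
    ex (ψ' 0) (mulOp μ l₁ (ψ 0)), coeFn_mulOp b₁ (ψ 0), coeFn_mulOp b₂ (ψ 0),
    ea (X 0 0) (τ • X 1 0), ea (X 1 0) (τ • X 2 0), em τ (X 1 0), em τ (X 2 0)] with x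
    h1 h2 h3 h4 h5 h6 h7 h8 h9 h10 h11 h12 h13 h14 h15 h16 h17 h18 h19 h20 h21
  have hx := congrArg (fun f : Lp ℂ 2 μ => f x) main
  beta_reduce at hx
  rw [h1, h2, h3, h4, h5, h6, h7, h8, h9, h10, h11, h12, h13, h14, h15, h16, h17, h18, h19, h20,
    h21] at hx
  simp only [hl₁, hl₂] at hx
  linear_combination hx

end

/-! ### The solution formula on the Fourier side -/

/-- The modulus `|ξ|` of the angular frequency `ξ = 2πη`. -/
def rad {n : ℕ} (η : Rn n) : ℝ := 2 * Real.pi * ‖η‖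

theorem rad_nonneg {n : ℕ} (η : Rn n) : 0 ≤ rad η := by unfold rad; positivity

theorem continuous_rad {n : ℕ} : Continuous (rad : Rn n → ℝ) := by unfold rad; fun_prop

/-- The `j`-th time derivative at time `t` of the solution of `(τ∂_t + 1)(y'' + βy' + ay) = 0`
with the Cauchy data `F`. -/
def solSymbol (τ β a t : ℝ) (j : Fin 3) (F : Fin 3 → ℂ) : ℂ :=
  Real.exp (-(t / τ)) * F j +
    (root₁ β a ^ (j : ℕ) * duhamel τ (root₁ β a) t *
        ((F 1 + τ * F 2) - root₂ β a * (F 0 + τ * F 1)) -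
      root₂ β a ^ (j : ℕ) * duhamel τ (root₂ β a) t *
        ((F 1 + τ * F 2) - root₁ β a * (F 0 + τ * F 1))) / (root₁ β a - root₂ β a)

theorem nontrivial_Rn {n : ℕ} (hn : 2 ≤ n) : Nontrivial (Rn n) :=
  Module.nontrivial_of_finrank_pos (R := ℝ) (by rw [finrank_euclideanSpace_fin]; omega)

theorem ae_rad_pos {n : ℕ} (hn : 2 ≤ n) : ∀ᵐ η : Rn n, 0 < rad η := by
  have := nontrivial_Rn hn
  have h0 : ∀ᵐ η : Rn n, η ∉ Metric.sphere (0 : Rn n) 0 :=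
    measure_eq_zero_iff_ae_notMem.1 (Measure.addHaar_sphere volume 0 0)
  filter_upwards [h0] with η hη
  have : η ≠ 0 := by simpa using hη
  unfold rad
  positivity

/-- The discriminant vanishes at positive ρ only if dρ^{2α} = 2c₀ρ, that is ρ^{1-2α} = d/(2c₀). This
is a sphere, hence a null set. -/
theorem ae_root₁_sub_root₂_ne_zero {n : ℕ} (hn : 2 ≤ n) {c₀ d α : ℝ} (hc₀ : 0 < c₀) (hd : 0 < d)
    (hα : α < 1 / 2) : ∀ᵐ η : Rn n,
      root₁ (d * rad η ^ (2 * α)) (c₀ ^ 2 * rad η ^ 2) -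
        root₂ (d * rad η ^ (2 * α)) (c₀ ^ 2 * rad η ^ 2) ≠ 0 := by
  have := nontrivial_Rn hn
  have h1 : ∀ᵐ η : Rn n, η ∉ Metric.sphere (0 : Rn n)
      ((d / (2 * c₀)) ^ (1 / (1 - 2 * α)) / (2 * Real.pi)) :=
    measure_eq_zero_iff_ae_notMem.1 (Measure.addHaar_sphere volume 0 _)
  filter_upwards [ae_rad_pos hn, h1] with η hη h1 h2
  apply h1
  rw [root₁_sub_root₂, mul_eq_zero, or_iff_right two_ne_zero] at h2
  have h3 := sqrtDisc_sq (d * rad η ^ (2 * α)) (c₀ ^ 2 * rad η ^ 2)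
  rw [h2] at h3
  have h4 : (d * rad η ^ (2 * α)) ^ 2 / 4 - c₀ ^ 2 * rad η ^ 2 = 0 := by
    rw [← Complex.ofReal_eq_zero, ← h3]
    norm_num
  have h5 : d * rad η ^ (2 * α) = 2 * c₀ * rad η := by
    refine (sq_eq_sq₀ (by positivity) (by positivity)).1 ?_
    linarith
  have h6 : d / (2 * c₀) = rad η ^ (1 - 2 * α) := by
    rw [Real.rpow_sub hη, Real.rpow_one, div_eq_div_iff (by positivity) (by positivity)]
    linarith
  rw [h6, ← Real.rpow_mul hη.le, mul_one_div_cancel (by linarith), Real.rpow_one, rad,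
    mem_sphere_zero_iff_norm]
  field_simp

theorem isBddMeas_indicator_closedBall {n : ℕ} {f : Rn n → ℝ} (hf : Continuous f) (N : ℝ) :
    IsBddMeas (fun η => (((Metric.closedBall (0 : Rn n) N).indicator f η : ℝ) : ℂ)) := by
  obtain ⟨C, hC⟩ := (isCompact_closedBall (0 : Rn n) N).exists_bound_of_continuousOn
    hf.continuousOn
  refine ⟨Complex.measurable_ofReal.comp (hf.measurable.indicator measurableSet_closedBall),
    max C 0, fun x => ?_⟩
  rw [Complex.norm_real]
  by_cases hx : x ∈ Metric.closedBall (0 : Rn n) N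
  · rw [Set.indicator_of_mem hx]
    exact (hC x hx).trans (le_max_left _ _)
  · rw [Set.indicator_of_notMem hx, norm_zero]
    exact le_max_right _ _

/-- Transports the solution to the frequency side: `U j` and `Y` are the Plancherel images of the
Bessel-weighted curves, so their time derivatives are taken in L². -/
theorem IsSolution.exists_fourier {n : ℕ} {τ c₀ b ν α : ℝ}
    {φ₀ φ₁ φ₂ : 𝓢'(Rn n, ℂ)} {D : Fin 3 → ℝ → 𝓢'(Rn n, ℂ)}
    (h : IsSolution τ c₀ b ν α φ₀ φ₁ φ₂ D) :
    ∃ (r : ℝ) (U : Fin 3 → ℝ → Lp ℂ 2 (volume : Measure (Rn n)))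
      (Y Y' : ℝ → Lp ℂ 2 (volume : Measure (Rn n))),
      (∀ j, ContinuousOn (U j) (Set.Ici 0)) ∧
      (∀ t, 0 < t → HasDerivAt (U 0) (U 1 t) t) ∧
      (∀ t, 0 < t → HasDerivAt (U 1) (U 2 t) t) ∧
      (∀ j t, 0 ≤ t → HasFourierFunction (D j t) (fun η => (bessel (-r) η : ℂ) * U j t η)) ∧
      (∀ t, 0 < t → HasDerivAt Y (Y' t) t) ∧
      (∀ t, 0 < t → τ • Y' t + Y t = 0) ∧
      ∀ t, 0 < t → ∀ᵐ η, Y t η = bessel (r - 2) η *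
        (bessel (-r) η * U 2 t η + (b * ν * rad η ^ (2 * α) : ℝ) * (bessel (-r) η * U 1 t η) +
          (c₀ ^ 2 * rad η ^ 2 : ℝ) * (bessel (-r) η * U 0 t η)) := by
  obtain ⟨-, -, -, r, ⟨V, hV, hJ⟩, v, W, hW⟩ := h
  let FT : Lp ℂ 2 (volume : Measure (Rn n)) →L[ℝ] Lp ℂ 2 (volume : Measure (Rn n)) :=
    (fourierCLM ℂ (Lp ℂ 2 (volume : Measure (Rn n)))).restrictScalars ℝ
  have hFT : ∀ f, FT f = 𝓕 f := fun f => rfl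
  have hVd : ∀ m : ℕ, m < 2 → ∀ t, 0 < t → HasDerivAt (iteratedDerivWithin m V (Set.Ici 0))
      (iteratedDerivWithin (m + 1) V (Set.Ici 0) t) t := by
    intro m hm t ht
    have h1 := (hV.differentiableOn_iteratedDerivWithin (m := m) (by exact_mod_cast hm)
      (uniqueDiffOn_Ici 0)) t ht.le
    rw [iteratedDerivWithin_succ]
    exact h1.hasDerivWithinAt.hasDerivAt (Ici_mem_nhds ht)
  have hle : ∀ m : ℕ, m ≤ 2 → (m : WithTop ℕ∞) ≤ 2 := fun m hm => by exact_mod_cast hm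
  have hGD : ∀ (j : Fin 3) t, 0 ≤ t → HasFourierFunction (D j t)
      (fun η => (bessel (-r) η : ℂ) * FT (iteratedDerivWithin j V (Set.Ici 0) t) η) :=
    fun j t ht => hasFourierFunction_of_besselPotential_eq (hJ j t ht)
  refine ⟨r, fun j t => FT (iteratedDerivWithin j V (Set.Ici 0) t), fun t => FT (W t),
    fun t => FT (deriv W t), fun j => FT.continuous.comp_continuousOn
      (hV.continuousOn_iteratedDerivWithin (hle j (Nat.lt_succ_iff.1 j.2)) (uniqueDiffOn_Ici 0)),
    fun t ht => FT.hasFDerivAt.comp_hasDerivAt t (hVd 0 (by norm_num) t ht),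
    fun t ht => FT.hasFDerivAt.comp_hasDerivAt t (hVd 1 (by norm_num) t ht), hGD,
    fun t ht => FT.hasFDerivAt.comp_hasDerivAt t (hW t ht).2.2.1.hasDerivAt,
    fun t ht => ?_, fun t ht => ?_⟩
  · rw [← map_smul, ← map_add, (hW t ht).2.2.2, map_zero]
  · obtain ⟨⟨g, hg, hgv⟩, hWt, -, -⟩ := hW t ht
    have h1 := (((hGD 2 t ht.le).sub ((hGD 0 t ht.le).laplacian.smul ((c₀ ^ 2 : ℝ) : ℂ))).add
      (hgv.smul ((b * ν : ℝ) : ℂ))).besselPotential (r - 2)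
    rw [hWt] at h1
    -- Uniqueness of the Fourier function is used twice: for the two expressions of `W t`, and to
    -- identify the unspecified `g` of the fractional Laplacian with the transform of `D 1 t`.
    filter_upwards [h1.ae_eq (hasFourierFunction_toTemperedDistribution (W t)),
      hg.ae_eq (hGD 1 t ht.le)] with η h2 h3
    rw [hFT (W t), ← h2, h3]
    simp only [rad]
    push_cast
    ring

theorem IsSolution.hasFourierFunction {n : ℕ} (hn : 2 ≤ n) {τ c₀ b ν α : ℝ} (hτ : 0 < τ)
    (hc₀ : 0 < c₀) (hb : 0 < b) (hν : 0 < ν) (hα₀ : 0 ≤ α) (hα : α < 1 / 2)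
    {φ₀ φ₁ φ₂ : 𝓢'(Rn n, ℂ)} {D : Fin 3 → ℝ → 𝓢'(Rn n, ℂ)}
    (h : IsSolution τ c₀ b ν α φ₀ φ₁ φ₂ D) {F : Fin 3 → Rn n → ℂ}
    (hF₀ : HasFourierFunction φ₀ (F 0)) (hF₁ : HasFourierFunction φ₁ (F 1))
    (hF₂ : HasFourierFunction φ₂ (F 2)) (j : Fin 3) {t : ℝ} (ht : 0 ≤ t) :
    HasFourierFunction (D j t) (fun η => solSymbol τ (b * ν * rad η ^ (2 * α))
      (c₀ ^ 2 * rad η ^ 2) t j (fun i => F i η)) := by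
  obtain ⟨r, U, Y, Y', hUc, hU₀, hU₁, hGD, hYd, hYe, hE⟩ := h.exists_fourier
  have hβc : Continuous fun η : Rn n => b * ν * rad η ^ (2 * α) :=
    continuous_const.mul (continuous_rad.rpow_const fun _ => Or.inr (by linarith))
  have hac : Continuous fun η : Rn n => c₀ ^ 2 * rad η ^ 2 := by
    have := continuous_rad (n := n)
    fun_prop
  have hbc : ∀ r, Continuous fun η : Rn n => bessel r η := fun r => by
    unfold bessel
    exact (by fun_prop : Continuous fun η : Rn n => 1 + ‖η‖ ^ 2).rpow_const
      fun η => Or.inl (by positivity)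
  have main : ∀ N : ℕ, ∀ᵐ η, η ∈ Metric.closedBall (0 : Rn n) N →
      (root₁ (b * ν * rad η ^ (2 * α)) (c₀ ^ 2 * rad η ^ 2) -
        root₂ (b * ν * rad η ^ (2 * α)) (c₀ ^ 2 * rad η ^ 2)) * (bessel (-r) η * U j t η) =
      (root₁ (b * ν * rad η ^ (2 * α)) (c₀ ^ 2 * rad η ^ 2) -
        root₂ (b * ν * rad η ^ (2 * α)) (c₀ ^ 2 * rad η ^ 2)) *
        solSymbol τ (b * ν * rad η ^ (2 * α)) (c₀ ^ 2 * rad η ^ 2) t j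
          (fun i => bessel (-r) η * U i 0 η) := by
    -- The symbols are unbounded on all of space, so the evolution formula is applied on the ball of
    -- radius N.
    intro N
    set B := Metric.closedBall (0 : Rn n) N
    have hm : ∀ r, IsBddMeas (fun η : Rn n => ((B.indicator (bessel r) η : ℝ) : ℂ)) :=
      fun r => isBddMeas_indicator_closedBall (hbc r) N
    have hβm : IsBddMeas (fun η : Rn n =>
        ((B.indicator (fun η => b * ν * rad η ^ (2 * α)) η : ℝ) : ℂ)) :=
      isBddMeas_indicator_closedBall hβc N
    have ham : IsBddMeas (fun η : Rn n =>
        ((B.indicator (fun η => c₀ ^ 2 * rad η ^ 2) η : ℝ) : ℂ)) :=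
      isBddMeas_indicator_closedBall hac N
    -- `M` removes the weight from `U j`, leaving the transform of `D j` on the ball; `M'` cancels
    -- the weight of order r-2 carried by `Y`.
    obtain ⟨M, hM⟩ : ∃ M, M = mulOp volume
      (fun η : Rn n => ((B.indicator (bessel (-r)) η : ℝ) : ℂ)) := ⟨_, rfl⟩
    obtain ⟨M', hM'⟩ : ∃ M', M' = mulOp volume
      (fun η : Rn n => ((B.indicator (bessel (2 - r)) η : ℝ) : ℂ)) := ⟨_, rfl⟩
    have hMX : ∀ j t, ∀ᵐ η, η ∈ B → M (U j t) η = bessel (-r) η * U j t η := by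
      intro j t
      rw [hM]
      filter_upwards [coeFn_mulOp (hm (-r)) (U j t)] with η h1 hη
      rw [h1, Set.indicator_of_mem hη]
    have hY : ∀ t, 0 < t → M' (Y t) = M (U 2 t) +
        mulOp volume (fun η => ((B.indicator (fun η => b * ν * rad η ^ (2 * α)) η : ℝ) : ℂ))
          (M (U 1 t)) +
        mulOp volume (fun η => ((B.indicator (fun η => c₀ ^ 2 * rad η ^ 2) η : ℝ) : ℂ))
          (M (U 0 t)) := fun t ht => by
      rw [hM, hM']
      refine mulOp_eq_add_mulOp_add_mulOp (hm (2 - r)) (hm (-r)) hβm ham ?_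
      filter_upwards [hE t ht] with η h1
      rw [h1]
      by_cases hη : η ∈ B
      · simp only [Set.indicator_of_mem hη]
        have : (bessel (2 - r) η : ℂ) * bessel (r - 2) η = 1 := by
          have := bessel_mul_neg (r - 2) η
          rw [neg_sub] at this
          exact_mod_cast this
        linear_combination ((bessel (-r) η : ℂ) * (U 2 t η +
          (b * ν * rad η ^ (2 * α) : ℝ) * U 1 t η + (c₀ ^ 2 * rad η ^ 2 : ℝ) * U 0 t η)) * this
      · simp only [Set.indicator_of_notMem hη]
        simp
    have ev := evolution_formula hτ hβm ham (X := fun j t => M (U j t)) (Y := fun t => M' (Y t))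
      (Y' := fun t => M' (Y' t)) (fun j => M.continuous.comp_continuousOn (hUc j))
      (fun t ht => M.hasFDerivAt.comp_hasDerivAt t (hU₀ t ht))
      (fun t ht => M.hasFDerivAt.comp_hasDerivAt t (hU₁ t ht)) hY
      (fun t ht => M'.hasFDerivAt.comp_hasDerivAt t (hYd t ht))
      (fun t ht => by rw [← map_smul, ← map_add, hYe t ht, map_zero]) j ht
    filter_upwards [ev, hMX j t, hMX j 0, hMX 0 0, hMX 1 0, hMX 2 0,
      ae_root₁_sub_root₂_ne_zero hn hc₀ (mul_pos hb hν) hα] with η e1 e2 e3 e4 e5 e6 e7 hη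
    simp only [Set.indicator_of_mem hη] at e1
    rw [e2 hη, e3 hη, e4 hη, e5 hη, e6 hη] at e1
    rw [e1, solSymbol, mul_add (root₁ _ _ - root₂ _ _), mul_div_cancel₀ _ e7]
    ring
  refine (hGD j t ht).congr ?_
  have h0 : ∀ i, ∀ᵐ η, bessel (-r) η * U i 0 η = F i η := by
    intro i
    fin_cases i
    · exact (hGD 0 0 le_rfl).ae_eq (h.initial₀ ▸ hF₀)
    · exact (hGD 1 0 le_rfl).ae_eq (h.initial₁ ▸ hF₁)
    · exact (hGD 2 0 le_rfl).ae_eq (h.initial₂ ▸ hF₂)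
  -- Countably many balls exhaust the space, so the exceptional sets have a null union; off the
  -- sphere of double roots the factor λ₁-λ₂ cancels.
  filter_upwards [ae_all_iff.2 main, ae_root₁_sub_root₂_ne_zero hn hc₀ (mul_pos hb hν) hα,
    ae_all_iff.2 h0] with η h1 h2 h3
  obtain ⟨N, hN⟩ := exists_nat_ge ‖η‖
  have := mul_left_cancel₀ h2 (h1 N (by simpa using hN))
  simpa only [h3] using this

/-! ### Estimates of the Duhamel kernel -/

theorem integral_exp_mul_le {k : ℝ} (hk : 0 < k) (t : ℝ) :
    ∫ r in (0 : ℝ)..t, Real.exp (k * r) ≤ Real.exp (k * t) / k := by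
  rw [intervalIntegral.integral_comp_mul_left (fun x => Real.exp x) hk.ne', integral_exp,
    smul_eq_mul, mul_zero, Real.exp_zero, div_eq_inv_mul]
  gcongr
  linarith

/-- The condition on μ leaves a gap 1/τ-μ ≥ 1/(2τ) in the exponent. Integrating costs the inverse of
the gap, and the prefactor 1/τ turns this into the constant 2. -/
theorem norm_duhamel_le {τ μ t : ℝ} (hτ : 0 < τ) (hμ : μ ≤ 1 / (2 * τ)) (ht : 0 ≤ t) {z : ℂ}
    (hz : z.re ≤ -μ) : ‖duhamel τ z t‖ ≤ 2 * Real.exp (-(μ * t)) := by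
  have h2 : 1 / (2 * τ) = 1 / τ / 2 := by field_simp
  have hτ' : 0 < 1 / τ := by positivity
  have hk : 1 / τ / 2 ≤ 1 / τ - μ := by linarith
  have hk0 : 0 < 1 / τ - μ := by linarith
  have h1 : ‖expInt (z + (1 / τ : ℝ)) t‖ ≤ Real.exp ((1 / τ - μ) * t) / (1 / τ - μ) := by
    refine (intervalIntegral.norm_integral_le_of_norm_le ht (ae_of_all _ fun r hr => ?_)
      ((by fun_prop : Continuous fun r => Real.exp ((1 / τ - μ) * r)).intervalIntegrable _ _)).trans
      (integral_exp_mul_le hk0 t)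
    rw [Complex.norm_exp]
    refine Real.exp_le_exp.2 ?_
    rw [Complex.re_ofReal_mul, Complex.add_re, Complex.ofReal_re, mul_comm]
    exact mul_le_mul_of_nonneg_right (by linarith) hr.1.le
  rw [duhamel, norm_mul, Complex.norm_real, Real.norm_of_nonneg (by positivity)]
  calc Real.exp (-(t / τ)) * (1 / τ) * ‖expInt (z + (1 / τ : ℝ)) t‖
      ≤ Real.exp (-(t / τ)) * (1 / τ) * (Real.exp ((1 / τ - μ) * t) / (1 / τ / 2)) := by
        refine mul_le_mul_of_nonneg_left (h1.trans ?_) (by positivity)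
        gcongr
    _ = 2 * (Real.exp (-(t / τ)) * Real.exp ((1 / τ - μ) * t)) := by field_simp
    _ = _ := by
      rw [← Real.exp_add]
      congr 2
      ring

/-- Mean value inequality on the convex half-plane Re z ≤ -μ. -/
theorem norm_exp_sub_exp_le {μ r : ℝ} (hr : 0 ≤ r) {z w : ℂ} (hz : z.re ≤ -μ) (hw : w.re ≤ -μ) :
    ‖Complex.exp (r * z) - Complex.exp (r * w)‖ ≤ r * Real.exp (-(μ * r)) * ‖z - w‖ := by
  have hconv : Convex ℝ {z : ℂ | z.re ≤ -μ} := convex_halfSpace_re_le _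
  refine hconv.norm_image_sub_le_of_norm_hasDerivWithin_le
    (f := fun z => Complex.exp (r * z)) (f' := fun z => Complex.exp (r * z) * r)
    (fun x _ => ?_) (fun x hx => ?_) hw hz
  · have := ((hasDerivAt_id x).const_mul (r : ℂ)).cexp
    simpa using! this.hasDerivWithinAt
  · rw [norm_mul, Complex.norm_real, Real.norm_of_nonneg hr, mul_comm, Complex.norm_exp,
      Complex.re_ofReal_mul]
    gcongr
    have hx : x.re ≤ -μ := hx
    nlinarith

/-- This Lipschitz bound controls the divided difference over two roots, however close they are. -/
theorem norm_duhamel_sub_le {τ μ t : ℝ} (hτ : 0 < τ) (hμ : μ ≤ 1 / (2 * τ)) (ht : 0 ≤ t) {z w : ℂ}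
    (hz : z.re ≤ -μ) (hw : w.re ≤ -μ) :
    ‖duhamel τ z t - duhamel τ w t‖ ≤ 2 * t * Real.exp (-(μ * t)) * ‖z - w‖ := by
  have h2 : 1 / (2 * τ) = 1 / τ / 2 := by field_simp
  have hτ' : 0 < 1 / τ := by positivity
  have hk : 1 / τ / 2 ≤ 1 / τ - μ := by linarith
  have hk0 : 0 < 1 / τ - μ := by linarith
  have hc : ∀ z : ℂ, Continuous fun r : ℝ => Complex.exp (r * (z + (1 / τ : ℝ))) := fun z => by
    fun_prop
  have h1 : ‖expInt (z + (1 / τ : ℝ)) t - expInt (w + (1 / τ : ℝ)) t‖ ≤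
      t * ‖z - w‖ * (Real.exp ((1 / τ - μ) * t) / (1 / τ - μ)) := by
    unfold expInt
    rw [← intervalIntegral.integral_sub ((hc z).intervalIntegrable _ _)
      ((hc w).intervalIntegrable _ _)]
    refine (intervalIntegral.norm_integral_le_of_norm_le ht
      (g := fun r => t * ‖z - w‖ * Real.exp ((1 / τ - μ) * r)) (ae_of_all _ fun r hr => ?_)
      ((by fun_prop : Continuous _).intervalIntegrable _ _)).trans ?_
    · have := norm_exp_sub_exp_le (μ := μ - 1 / τ) hr.1.le (z := z + (1 / τ : ℝ))
        (w := w + (1 / τ : ℝ)) (by rw [Complex.add_re, Complex.ofReal_re]; linarith)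
        (by rw [Complex.add_re, Complex.ofReal_re]; linarith)
      refine this.trans ?_
      rw [add_sub_add_right_eq_sub]
      have e : -((μ - 1 / τ) * r) = (1 / τ - μ) * r := by ring
      rw [e]
      have := mul_le_mul_of_nonneg_right hr.2
        (by positivity : 0 ≤ Real.exp ((1 / τ - μ) * r) * ‖z - w‖)
      linarith
    · rw [intervalIntegral.integral_const_mul]
      exact mul_le_mul_of_nonneg_left (integral_exp_mul_le hk0 t) (by positivity)
  rw [duhamel, duhamel, ← mul_sub, norm_mul, Complex.norm_real, Real.norm_of_nonneg (by positivity)]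
  calc Real.exp (-(t / τ)) * (1 / τ) * ‖expInt (z + (1 / τ : ℝ)) t - expInt (w + (1 / τ : ℝ)) t‖
      ≤ Real.exp (-(t / τ)) * (1 / τ) *
        (t * ‖z - w‖ * (Real.exp ((1 / τ - μ) * t) / (1 / τ / 2))) := by
        refine mul_le_mul_of_nonneg_left (h1.trans ?_) (by positivity)
        gcongr
    _ = 2 * t * (Real.exp (-(t / τ)) * Real.exp ((1 / τ - μ) * t)) * ‖z - w‖ := by field_simp
    _ = _ := by
      rw [← Real.exp_add]
      congr 3
      ring

theorem duhamel_eq {τ : ℝ} (hτ : 0 < τ) {z : ℂ} (hz : 1 + τ * z ≠ 0) (t : ℝ) :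
    duhamel τ z t = (Complex.exp (t * z) - Real.exp (-(t / τ))) / (1 + τ * z) := by
  have hτ' : (τ : ℂ) ≠ 0 := by exact_mod_cast hτ.ne'
  have hw : z + (1 / τ : ℝ) ≠ 0 := fun h => hz (by
    have : (1 : ℂ) + τ * z = τ * (z + (1 / τ : ℝ)) := by
      push_cast
      field_simp
      ring
    rw [this, h, mul_zero])
  have h1 : expInt (z + (1 / τ : ℝ)) t =
      (Complex.exp (t * (z + (1 / τ : ℝ))) - 1) / (z + (1 / τ : ℝ)) := by
    have := integral_exp_mul_complex (a := 0) (b := t) hw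
    simp only [Complex.ofReal_zero, mul_zero, Complex.exp_zero] at this
    rw [mul_comm (t : ℂ), ← this]
    unfold expInt
    simp only [mul_comm]
  have h2 : Complex.exp (t * (z + (1 / τ : ℝ))) * Real.exp (-(t / τ)) = Complex.exp (t * z) := by
    rw [Complex.ofReal_exp, ← Complex.exp_add]
    congr 1
    push_cast
    ring
  have h3 : (1 : ℂ) + τ * z = τ * (z + (1 / τ : ℝ)) := by
    push_cast
    field_simp
    ring
  rw [duhamel, h1, ← h2, h3]
  push_cast
  push_cast at hw
  field_simp

/-- From the closed form. For large roots the denominator gains one power of frequency, which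
`norm_duhamel_le` does not see. -/
theorem norm_duhamel_le_div {τ μ t : ℝ} (hτ : 0 < τ) (hμ : μ ≤ 1 / τ) (ht : 0 ≤ t) {z : ℂ}
    (hz : z.re ≤ -μ) (hz' : 1 + τ * z ≠ 0) :
    ‖duhamel τ z t‖ ≤ 2 * Real.exp (-(μ * t)) / ‖1 + τ * z‖ := by
  rw [duhamel_eq hτ hz', norm_div]
  gcongr
  refine (norm_sub_le _ _).trans ?_
  rw [Complex.norm_exp, Complex.re_ofReal_mul, Complex.norm_real,
    Real.norm_of_nonneg (Real.exp_pos _).le]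
  have h1 : Real.exp (t * z.re) ≤ Real.exp (-(μ * t)) := Real.exp_le_exp.2 (by nlinarith)
  have h2 : Real.exp (-(t / τ)) ≤ Real.exp (-(μ * t)) := Real.exp_le_exp.2 (by
    have := mul_le_mul_of_nonneg_right hμ ht
    rw [one_div_mul_eq_div] at this
    linarith)
  linarith

/-! ### Estimates of the characteristic roots -/

/-- The point -μ is not left of the vertex -β/2, and λ²+βλ+a is nonnegative there; both real roots,
if any, then lie to its left. -/
theorem re_root₁_le {β a μ : ℝ} (h1 : μ ≤ β / 2) (h2 : μ * β ≤ a) :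
    (root₁ β a).re ≤ -μ := by
  have e : (root₁ β a).re = -(β / 2) + √(β ^ 2 / 4 - a) := by
    simp [root₁, sqrtDisc]
  rw [e]
  have : √(β ^ 2 / 4 - a) ≤ β / 2 - μ := by
    refine Real.sqrt_le_iff.2 ⟨by linarith, ?_⟩
    nlinarith [sq_nonneg μ]
  linarith

theorem re_root₂_le (β a : ℝ) : (root₂ β a).re ≤ -(β / 2) := by
  have e : (root₂ β a).re = -(β / 2) - √(β ^ 2 / 4 - a) := by
    simp [root₂, sqrtDisc]
  rw [e]
  linarith [Real.sqrt_nonneg (β ^ 2 / 4 - a)]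

theorem norm_sqrtDisc_sq (β a : ℝ) : ‖sqrtDisc β a‖ ^ 2 = |β ^ 2 / 4 - a| := by
  rw [← norm_pow, sqrtDisc_sq, Complex.norm_real, Real.norm_eq_abs]

theorem norm_sqrtDisc_le {β a : ℝ} (hβ : 0 ≤ β) (ha : 0 ≤ a) : ‖sqrtDisc β a‖ ≤ β / 2 + √a := by
  refine abs_le_of_sq_le_sq ?_ (by positivity) |> (le_abs_self _).trans
  rw [norm_sqrtDisc_sq]
  refine (abs_sub _ _).trans ?_
  rw [abs_of_nonneg (by positivity), abs_of_nonneg ha]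
  nlinarith [Real.sq_sqrt ha, Real.sqrt_nonneg a]

theorem norm_root₁_le {β a : ℝ} (hβ : 0 ≤ β) (ha : 0 ≤ a) : ‖root₁ β a‖ ≤ β + √a := by
  refine (norm_add_le _ _).trans ?_
  rw [norm_neg, Complex.norm_real, Real.norm_of_nonneg (by positivity)]
  linarith [norm_sqrtDisc_le hβ ha]

theorem norm_root₂_le {β a : ℝ} (hβ : 0 ≤ β) (ha : 0 ≤ a) : ‖root₂ β a‖ ≤ β + √a := by
  refine (norm_sub_le _ _).trans ?_
  rw [norm_neg, Complex.norm_real, Real.norm_of_nonneg (by positivity)]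
  linarith [norm_sqrtDisc_le hβ ha]

/-! ### The solution symbol away from the zero frequency -/

/-- The coefficient of `F 1 + τ * F 2` in `solSymbol`. -/
def coefA (τ β a t : ℝ) (j : ℕ) : ℂ :=
  (root₁ β a ^ j * duhamel τ (root₁ β a) t - root₂ β a ^ j * duhamel τ (root₂ β a) t) /
    (root₁ β a - root₂ β a)

/-- The coefficient of `F 0 + τ * F 1` in `solSymbol`. -/
def coefB (τ β a t : ℝ) (j : ℕ) : ℂ :=
  (root₁ β a * (root₂ β a ^ j * duhamel τ (root₂ β a) t) -
    root₂ β a * (root₁ β a ^ j * duhamel τ (root₁ β a) t)) / (root₁ β a - root₂ β a)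

theorem solSymbol_eq (τ β a t : ℝ) (j : Fin 3) (F : Fin 3 → ℂ) :
    solSymbol τ β a t j F = Real.exp (-(t / τ)) * F j + coefA τ β a t j * (F 1 + τ * F 2) +
      coefB τ β a t j * (F 0 + τ * F 1) := by
  rw [solSymbol, coefA, coefB]
  ring

/-- For bounded frequencies. Both coefficients are polynomials in the roots, the divided difference
`A` and `e₂`, so the bound does not degenerate as the roots merge. -/
theorem norm_coef_le_of_ne {τ β a t μ L : ℝ} (hτ : 0 < τ) (ht : 0 ≤ t) (hμ : μ ≤ 1 / (2 * τ))
    (hL : 1 ≤ L) (h₁ : ‖root₁ β a‖ ≤ L) (h₂ : ‖root₂ β a‖ ≤ L) (hr₁ : (root₁ β a).re ≤ -μ)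
    (hr₂ : (root₂ β a).re ≤ -μ) (hne : root₁ β a - root₂ β a ≠ 0) {j : ℕ} (hj : j ≤ 2) :
    ‖coefA τ β a t j‖ ≤ L ^ 3 * ((2 * t + 4) * Real.exp (-(μ * t))) ∧
    ‖coefB τ β a t j‖ ≤ L ^ 3 * ((2 * t + 4) * Real.exp (-(μ * t))) := by
  set r₁ := root₁ β a
  set r₂ := root₂ β a
  set e₁ := duhamel τ r₁ t with he₁
  set e₂ := duhamel τ r₂ t with he₂
  set X := Real.exp (-(μ * t)) with hX
  have hX0 : 0 < X := Real.exp_pos _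
  set A := (e₁ - e₂) / (r₁ - r₂) with hA
  have hA0 : ‖A‖ ≤ 2 * t * X := by
    rw [hA, norm_div, div_le_iff₀ (norm_pos_iff.2 hne)]
    exact norm_duhamel_sub_le hτ hμ ht hr₁ hr₂
  have hE : ‖e₂‖ ≤ 2 * X := norm_duhamel_le hτ hμ ht hr₂
  have hA1 : e₁ = A * (r₁ - r₂) + e₂ := by rw [hA, div_mul_cancel₀ _ hne]; ring
  have hL2 : L ≤ L ^ 2 := by nlinarith
  have hL3 : L ^ 2 ≤ L ^ 3 := by nlinarith [sq_nonneg L]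
  have hn₁ := norm_nonneg r₁
  have hn₂ := norm_nonneg r₂
  have hnA := norm_nonneg A
  have hnE := norm_nonneg e₂
  have htX : 0 ≤ t * X := by positivity
  have hp : ‖r₁ * r₂‖ ≤ L ^ 2 := by
    rw [norm_mul, sq]
    exact mul_le_mul h₁ h₂ hn₂ (by linarith)
  have hAL : ‖r₁ * A + e₂‖ ≤ L * (2 * t * X) + 2 * X := by
    refine (norm_add_le _ _).trans (add_le_add ?_ hE)
    rw [norm_mul]
    exact mul_le_mul h₁ hA0 hnA (by linarith)
  have bound : ∀ x k : ℝ, 0 ≤ k → k ≤ L ^ 3 → x ≤ k * (2 * t * X) + k * (4 * X) →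
      x ≤ L ^ 3 * ((2 * t + 4) * X) := fun x k _ hk hx => by
    have := mul_le_mul_of_nonneg_right hk (by positivity : 0 ≤ (2 * t + 4) * X)
    linarith
  have hA_ : ∀ x : ℂ, x * (r₁ - r₂) = r₁ ^ j * e₁ - r₂ ^ j * e₂ → coefA τ β a t j = x :=
    fun x hx => by rw [coefA, ← hx, mul_div_cancel_right₀ _ hne]
  have hB_ : ∀ x : ℂ, x * (r₁ - r₂) = r₁ * (r₂ ^ j * e₂) - r₂ * (r₁ ^ j * e₁) →
      coefB τ β a t j = x := fun x hx => by rw [coefB, ← hx, mul_div_cancel_right₀ _ hne]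
  interval_cases j
  · rw [hA_ A (by rw [hA1]; ring), hB_ (e₂ - r₂ * A) (by rw [hA1]; ring)]
    refine ⟨bound _ 1 zero_le_one (by linarith) (by linarith),
      bound _ L (by linarith) (by linarith) ?_⟩
    refine (norm_sub_le _ _).trans ?_
    rw [norm_mul]
    have := mul_le_mul h₂ hA0 hnA (by linarith)
    nlinarith
  · rw [hA_ (r₁ * A + e₂) (by rw [hA1]; ring), hB_ (-(r₁ * r₂) * A) (by rw [hA1]; ring)]
    refine ⟨bound _ L (by linarith) (by linarith) (by nlinarith),
      bound _ (L ^ 2) (by positivity) hL3 ?_⟩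
    rw [norm_mul, norm_neg]
    have := mul_le_mul hp hA0 hnA (by positivity)
    nlinarith [mul_nonneg (sq_nonneg L) hX0.le]
  · rw [hA_ (r₁ ^ 2 * A + (r₁ + r₂) * e₂) (by rw [hA1]; ring),
      hB_ (-(r₁ * r₂) * (r₁ * A + e₂)) (by rw [hA1]; ring)]
    constructor
    · refine bound _ (L ^ 2) (by positivity) hL3 ((norm_add_le _ _).trans (add_le_add ?_ ?_))
      · rw [norm_mul, norm_pow]
        exact mul_le_mul (pow_le_pow_left₀ hn₁ h₁ 2) hA0 hnA (by positivity)
      · rw [norm_mul]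
        have h5 : ‖r₁ + r₂‖ ≤ 2 * L ^ 2 := (norm_add_le _ _).trans (by linarith)
        have := mul_le_mul h5 hE hnE (by positivity)
        linarith
    · refine bound _ (L ^ 3) (by positivity) le_rfl ?_
      rw [norm_mul, norm_neg]
      have := mul_le_mul hp hAL (norm_nonneg _) (by positivity)
      have h6 := mul_le_mul_of_nonneg_right hL3 hX0.le
      have h7 : 0 ≤ L ^ 3 * X := by positivity
      nlinarith

/-- For large frequencies the roots are complex conjugates with |Im λ| ≥ x/2. This bounds |λ₁-λ₂|
below by x and |1+τλ| by τx/2, and |λ| ≤ 3x. The constants are 9·8 and 9·24, where 9 bounds 3^j. -/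
theorem norm_coef_le_of_oscillating {τ β a t μ x : ℝ} (hτ : 0 < τ) (ht : 0 ≤ t)
    (hμ : μ ≤ 1 / τ) (hβ : 0 ≤ β) (hx : 0 < x) (ha : a = x ^ 2) (hβa : β ^ 2 / 4 ≤ a / 2)
    (hμβ : μ ≤ β / 2) {j : ℕ} (hj : j ≤ 2) :
    ‖coefA τ β a t j‖ * x ^ 2 ≤ 72 / τ * x ^ j * Real.exp (-(μ * t)) ∧
    ‖coefB τ β a t j‖ * x ≤ 216 / τ * x ^ j * Real.exp (-(μ * t)) := by
  have ha0 : 0 < a := by rw [ha]; positivity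
  have hsa : √a = x := by rw [ha, Real.sqrt_sq hx.le]
  set X := Real.exp (-(μ * t)) with hX
  have hX0 : 0 < X := Real.exp_pos _
  have hS : x / 2 ≤ √(a - β ^ 2 / 4) := Real.le_sqrt_of_sq_le (by rw [div_pow, ← ha]; linarith)
  have hβx : β ≤ 2 * x := abs_le_of_sq_le_sq (by nlinarith) (by positivity) |> (le_abs_self _).trans
  have h₁ : ‖root₁ β a‖ ≤ 3 * x := (norm_root₁_le hβ ha0.le).trans (by linarith)
  have h₂ : ‖root₂ β a‖ ≤ 3 * x := (norm_root₂_le hβ ha0.le).trans (by linarith)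
  have hz : √(β ^ 2 / 4 - a) = 0 := Real.sqrt_eq_zero_of_nonpos (by linarith)
  have im₁ : (root₁ β a).im = √(a - β ^ 2 / 4) := by simp [root₁, sqrtDisc]
  have im₂ : (root₂ β a).im = -√(a - β ^ 2 / 4) := by simp [root₂, sqrtDisc]
  have re₁ : (root₁ β a).re ≤ -μ := by
    have : (root₁ β a).re = -(β / 2) := by simp [root₁, sqrtDisc, hz]
    linarith
  have re₂ : (root₂ β a).re ≤ -μ := (re_root₂_le β a).trans (by linarith)
  have n₁ : τ * (x / 2) ≤ ‖1 + τ * root₁ β a‖ := by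
    refine le_trans ?_ (Complex.abs_im_le_norm _)
    have : (1 + τ * root₁ β a).im = τ * √(a - β ^ 2 / 4) := by simp [im₁]
    rw [this, abs_of_nonneg (by positivity)]
    gcongr
  have n₂ : τ * (x / 2) ≤ ‖1 + τ * root₂ β a‖ := by
    refine le_trans ?_ (Complex.abs_im_le_norm _)
    have : (1 + τ * root₂ β a).im = -(τ * √(a - β ^ 2 / 4)) := by simp [im₂]
    rw [this, abs_neg, abs_of_nonneg (by positivity)]
    gcongr
  have hpos : 0 < τ * (x / 2) := by positivity
  have e₁ : ‖duhamel τ (root₁ β a) t‖ ≤ 2 * X / (τ * (x / 2)) :=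
    (norm_duhamel_le_div hτ hμ ht re₁ (norm_pos_iff.1 (hpos.trans_le n₁))).trans (by gcongr)
  have e₂ : ‖duhamel τ (root₂ β a) t‖ ≤ 2 * X / (τ * (x / 2)) :=
    (norm_duhamel_le_div hτ hμ ht re₂ (norm_pos_iff.1 (hpos.trans_le n₂))).trans (by gcongr)
  have hD : x ≤ ‖root₁ β a - root₂ β a‖ := by
    refine le_trans ?_ (Complex.abs_im_le_norm _)
    have : (root₁ β a - root₂ β a).im = 2 * √(a - β ^ 2 / 4) := by
      rw [Complex.sub_im, im₁, im₂]
      ring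
    rw [this, abs_of_nonneg (by positivity)]
    linarith
  have p₁ : ‖root₁ β a ^ j * duhamel τ (root₁ β a) t‖ ≤ (3 * x) ^ j * (2 * X / (τ * (x / 2))) := by
    rw [norm_mul, norm_pow]
    gcongr
  have p₂ : ‖root₂ β a ^ j * duhamel τ (root₂ β a) t‖ ≤ (3 * x) ^ j * (2 * X / (τ * (x / 2))) := by
    rw [norm_mul, norm_pow]
    gcongr
  have h9 : (3 : ℝ) ^ j ≤ 9 := by
    interval_cases j <;> norm_num
  constructor
  · calc ‖coefA τ β a t j‖ * x ^ 2
        ≤ (((3 * x) ^ j * (2 * X / (τ * (x / 2))) + (3 * x) ^ j * (2 * X / (τ * (x / 2)))) / x) *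
          x ^ 2 := by
          rw [coefA, norm_div]
          gcongr
          exact (norm_sub_le _ _).trans (add_le_add p₁ p₂)
      _ = 3 ^ j * (8 / τ * x ^ j * X) := by
          rw [mul_pow]
          field_simp
          ring
      _ ≤ 9 * (8 / τ * x ^ j * X) := by gcongr
      _ = _ := by ring
  · calc ‖coefB τ β a t j‖ * x
        ≤ (((3 * x) * ((3 * x) ^ j * (2 * X / (τ * (x / 2)))) +
          (3 * x) * ((3 * x) ^ j * (2 * X / (τ * (x / 2))))) / x) * x := by
          rw [coefB, norm_div]
          gcongr
          refine (norm_sub_le _ _).trans (add_le_add ?_ ?_)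
          · rw [norm_mul]
            gcongr
          · rw [norm_mul]
            gcongr
      _ = 3 ^ j * (24 / τ * x ^ j * X) := by
          rw [mul_pow]
          field_simp
          ring
      _ ≤ 9 * (24 / τ * x ^ j * X) := by gcongr
      _ = _ := by ring

/-- Half of the exponential rate absorbs the linear factor. -/
theorem add_mul_exp_le {μ t : ℝ} (hμ : 0 < μ) (ht : 0 ≤ t) :
    (2 * t + 4) * Real.exp (-(μ * t)) ≤ (4 / μ + 4) * Real.exp (-(μ / 2 * t)) := by
  have e : Real.exp (-(μ * t)) = Real.exp (-(μ / 2 * t)) * Real.exp (-(μ / 2 * t)) := by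
    rw [← Real.exp_add]
    congr 1
    ring
  rw [e, ← mul_assoc]
  refine mul_le_mul_of_nonneg_right ?_ (Real.exp_pos _).le
  have h1 : μ / 2 * t ≤ Real.exp (μ / 2 * t) := by linarith [Real.add_one_le_exp (μ / 2 * t)]
  have h2 : 1 ≤ Real.exp (μ / 2 * t) := Real.one_le_exp (by positivity)
  rw [Real.exp_neg, ← div_eq_mul_inv, div_le_iff₀ (Real.exp_pos _)]
  have h3 : 2 * t = 4 / μ * (μ / 2 * t) := by field_simp; ring
  rw [h3, add_mul]
  have : 0 < 4 / μ := by positivity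
  gcongr
  linarith

-- The damping β ~ ρ^{2α} grows more slowly than √a ~ ρ. Beyond a radius `M` the modes oscillate and
-- `norm_coef_le_of_oscillating` applies; between ε and `M` the frequencies are bounded and
-- `norm_coef_le_of_ne` applies.
set_option maxHeartbeats 400000 in
theorem exists_norm_coef_le {τ c₀ d α ε : ℝ} (hτ : 0 < τ) (hc₀ : 0 < c₀) (hd : 0 < d)
    (hα₀ : 0 ≤ α) (hα : α < 1 / 2) (hε : 0 < ε) :
    ∃ C : ℝ, 0 < C ∧ ∃ c : ℝ, 0 < c ∧ c ≤ 1 / τ ∧ ∀ ρ : ℝ, ε ≤ ρ → ∀ t : ℝ, 0 ≤ t → ∀ j : ℕ, j ≤ 2 →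
      root₁ (d * ρ ^ (2 * α)) (c₀ ^ 2 * ρ ^ 2) - root₂ (d * ρ ^ (2 * α)) (c₀ ^ 2 * ρ ^ 2) ≠ 0 →
      ‖coefA τ (d * ρ ^ (2 * α)) (c₀ ^ 2 * ρ ^ 2) t j‖ * ρ ^ 2 ≤
        C * ρ ^ j * Real.exp (-(c * t)) ∧
      ‖coefB τ (d * ρ ^ (2 * α)) (c₀ ^ 2 * ρ ^ 2) t j‖ * ρ ≤
        C * ρ ^ j * Real.exp (-(c * t)) := by
  -- The first two entries give μ ≤ β/2 and μβ ≤ a for every ρ ≥ ε, by monotonicity in ρ; the third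
  -- is the gap required by the Duhamel estimates.
  set μ : ℝ := min (min (d * ε ^ (2 * α) / 2) (c₀ ^ 2 * ε ^ (2 - 2 * α) / d)) (1 / (2 * τ)) with hμ
  have hμ0 : 0 < μ := by positivity
  have hμ1 : μ ≤ d * ε ^ (2 * α) / 2 := (min_le_left _ _).trans (min_le_left _ _)
  have hμ2 : μ ≤ c₀ ^ 2 * ε ^ (2 - 2 * α) / d := (min_le_left _ _).trans (min_le_right _ _)
  have hμ3 : μ ≤ 1 / (2 * τ) := min_le_right _ _
  have hττ : 1 / (2 * τ) ≤ 1 / τ := by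
    gcongr
    linarith
  -- From this radius on, β²/4 ≤ a/2.
  set M : ℝ := max 1 ((d ^ 2 / (2 * c₀ ^ 2)) ^ (1 / (2 - 4 * α))) with hM
  have hM1 : 1 ≤ M := le_max_left _ _
  set L : ℝ := 1 + d * M ^ (2 * α) + c₀ * M with hL
  have hL1 : 1 ≤ L := by
    have : 0 ≤ d * M ^ (2 * α) := by positivity
    have : 0 ≤ c₀ * M := by positivity
    linarith
  set δ : ℝ := min 1 ε ^ 2 with hδ
  have hδ0 : 0 < δ := by positivity
  set C₁ : ℝ := 72 / τ * (1 + c₀) ^ 2 / c₀ ^ 2 with hC₁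
  set C₂ : ℝ := 216 / τ * (1 + c₀) ^ 2 / c₀ with hC₂
  set C₃ : ℝ := L ^ 3 * (4 / μ + 4) * M ^ 2 / δ with hC₃
  have h₁ : 0 < C₁ := by positivity
  have h₂ : 0 < C₂ := by positivity
  have h₃ : 0 < C₃ := by positivity
  refine ⟨C₁ + C₂ + C₃, by positivity, μ / 2, by positivity, by linarith, ?_⟩
  intro ρ hρ t ht j hj hne
  have hρ0 : 0 < ρ := hε.trans_le hρ
  have hβ0 : 0 ≤ d * ρ ^ (2 * α) := by positivity
  have ha0 : 0 ≤ c₀ ^ 2 * ρ ^ 2 := by positivity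
  have hsa : √(c₀ ^ 2 * ρ ^ 2) = c₀ * ρ := by
    rw [← mul_pow, Real.sqrt_sq (by positivity)]
  have hβ : μ ≤ d * ρ ^ (2 * α) / 2 := hμ1.trans (by gcongr)
  have hβa : μ * (d * ρ ^ (2 * α)) ≤ c₀ ^ 2 * ρ ^ 2 := by
    have e : ρ ^ 2 = ρ ^ (2 - 2 * α) * ρ ^ (2 * α) := by
      rw [← Real.rpow_add hρ0, sub_add_cancel, Real.rpow_two]
    calc μ * (d * ρ ^ (2 * α)) ≤ c₀ ^ 2 * ε ^ (2 - 2 * α) / d * (d * ρ ^ (2 * α)) := by gcongr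
      _ = c₀ ^ 2 * (ε ^ (2 - 2 * α) * ρ ^ (2 * α)) := by field_simp
      _ ≤ c₀ ^ 2 * (ρ ^ (2 - 2 * α) * ρ ^ (2 * α)) := by
        gcongr
        linarith
      _ = _ := by rw [e]
  have hj2 : c₀ ^ j ≤ (1 + c₀) ^ 2 :=
    (pow_le_pow_left₀ hc₀.le (by linarith) j).trans (pow_le_pow_right₀ (by linarith) hj)
  have hexp : Real.exp (-(μ * t)) ≤ Real.exp (-(μ / 2 * t)) :=
    Real.exp_le_exp.2 (by nlinarith)
  have hfin : ∀ x C : ℝ, C ≤ C₁ + C₂ + C₃ → x ≤ C * ρ ^ j * Real.exp (-(μ / 2 * t)) →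
      x ≤ (C₁ + C₂ + C₃) * ρ ^ j * Real.exp (-(μ / 2 * t)) := fun x C hC hx =>
    hx.trans (by gcongr)
  rcases le_total M ρ with hMρ | hMρ
  · have hosc : (d * ρ ^ (2 * α)) ^ 2 / 4 ≤ c₀ ^ 2 * ρ ^ 2 / 2 := by
      have h4 : d ^ 2 / (2 * c₀ ^ 2) ≤ ρ ^ (2 - 4 * α) := by
        have h5 : (d ^ 2 / (2 * c₀ ^ 2)) ^ (1 / (2 - 4 * α)) ≤ ρ := (le_max_right _ _).trans hMρ
        have h6 := Real.rpow_le_rpow (by positivity) h5 (by linarith : 0 ≤ 2 - 4 * α)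
        rwa [← Real.rpow_mul (by positivity), one_div_mul_cancel (by linarith),
          Real.rpow_one] at h6
      have e : ρ ^ 2 = ρ ^ (2 - 4 * α) * (ρ ^ (2 * α)) ^ 2 := by
        rw [← Real.rpow_mul_natCast hρ0.le, ← Real.rpow_add hρ0, ← Real.rpow_two]
        congr 1
        push_cast
        ring
      rw [div_le_iff₀ (by positivity)] at h4
      rw [e]
      nlinarith [mul_le_mul_of_nonneg_right h4 (sq_nonneg (ρ ^ (2 * α)))]
    obtain ⟨hA, hB⟩ := norm_coef_le_of_oscillating (x := c₀ * ρ) hτ ht (hμ3.trans hττ) hβ0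
      (by positivity) (by rw [mul_pow]) hosc hβ hj
    constructor
    · refine hfin _ C₁ (by linarith) ?_
      have : ‖coefA τ (d * ρ ^ (2 * α)) (c₀ ^ 2 * ρ ^ 2) t j‖ * ρ ^ 2 ≤
          72 / τ * (c₀ ^ j * ρ ^ j) * Real.exp (-(μ * t)) / c₀ ^ 2 := by
        rw [le_div_iff₀ (by positivity)]
        rw [mul_pow, mul_pow] at hA
        linarith
      refine this.trans ?_
      calc 72 / τ * (c₀ ^ j * ρ ^ j) * Real.exp (-(μ * t)) / c₀ ^ 2
          ≤ 72 / τ * ((1 + c₀) ^ 2 * ρ ^ j) * Real.exp (-(μ / 2 * t)) / c₀ ^ 2 := by gcongr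
        _ = _ := by rw [hC₁]; ring
    · refine hfin _ C₂ (by linarith) ?_
      have : ‖coefB τ (d * ρ ^ (2 * α)) (c₀ ^ 2 * ρ ^ 2) t j‖ * ρ ≤
          216 / τ * (c₀ ^ j * ρ ^ j) * Real.exp (-(μ * t)) / c₀ := by
        rw [le_div_iff₀ (by positivity)]
        rw [mul_pow] at hB
        linarith
      refine this.trans ?_
      calc 216 / τ * (c₀ ^ j * ρ ^ j) * Real.exp (-(μ * t)) / c₀
          ≤ 216 / τ * ((1 + c₀) ^ 2 * ρ ^ j) * Real.exp (-(μ / 2 * t)) / c₀ := by gcongr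
        _ = _ := by rw [hC₂]; ring
  · have hLr : d * ρ ^ (2 * α) + √(c₀ ^ 2 * ρ ^ 2) ≤ L := by
      rw [hsa]
      have : d * ρ ^ (2 * α) ≤ d * M ^ (2 * α) := by gcongr
      have : c₀ * ρ ≤ c₀ * M := by gcongr
      linarith
    obtain ⟨hA, hB⟩ := norm_coef_le_of_ne hτ ht hμ3 hL1 ((norm_root₁_le hβ0 ha0).trans hLr)
      ((norm_root₂_le hβ0 ha0).trans hLr) (re_root₁_le hβ hβa)
      ((re_root₂_le _ _).trans (by linarith)) hne hj
    have hδj : δ ≤ ρ ^ j := by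
      have h5 : min 1 ε ≤ 1 := min_le_left _ _
      have h6 : min 1 ε ≤ ρ := (min_le_right _ _).trans hρ
      exact (pow_le_pow_of_le_one (by positivity) h5 hj).trans
        (pow_le_pow_left₀ (by positivity) h6 j)
    have key : ∀ x y : ℝ, 0 ≤ y → y ≤ M ^ 2 → x ≤ L ^ 3 * ((2 * t + 4) * Real.exp (-(μ * t))) →
        x * y ≤ C₃ * ρ ^ j * Real.exp (-(μ / 2 * t)) := fun x y hy0 hy hx => by
      calc x * y ≤ L ^ 3 * ((4 / μ + 4) * Real.exp (-(μ / 2 * t))) * y := by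
            refine mul_le_mul_of_nonneg_right (hx.trans ?_) hy0
            gcongr L ^ 3 * ?_
            exact add_mul_exp_le hμ0 ht
        _ ≤ L ^ 3 * ((4 / μ + 4) * Real.exp (-(μ / 2 * t))) * M ^ 2 := by gcongr
        _ = C₃ * δ * Real.exp (-(μ / 2 * t)) := by
          rw [hC₃]
          field_simp
        _ ≤ _ := by gcongr
    have hρM : ρ ≤ M ^ 2 := by nlinarith
    have hC₃' : C₃ ≤ C₁ + C₂ + C₃ := by linarith
    have hρ2 : ρ ^ 2 ≤ M ^ 2 := pow_le_pow_left₀ hρ0.le hMρ 2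
    exact ⟨hfin _ C₃ hC₃' (key _ _ (sq_nonneg ρ) hρ2 hA), hfin _ C₃ hC₃' (key _ _ hρ0.le hρM hB)⟩

/-- Explains the order max{1, 2-j} for φ₀: the term e^{-t/τ}F_j costs ρ^{2-j}|F_j|, while the
`coefB` term costs ρ|F₀| for every j. -/
theorem exists_norm_solSymbol_le {τ c₀ d α ε : ℝ} (hτ : 0 < τ) (hc₀ : 0 < c₀) (hd : 0 < d)
    (hα₀ : 0 ≤ α) (hα : α < 1 / 2) (hε : 0 < ε) (j : Fin 3) :
    ∃ C : ℝ, 0 < C ∧ ∃ c : ℝ, 0 < c ∧ ∀ ρ : ℝ, ε ≤ ρ → ∀ t : ℝ, 0 ≤ t → ∀ F : Fin 3 → ℂ,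
      root₁ (d * ρ ^ (2 * α)) (c₀ ^ 2 * ρ ^ 2) - root₂ (d * ρ ^ (2 * α)) (c₀ ^ 2 * ρ ^ 2) ≠ 0 →
      ρ ^ (2 - (j : ℝ)) * ‖solSymbol τ (d * ρ ^ (2 * α)) (c₀ ^ 2 * ρ ^ 2) t j F‖ ≤
        C * Real.exp (-(c * t)) *
          (ρ ^ max 1 (2 - (j : ℝ)) * ‖F 0‖ + ρ * ‖F 1‖ + ‖F 2‖) := by
  obtain ⟨C, hC, c, hc, hcτ, h⟩ := exists_norm_coef_le hτ hc₀ hd hα₀ hα hε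
  refine ⟨1 + C * (1 / ε + τ) + C * (1 + 1 / ε + τ), by positivity, c, hc, ?_⟩
  intro ρ hρ t ht F hne
  have hρ0 : 0 < ρ := hε.trans_le hρ
  obtain ⟨hA, hB⟩ := h ρ hρ t ht j (Nat.lt_succ_iff.1 j.2) hne
  set β := d * ρ ^ (2 * α)
  set a := c₀ ^ 2 * ρ ^ 2
  set X := Real.exp (-(c * t)) with hX
  have hX0 : 0 < X := Real.exp_pos _
  set S := ρ ^ max 1 (2 - (j : ℝ)) * ‖F 0‖ + ρ * ‖F 1‖ + ‖F 2‖ with hS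
  have hn0 := norm_nonneg (F 0)
  have hn1 := norm_nonneg (F 1)
  have hn2 := norm_nonneg (F 2)
  have s0 : ρ ^ max 1 (2 - (j : ℝ)) * ‖F 0‖ ≤ S := by
    have : 0 ≤ ρ * ‖F 1‖ := by positivity
    linarith
  have s1 : ρ * ‖F 1‖ ≤ S := by
    have : 0 ≤ ρ ^ max 1 (2 - (j : ℝ)) * ‖F 0‖ := by positivity
    linarith
  have s2 : ‖F 2‖ ≤ S := by
    have : 0 ≤ ρ * ‖F 1‖ := by positivity
    have : 0 ≤ ρ ^ max 1 (2 - (j : ℝ)) * ‖F 0‖ := by positivity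
    linarith
  have hS0 : 0 ≤ S := hn2.trans s2
  have hεi : 1 ≤ ρ / ε := (one_le_div hε).2 hρ
  have hpow : ρ ^ (2 - (j : ℝ)) * ρ ^ (j : ℕ) = ρ ^ 2 := by
    rw [← Real.rpow_natCast, ← Real.rpow_add hρ0, sub_add_cancel, Real.rpow_two]
  have hFj : ρ ^ (2 - (j : ℝ)) * ‖F j‖ ≤ S := by
    fin_cases j
    · refine le_trans (le_of_eq ?_) s0
      norm_num
    · refine le_trans (le_of_eq ?_) s1
      norm_num
    · refine le_trans (le_of_eq ?_) s2
      norm_num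
      rfl
  -- Only j = 0 is not immediate; there ρ ≤ ρ²/ε because ρ ≥ ε.
  have hρmax : ρ ≤ (1 + 1 / ε) * ρ ^ max 1 (2 - (j : ℝ)) := by
    rcases le_total 1 (2 - (j : ℝ)) with h1 | h1
    · have hj : (j : ℕ) ≤ 1 := by
        have : ((j : ℕ) : ℝ) ≤ 1 := by linarith
        exact_mod_cast this
      rw [max_eq_right h1]
      interval_cases hk : (j : ℕ)
      · simp only [Nat.cast_zero, sub_zero, Real.rpow_two]
        have : ρ / ε * ρ = 1 / ε * ρ ^ 2 := by ring
        nlinarith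
      · have : (2 : ℝ) - ((1 : ℕ) : ℝ) = 1 := by norm_num
        rw [this, Real.rpow_one]
        have : 0 < 1 / ε * ρ := by positivity
        linarith
    · rw [max_eq_left h1, Real.rpow_one]
      have : 0 < 1 / ε * ρ := by positivity
      linarith
  have hψ₁ : ‖F 1 + τ * F 2‖ ≤ (1 / ε + τ) * S := by
    refine (norm_add_le _ _).trans ?_
    rw [norm_mul, Complex.norm_real, Real.norm_of_nonneg hτ.le, add_mul]
    refine add_le_add ?_ (by gcongr)
    calc ‖F 1‖ ≤ ρ / ε * ‖F 1‖ := le_mul_of_one_le_left hn1 hεi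
      _ = 1 / ε * (ρ * ‖F 1‖) := by ring
      _ ≤ _ := by gcongr
  have hψ₀ : ρ * ‖F 0 + τ * F 1‖ ≤ (1 + 1 / ε + τ) * S := by
    calc ρ * ‖F 0 + τ * F 1‖ ≤ ρ * (‖F 0‖ + τ * ‖F 1‖) := by
          gcongr
          refine (norm_add_le _ _).trans ?_
          rw [norm_mul, Complex.norm_real, Real.norm_of_nonneg hτ.le]
      _ = ρ * ‖F 0‖ + τ * (ρ * ‖F 1‖) := by ring
      _ ≤ (1 + 1 / ε) * ρ ^ max 1 (2 - (j : ℝ)) * ‖F 0‖ + τ * S := by gcongr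
      _ = (1 + 1 / ε) * (ρ ^ max 1 (2 - (j : ℝ)) * ‖F 0‖) + τ * S := by ring
      _ ≤ (1 + 1 / ε) * S + τ * S := by gcongr
      _ = _ := by ring
  have hexp : Real.exp (-(t / τ)) ≤ X := Real.exp_le_exp.2 (by
    have := mul_le_mul_of_nonneg_right hcτ ht
    rw [one_div_mul_eq_div] at this
    linarith)
  have hA' : ρ ^ (2 - (j : ℝ)) * ‖coefA τ β a t j‖ ≤ C * X := by
    have h1 := mul_le_mul_of_nonneg_left hA (by positivity : 0 ≤ ρ ^ (2 - (j : ℝ)))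
    have e1 : ρ ^ (2 - (j : ℝ)) * (‖coefA τ β a t j‖ * ρ ^ 2) =
      ρ ^ 2 * (ρ ^ (2 - (j : ℝ)) * ‖coefA τ β a t j‖) := by ring
    have e2 : ρ ^ (2 - (j : ℝ)) * (C * ρ ^ (j : ℕ) * X) = ρ ^ 2 * (C * X) := by
      rw [← hpow]; ring
    rw [e1, e2] at h1
    exact le_of_mul_le_mul_left h1 (by positivity)
  have hB' : ρ ^ (2 - (j : ℝ)) * ‖coefB τ β a t j‖ ≤ C * X * ρ := by
    have h1 := mul_le_mul_of_nonneg_left hB (by positivity : 0 ≤ ρ ^ (2 - (j : ℝ)))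
    have e1 : ρ ^ (2 - (j : ℝ)) * (‖coefB τ β a t j‖ * ρ) =
      ρ * (ρ ^ (2 - (j : ℝ)) * ‖coefB τ β a t j‖) := by ring
    have e2 : ρ ^ (2 - (j : ℝ)) * (C * ρ ^ (j : ℕ) * X) = ρ * (C * X * ρ) := by
      rw [show ρ * (C * X * ρ) = ρ ^ 2 * (C * X) by ring, ← hpow]; ring
    rw [e1, e2] at h1
    exact le_of_mul_le_mul_left h1 hρ0
  have hnorm : ‖solSymbol τ β a t j F‖ ≤ Real.exp (-(t / τ)) * ‖F j‖ +
      ‖coefA τ β a t j‖ * ‖F 1 + τ * F 2‖ + ‖coefB τ β a t j‖ * ‖F 0 + τ * F 1‖ := by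
    rw [solSymbol_eq]
    refine (norm_add₃_le).trans (le_of_eq ?_)
    rw [norm_mul, norm_mul, norm_mul, Complex.norm_real, Real.norm_of_nonneg (Real.exp_pos _).le]
  calc ρ ^ (2 - (j : ℝ)) * ‖solSymbol τ β a t j F‖
      ≤ ρ ^ (2 - (j : ℝ)) * (Real.exp (-(t / τ)) * ‖F j‖ +
        ‖coefA τ β a t j‖ * ‖F 1 + τ * F 2‖ + ‖coefB τ β a t j‖ * ‖F 0 + τ * F 1‖) := by gcongr
    _ = Real.exp (-(t / τ)) * (ρ ^ (2 - (j : ℝ)) * ‖F j‖) +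
        (ρ ^ (2 - (j : ℝ)) * ‖coefA τ β a t j‖) * ‖F 1 + τ * F 2‖ +
        (ρ ^ (2 - (j : ℝ)) * ‖coefB τ β a t j‖) * ‖F 0 + τ * F 1‖ := by ring
    _ ≤ X * S + (C * X) * ((1 / ε + τ) * S) + (C * X * ρ) * ‖F 0 + τ * F 1‖ := by gcongr
    _ = X * S + (C * X) * ((1 / ε + τ) * S) + (C * X) * (ρ * ‖F 0 + τ * F 1‖) := by ring
    _ ≤ X * S + (C * X) * ((1 / ε + τ) * S) + (C * X) * ((1 + 1 / ε + τ) * S) := by gcongr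
    _ = _ := by ring

/-! ### The solution symbol at low frequencies -/

theorem exists_rpow_le {A x : ℝ} (hA : 0 < A) (hx : 0 < x) :
    ∃ ε : ℝ, 0 < ε ∧ ∀ ρ : ℝ, 0 ≤ ρ → ρ ≤ ε → ρ ^ x ≤ A := by
  refine ⟨A ^ (1 / x), by positivity, fun ρ h0 h => ?_⟩
  have := Real.rpow_le_rpow h0 h hx.le
  rwa [← Real.rpow_mul hA.le, one_div_mul_cancel hx.ne', Real.rpow_one] at this

/-- The normalised square root of the discriminant at low frequencies. -/
def lowDisc (c₀ d α ρ : ℝ) : ℝ := √(d ^ 2 / 4 - c₀ ^ 2 * ρ ^ (2 - 4 * α))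

theorem lowDisc_le {c₀ d α ρ : ℝ} (hd : 0 < d) (hρ : 0 ≤ ρ) : lowDisc c₀ d α ρ ≤ d / 2 := by
  refine Real.sqrt_le_iff.2 ⟨by positivity, ?_⟩
  have : 0 ≤ c₀ ^ 2 * ρ ^ (2 - 4 * α) := by positivity
  nlinarith

theorem le_lowDisc {c₀ d α ρ : ℝ} (h : c₀ ^ 2 * ρ ^ (2 - 4 * α) ≤ 3 / 16 * d ^ 2) :
    d / 4 ≤ lowDisc c₀ d α ρ := by
  refine Real.le_sqrt_of_sq_le ?_
  linarith [sq_nonneg d]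

/-! ### Exact form of the roots near the zero frequency. -/

section

variable {c₀ d α ρ : ℝ}

theorem sqrtDisc_eq_lowDisc (hρ : 0 < ρ)
    (h : c₀ ^ 2 * ρ ^ (2 - 4 * α) ≤ 3 / 16 * d ^ 2) :
    sqrtDisc (d * ρ ^ (2 * α)) (c₀ ^ 2 * ρ ^ 2) = (lowDisc c₀ d α ρ * ρ ^ (2 * α) : ℝ) := by
  have e : (d * ρ ^ (2 * α)) ^ 2 / 4 - c₀ ^ 2 * ρ ^ 2 =
      (d ^ 2 / 4 - c₀ ^ 2 * ρ ^ (2 - 4 * α)) * (ρ ^ (2 * α)) ^ 2 := by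
    have : ρ ^ 2 = ρ ^ (2 - 4 * α) * (ρ ^ (2 * α)) ^ 2 := by
      rw [← Real.rpow_mul_natCast hρ.le, ← Real.rpow_add hρ, ← Real.rpow_two]
      congr 1
      push_cast
      ring
    rw [this]
    ring
  have hpos : 0 ≤ d ^ 2 / 4 - c₀ ^ 2 * ρ ^ (2 - 4 * α) := by linarith [sq_nonneg d]
  rw [sqrtDisc, Real.sqrt_eq_zero_of_nonpos (x := c₀ ^ 2 * ρ ^ 2 - (d * ρ ^ (2 * α)) ^ 2 / 4), e,
    Real.sqrt_mul hpos, Real.sqrt_sq (by positivity)]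
  · simp [lowDisc]
  · have : 0 ≤ (d ^ 2 / 4 - c₀ ^ 2 * ρ ^ (2 - 4 * α)) * (ρ ^ (2 * α)) ^ 2 := by positivity
    linarith

theorem root₂_eq_low (hρ : 0 < ρ)
    (h : c₀ ^ 2 * ρ ^ (2 - 4 * α) ≤ 3 / 16 * d ^ 2) :
    root₂ (d * ρ ^ (2 * α)) (c₀ ^ 2 * ρ ^ 2) =
      (-((d / 2 + lowDisc c₀ d α ρ) * ρ ^ (2 * α)) : ℝ) := by
  rw [root₂, sqrtDisc_eq_lowDisc hρ h]
  push_cast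
  ring

/-- Vieta's λ₁ = a/λ₂ avoids the cancellation in -β/2+√(β²/4-a) and shows the order ρ^{2-2α}. -/
theorem root₁_eq_low (hd : 0 < d) (hρ : 0 < ρ)
    (h : c₀ ^ 2 * ρ ^ (2 - 4 * α) ≤ 3 / 16 * d ^ 2) :
    root₁ (d * ρ ^ (2 * α)) (c₀ ^ 2 * ρ ^ 2) =
      (-(c₀ ^ 2 / (d / 2 + lowDisc c₀ d α ρ) * ρ ^ (2 - 2 * α)) : ℝ) := by
  have h1 := root₁_mul_root₂ (d * ρ ^ (2 * α)) (c₀ ^ 2 * ρ ^ 2)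
  rw [root₂_eq_low hρ h] at h1
  have hS := le_lowDisc h
  have hS' : 0 < d / 2 + lowDisc c₀ d α ρ := by linarith
  have hne : ((-((d / 2 + lowDisc c₀ d α ρ) * ρ ^ (2 * α)) : ℝ) : ℂ) ≠ 0 := by
    rw [Ne, Complex.ofReal_eq_zero, neg_eq_zero]
    positivity
  rw [eq_div_of_mul_eq hne h1, ← Complex.ofReal_div]
  congr 1
  have : ρ ^ 2 = ρ ^ (2 - 2 * α) * ρ ^ (2 * α) := by
    rw [← Real.rpow_add hρ, sub_add_cancel, Real.rpow_two]
  rw [this]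
  field_simp

theorem root₁_sub_root₂_low (hρ : 0 < ρ)
    (h : c₀ ^ 2 * ρ ^ (2 - 4 * α) ≤ 3 / 16 * d ^ 2) :
    root₁ (d * ρ ^ (2 * α)) (c₀ ^ 2 * ρ ^ 2) - root₂ (d * ρ ^ (2 * α)) (c₀ ^ 2 * ρ ^ 2) =
      (2 * lowDisc c₀ d α ρ * ρ ^ (2 * α) : ℝ) := by
  rw [root₁_sub_root₂, sqrtDisc_eq_lowDisc hρ h]
  push_cast
  ring

end

/-- The contribution of the slowly decaying mode to `solSymbol`. -/
def slowPart (τ β a t : ℝ) (j : ℕ) (F : Fin 3 → ℂ) : ℂ :=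
  root₁ β a ^ j * duhamel τ (root₁ β a) t *
    ((F 1 + τ * F 2) - root₂ β a * (F 0 + τ * F 1)) / (root₁ β a - root₂ β a)

/-- The contribution of the fast decaying mode to `solSymbol`. -/
def fastPart (τ β a t : ℝ) (j : ℕ) (F : Fin 3 → ℂ) : ℂ :=
  root₂ β a ^ j * duhamel τ (root₂ β a) t *
    ((F 1 + τ * F 2) - root₁ β a * (F 0 + τ * F 1)) / (root₁ β a - root₂ β a)

theorem solSymbol_eq_slowPart (τ β a t : ℝ) (j : Fin 3) (F : Fin 3 → ℂ) :
    solSymbol τ β a t j F =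
      slowPart τ β a t j F + (Real.exp (-(t / τ)) * F j - fastPart τ β a t j F) := by
  rw [solSymbol, slowPart, fastPart]
  ring

theorem norm_data_le {τ L : ℝ} (hτ : 0 < τ) {r : ℂ} (hr : ‖r‖ ≤ L) (F : Fin 3 → ℂ) :
    ‖(F 1 + τ * F 2) - r * (F 0 + τ * F 1)‖ ≤
      (1 + τ) * (1 + L) * (‖F 0‖ + ‖F 1‖ + ‖F 2‖) := by
  have hn0 := norm_nonneg (F 0)
  have hn1 := norm_nonneg (F 1)
  have hn2 := norm_nonneg (F 2)
  have hL : 0 ≤ L := (norm_nonneg _).trans hr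
  have h1 : ‖F 1 + τ * F 2‖ ≤ (1 + τ) * (‖F 0‖ + ‖F 1‖ + ‖F 2‖) := by
    refine (norm_add_le _ _).trans ?_
    rw [norm_mul, Complex.norm_real, Real.norm_of_nonneg hτ.le]
    nlinarith [mul_nonneg hτ.le hn0, mul_nonneg hτ.le hn1]
  have h0 : ‖F 0 + τ * F 1‖ ≤ (1 + τ) * (‖F 0‖ + ‖F 1‖ + ‖F 2‖) := by
    refine (norm_add_le _ _).trans ?_
    rw [norm_mul, Complex.norm_real, Real.norm_of_nonneg hτ.le]
    nlinarith [mul_nonneg hτ.le hn0, mul_nonneg hτ.le hn2]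
  refine (norm_sub_le _ _).trans ?_
  rw [norm_mul]
  have := mul_le_mul hr h0 (norm_nonneg _) hL
  linarith

/-- `ε` is so small that the low-frequency expansion of the roots holds on `(0, ε]`. -/
structure IsLowRadius (τ c₀ d α ε : ℝ) : Prop where
  pos : 0 < ε
  le_one : ε ≤ 1
  disc : ∀ ρ, 0 ≤ ρ → ρ ≤ ε → c₀ ^ 2 * ρ ^ (2 - 4 * α) ≤ 3 / 16 * d ^ 2
  slow : ∀ ρ, 0 ≤ ρ → ρ ≤ ε → c₀ ^ 2 / d * ρ ^ (2 - 2 * α) ≤ 1 / (4 * τ)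

theorem exists_isLowRadius {τ c₀ d α : ℝ} (hτ : 0 < τ) (hc₀ : 0 < c₀) (hd : 0 < d)
    (hα : α < 1 / 2) : ∃ ε, IsLowRadius τ c₀ d α ε := by
  obtain ⟨ε₁, h₁, h₁'⟩ := exists_rpow_le (A := 3 / 16 * d ^ 2 / c₀ ^ 2) (x := 2 - 4 * α)
    (by positivity) (by linarith)
  obtain ⟨ε₂, h₂, h₂'⟩ := exists_rpow_le (A := 1 / (4 * τ) / (c₀ ^ 2 / d)) (x := 2 - 2 * α)
    (by positivity) (by linarith)
  refine ⟨min 1 (min ε₁ ε₂), by positivity, min_le_left _ _, fun ρ h0 h => ?_, fun ρ h0 h => ?_⟩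
  · have := h₁' ρ h0 (h.trans ((min_le_right _ _).trans (min_le_left _ _)))
    rw [le_div_iff₀ (by positivity)] at this
    linarith
  · have := h₂' ρ h0 (h.trans ((min_le_right _ _).trans (min_le_right _ _)))
    rw [le_div_iff₀ (by positivity)] at this
    linarith

theorem IsLowRadius.mono {τ c₀ d α ε ε' : ℝ} (h : IsLowRadius τ c₀ d α ε) (h0 : 0 < ε')
    (hle : ε' ≤ ε) : IsLowRadius τ c₀ d α ε' :=
  ⟨h0, hle.trans h.le_one, fun ρ h1 h2 => h.disc ρ h1 (h2.trans hle),
    fun ρ h1 h2 => h.slow ρ h1 (h2.trans hle)⟩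

/-- Since d/4 ≤ `lowDisc` ≤ d/2, |λ₁| is comparable to ρ^{2-2α} and |λ₁-λ₂| ≥ (d/2)ρ^{2α}. The
division by the latter is the source of ρ^{-2α}. -/
theorem norm_slowPart_le {τ c₀ d α ε : ℝ} (hε : IsLowRadius τ c₀ d α ε) (hτ : 0 < τ)
    (hc₀ : 0 < c₀) (hd : 0 < d) (hα₀ : 0 ≤ α) (j : ℕ) {ρ : ℝ}
    (hρ : 0 < ρ) (hρε : ρ ≤ ε) {t : ℝ} (ht : 0 ≤ t) (F : Fin 3 → ℂ) :
    ‖slowPart τ (d * ρ ^ (2 * α)) (c₀ ^ 2 * ρ ^ 2) t j F‖ ≤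
      (2 * c₀ ^ 2 / d) ^ j * 2 * ((1 + τ) * (1 + d)) * (2 / d) *
        (‖F 0‖ + ‖F 1‖ + ‖F 2‖) * (ρ ^ ((2 - 2 * α) * j - 2 * α) *
        Real.exp (-(c₀ ^ 2 / d * ρ ^ (2 - 2 * α) * t))) := by
  have h := hε.disc ρ hρ.le hρε
  have hS := le_lowDisc h
  have hS' := lowDisc_le (c₀ := c₀) (α := α) hd hρ.le
  have hρ1 : ρ ≤ 1 := hρε.trans hε.le_one
  have hρα : ρ ^ (2 * α) ≤ 1 := Real.rpow_le_one hρ.le hρ1 (by linarith)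
  have hρα0 : 0 < ρ ^ (2 * α) := by positivity
  have hρq : 0 < ρ ^ (2 - 2 * α) := by positivity
  have hS0 : 0 < lowDisc c₀ d α ρ := by linarith
  have n₂ : ‖root₂ (d * ρ ^ (2 * α)) (c₀ ^ 2 * ρ ^ 2)‖ ≤ d := by
    rw [root₂_eq_low hρ h, Complex.norm_real, norm_neg, Real.norm_of_nonneg (by positivity)]
    nlinarith
  have n₁ : ‖root₁ (d * ρ ^ (2 * α)) (c₀ ^ 2 * ρ ^ 2)‖ ≤ 2 * c₀ ^ 2 / d * ρ ^ (2 - 2 * α) := by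
    rw [root₁_eq_low hd hρ h, Complex.norm_real, norm_neg, Real.norm_of_nonneg (by positivity)]
    have e : 2 * c₀ ^ 2 / d = c₀ ^ 2 / (d / 2) := by field_simp
    rw [e]
    gcongr
    linarith
  have re₁ : (root₁ (d * ρ ^ (2 * α)) (c₀ ^ 2 * ρ ^ 2)).re ≤
      -(c₀ ^ 2 / d * ρ ^ (2 - 2 * α)) := by
    rw [root₁_eq_low hd hρ h, Complex.ofReal_re, neg_le_neg_iff]
    gcongr
    linarith
  have e₁ := norm_duhamel_le hτ ((hε.slow ρ hρ.le hρε).trans (by gcongr; norm_num)) ht re₁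
  have nD : d / 2 * ρ ^ (2 * α) ≤ ‖root₁ (d * ρ ^ (2 * α)) (c₀ ^ 2 * ρ ^ 2) -
      root₂ (d * ρ ^ (2 * α)) (c₀ ^ 2 * ρ ^ 2)‖ := by
    rw [root₁_sub_root₂_low hρ h, Complex.norm_real, Real.norm_of_nonneg (by positivity)]
    gcongr
    linarith
  have hF := norm_data_le hτ n₂ F
  set N := ‖F 0‖ + ‖F 1‖ + ‖F 2‖
  rw [slowPart, norm_div, norm_mul, norm_mul, norm_pow]
  calc _ ≤ (2 * c₀ ^ 2 / d * ρ ^ (2 - 2 * α)) ^ j *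
        (2 * Real.exp (-(c₀ ^ 2 / d * ρ ^ (2 - 2 * α) * t))) * ((1 + τ) * (1 + d) * N) /
        (d / 2 * ρ ^ (2 * α)) := by gcongr
    _ = (2 * c₀ ^ 2 / d) ^ j * 2 * ((1 + τ) * (1 + d)) * (2 / d) * N *
        ((ρ ^ (2 - 2 * α)) ^ j / ρ ^ (2 * α) *
          Real.exp (-(c₀ ^ 2 / d * ρ ^ (2 - 2 * α) * t))) := by
      rw [mul_pow]
      field_simp
    _ = _ := by
      rw [← Real.rpow_mul_natCast hρ.le, ← Real.rpow_sub hρ]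

/-- The decay rate is capped by 1/(2τ) to keep the gap in the Duhamel estimate; since ρ ≤ 1, the
factor ρ^{2α} does no harm. -/
theorem norm_fastPart_le {τ c₀ d α ε : ℝ} (hε : IsLowRadius τ c₀ d α ε) (hτ : 0 < τ)
    (hd : 0 < d) (hα₀ : 0 ≤ α) (hα : α < 1 / 2) (j : ℕ) {ρ : ℝ}
    (hρ : 0 < ρ) (hρε : ρ ≤ ε) {t : ℝ} (ht : 0 ≤ t) (F : Fin 3 → ℂ) :
    ‖fastPart τ (d * ρ ^ (2 * α)) (c₀ ^ 2 * ρ ^ 2) t j F‖ ≤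
      d ^ j * 2 * ((1 + τ) * (1 + 2 * c₀ ^ 2 / d)) * (2 / d) *
        (‖F 0‖ + ‖F 1‖ + ‖F 2‖) * (ρ ^ (2 * α * j - 2 * α) *
        Real.exp (-(min (d / 2) (1 / (2 * τ)) * ρ ^ (2 * α) * t))) := by
  have h := hε.disc ρ hρ.le hρε
  have hS := le_lowDisc h
  have hS' := lowDisc_le (c₀ := c₀) (α := α) hd hρ.le
  have hρ1 : ρ ≤ 1 := hρε.trans hε.le_one
  have hρα : ρ ^ (2 * α) ≤ 1 := Real.rpow_le_one hρ.le hρ1 (by linarith)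
  have hρα0 : 0 < ρ ^ (2 * α) := by positivity
  have hρq : ρ ^ (2 - 2 * α) ≤ 1 := Real.rpow_le_one hρ.le hρ1 (by linarith)
  have hρq0 : 0 < ρ ^ (2 - 2 * α) := by positivity
  have hS0 : 0 < lowDisc c₀ d α ρ := by linarith
  have n₂ : ‖root₂ (d * ρ ^ (2 * α)) (c₀ ^ 2 * ρ ^ 2)‖ ≤ d * ρ ^ (2 * α) := by
    rw [root₂_eq_low hρ h, Complex.norm_real, norm_neg, Real.norm_of_nonneg (by positivity)]
    nlinarith
  have n₁ : ‖root₁ (d * ρ ^ (2 * α)) (c₀ ^ 2 * ρ ^ 2)‖ ≤ 2 * c₀ ^ 2 / d := by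
    rw [root₁_eq_low hd hρ h, Complex.norm_real, norm_neg, Real.norm_of_nonneg (by positivity)]
    have e : 2 * c₀ ^ 2 / d = c₀ ^ 2 / (d / 2) := by field_simp
    rw [e]
    refine (mul_le_of_le_one_right (by positivity) hρq).trans ?_
    gcongr
    linarith
  have hm : 0 < min (d / 2) (1 / (2 * τ)) := by positivity
  have re₂ : (root₂ (d * ρ ^ (2 * α)) (c₀ ^ 2 * ρ ^ 2)).re ≤
      -(min (d / 2) (1 / (2 * τ)) * ρ ^ (2 * α)) := by
    refine (re_root₂_le _ _).trans ?_
    have := mul_le_mul_of_nonneg_right (min_le_left (d / 2) (1 / (2 * τ))) hρα0.le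
    linarith
  have e₂ := norm_duhamel_le hτ
    ((mul_le_of_le_one_right hm.le hρα).trans (min_le_right _ _)) ht re₂
  have nD : d / 2 * ρ ^ (2 * α) ≤ ‖root₁ (d * ρ ^ (2 * α)) (c₀ ^ 2 * ρ ^ 2) -
      root₂ (d * ρ ^ (2 * α)) (c₀ ^ 2 * ρ ^ 2)‖ := by
    rw [root₁_sub_root₂_low hρ h, Complex.norm_real, Real.norm_of_nonneg (by positivity)]
    gcongr
    linarith
  have hF := norm_data_le hτ n₁ F
  set N := ‖F 0‖ + ‖F 1‖ + ‖F 2‖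
  rw [fastPart, norm_div, norm_mul, norm_mul, norm_pow]
  calc _ ≤ (d * ρ ^ (2 * α)) ^ j *
        (2 * Real.exp (-(min (d / 2) (1 / (2 * τ)) * ρ ^ (2 * α) * t))) *
        ((1 + τ) * (1 + 2 * c₀ ^ 2 / d) * N) / (d / 2 * ρ ^ (2 * α)) := by gcongr
    _ = d ^ j * 2 * ((1 + τ) * (1 + 2 * c₀ ^ 2 / d)) * (2 / d) * N *
        ((ρ ^ (2 * α)) ^ j / ρ ^ (2 * α) *
          Real.exp (-(min (d / 2) (1 / (2 * τ)) * ρ ^ (2 * α) * t))) := by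
      rw [mul_pow]
      field_simp
    _ = _ := by
      rw [← Real.rpow_mul_natCast hρ.le, ← Real.rpow_sub hρ]

/-- The profile of `slowPart` after parabolic rescaling. -/
theorem tendsto_slowPart {τ c₀ d α : ℝ} (hτ : 0 < τ) (hd : 0 < d)
    (hα₀ : 0 ≤ α) (hα : α < 1 / 2) (j : ℕ) {x : ℝ} (hx : 0 < x) {G : ℝ → Fin 3 → ℂ}
    {G₀ : Fin 3 → ℂ} (hG : ∀ i, Tendsto (fun t => G t i) atTop (𝓝 (G₀ i)))
    (hG₀ : 0 < α ∨ G₀ 0 + τ * G₀ 1 = 0) :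
    Tendsto (fun t : ℝ => ((((t ^ (-(1 / (2 - 2 * α)))) ^ (-((2 - 2 * α) * j - 2 * α)) : ℝ)) : ℂ) *
        slowPart τ (d * (t ^ (-(1 / (2 - 2 * α))) * x) ^ (2 * α))
          (c₀ ^ 2 * (t ^ (-(1 / (2 - 2 * α))) * x) ^ 2) t j (G t)) atTop
      (𝓝 ((x ^ ((2 - 2 * α) * j - 2 * α) * (-(c₀ ^ 2 / d)) ^ j *
        Real.exp (-(c₀ ^ 2 / d * x ^ (2 - 2 * α))) * (1 / d) : ℝ) * (G₀ 1 + τ * G₀ 2))) := by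
  set q := 2 - 2 * α with hq
  have hq0 : 0 < q := by linarith
  set l : ℝ → ℝ := fun t => t ^ (-(1 / q)) with hl
  have hlt : Tendsto l atTop (𝓝 0) := tendsto_rpow_neg_atTop (by positivity)
  have hρt : Tendsto (fun t => l t * x) atTop (𝓝 0) := by simpa using hlt.mul_const x
  have hpow : ∀ {y : ℝ}, 0 < y → Tendsto (fun t => (l t * x) ^ y) atTop (𝓝 0) := fun hy => by
    have := hρt.rpow_const (p := _) (Or.inr hy.le)
    rwa [Real.zero_rpow hy.ne'] at this
  have hSt : Tendsto (fun t => lowDisc c₀ d α (l t * x)) atTop (𝓝 (d / 2)) := by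
    have h1 := ((hpow (y := 2 - 4 * α) (by linarith)).const_mul (c₀ ^ 2)).const_sub (d ^ 2 / 4)
    have h2 := h1.sqrt
    have e : √(d ^ 2 / 4 - c₀ ^ 2 * 0) = d / 2 := by
      rw [mul_zero, sub_zero, show d ^ 2 / 4 = (d / 2) ^ 2 by ring, Real.sqrt_sq (by positivity)]
    rwa [e] at h2
  have hk : Tendsto (fun t => c₀ ^ 2 / (d / 2 + lowDisc c₀ d α (l t * x))) atTop
      (𝓝 (c₀ ^ 2 / d)) := by
    have := (tendsto_const_nhds (x := c₀ ^ 2)).div (hSt.const_add (d / 2)) (by positivity)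
    rwa [add_halves] at this
  have hr₁ : Tendsto (fun t => c₀ ^ 2 / (d / 2 + lowDisc c₀ d α (l t * x)) * (l t * x) ^ q) atTop
      (𝓝 0) := by
    simpa using hk.mul (hpow hq0)
  -- closed form for large times
  have hev : ∀ᶠ t in atTop, ((((l t) ^ (-(q * j - 2 * α)) : ℝ)) : ℂ) *
        slowPart τ (d * (l t * x) ^ (2 * α)) (c₀ ^ 2 * (l t * x) ^ 2) t j (G t) =
      (x ^ (q * j - 2 * α) * (-(c₀ ^ 2 / (d / 2 + lowDisc c₀ d α (l t * x)))) ^ j *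
        ((Real.exp (-(c₀ ^ 2 / (d / 2 + lowDisc c₀ d α (l t * x)) * x ^ q)) -
          Real.exp (-(t / τ))) /
          (1 - τ * (c₀ ^ 2 / (d / 2 + lowDisc c₀ d α (l t * x)) * (l t * x) ^ q))) *
        (1 / (2 * lowDisc c₀ d α (l t * x))) : ℝ) *
      ((G t 1 + τ * G t 2) + ((d / 2 + lowDisc c₀ d α (l t * x)) * (l t * x) ^ (2 * α) : ℝ) *
        (G t 0 + τ * G t 1)) := by
    have h1 : ∀ᶠ t in atTop, c₀ ^ 2 * (l t * x) ^ (2 - 4 * α) < 3 / 16 * d ^ 2 := by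
      have := (hpow (y := 2 - 4 * α) (by linarith)).const_mul (c₀ ^ 2)
      rw [mul_zero] at this
      exact this.eventually_lt_const (by positivity)
    have h2 : ∀ᶠ t in atTop,
        c₀ ^ 2 / (d / 2 + lowDisc c₀ d α (l t * x)) * (l t * x) ^ q < 1 / τ :=
      hr₁.eventually_lt_const (by positivity)
    filter_upwards [h1, h2, eventually_gt_atTop 0] with t h1 h2 ht
    have hlpos : 0 < l t := by positivity
    have hρ : 0 < l t * x := by positivity
    have hS := le_lowDisc h1.le
    have hS0 : 0 < lowDisc c₀ d α (l t * x) := by linarith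
    set S := lowDisc c₀ d α (l t * x) with hSdef
    have hr := root₁_eq_low hd hρ h1.le
    have hne : 1 - τ * (c₀ ^ 2 / (d / 2 + S) * (l t * x) ^ q) ≠ 0 := by
      have := mul_lt_mul_of_pos_left h2 hτ
      rw [mul_one_div_cancel hτ.ne'] at this
      linarith
    have e1 : (1 : ℂ) + τ * root₁ (d * (l t * x) ^ (2 * α)) (c₀ ^ 2 * (l t * x) ^ 2) =
        ((1 - τ * (c₀ ^ 2 / (d / 2 + S) * (l t * x) ^ q) : ℝ) : ℂ) := by
      rw [hr]
      push_cast
      ring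
    -- The choice of the scale: in the rescaled variable the exponent tλ₁ no longer contains t
    -- except through `lowDisc`.
    have e2 : t * (l t) ^ q = 1 := by
      rw [hl]
      simp only
      rw [← Real.rpow_mul ht.le, neg_mul, one_div_mul_cancel hq0.ne', Real.rpow_neg_one,
        mul_inv_cancel₀ ht.ne']
    have e3 : Complex.exp (t * root₁ (d * (l t * x) ^ (2 * α)) (c₀ ^ 2 * (l t * x) ^ 2)) =
        (Real.exp (-(c₀ ^ 2 / (d / 2 + S) * x ^ q)) : ℝ) := by
      rw [hr, ← Complex.ofReal_mul, ← Complex.ofReal_exp, Real.mul_rpow hlpos.le hx.le]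
      congr 2
      linear_combination (-(c₀ ^ 2 / (d / 2 + S) * x ^ q)) * e2
    have hd1 : duhamel τ (root₁ (d * (l t * x) ^ (2 * α)) (c₀ ^ 2 * (l t * x) ^ 2)) t =
        ((Real.exp (-(c₀ ^ 2 / (d / 2 + S) * x ^ q)) - Real.exp (-(t / τ))) /
          (1 - τ * (c₀ ^ 2 / (d / 2 + S) * (l t * x) ^ q)) : ℝ) := by
      rw [duhamel_eq hτ (by rw [e1]; exact_mod_cast hne), e1, e3]
      push_cast
      rfl
    have e4 : (l t) ^ (-(q * j - 2 * α)) * ((l t * x) ^ q) ^ j = x ^ (q * j - 2 * α) *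
        (l t * x) ^ (2 * α) := by
      have f1 : ((l t * x) ^ q) ^ j = (l t * x) ^ (q * j - 2 * α) * (l t * x) ^ (2 * α) := by
        rw [← Real.rpow_mul_natCast hρ.le, ← Real.rpow_add hρ, sub_add_cancel]
      rw [f1, Real.mul_rpow hlpos.le hx.le (z := q * j - 2 * α), Real.rpow_neg hlpos.le]
      field_simp
    have hραne : (l t * x) ^ (2 * α) ≠ 0 := by positivity
    rw [slowPart, hd1, root₁_sub_root₂_low hρ h1.le, root₂_eq_low hρ h1.le, hr]
    rw [← hSdef]
    set E := (Real.exp (-(c₀ ^ 2 / (d / 2 + S) * x ^ q)) - Real.exp (-(t / τ))) /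
          (1 - τ * (c₀ ^ 2 / (d / 2 + S) * (l t * x) ^ q))
    have e5 : (l t) ^ (-(q * j - 2 * α)) * ((-(c₀ ^ 2 / (d / 2 + S) * (l t * x) ^ q)) ^ j * E /
        (2 * S * (l t * x) ^ (2 * α))) =
        x ^ (q * j - 2 * α) * (-(c₀ ^ 2 / (d / 2 + S))) ^ j * E * (1 / (2 * S)) := by
      rw [neg_mul_eq_neg_mul, mul_pow]
      rw [show (l t) ^ (-(q * j - 2 * α)) * ((-(c₀ ^ 2 / (d / 2 + S))) ^ j * ((l t * x) ^ q) ^ j *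
        E / (2 * S * (l t * x) ^ (2 * α))) = ((l t) ^ (-(q * j - 2 * α)) * ((l t * x) ^ q) ^ j) *
        ((-(c₀ ^ 2 / (d / 2 + S))) ^ j * E / (2 * S * (l t * x) ^ (2 * α))) by ring, e4]
      field_simp
    rw [← e5]
    push_cast
    ring
  refine (tendsto_congr' hev).2 ?_
  have hexpt : Tendsto (fun t : ℝ => Real.exp (-(t / τ))) atTop (𝓝 0) :=
    Real.tendsto_exp_atBot.comp (tendsto_neg_atTop_atBot.comp
      (tendsto_id.atTop_div_const hτ))
  have hreal : Tendsto (fun t => x ^ (q * j - 2 * α) *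
      (-(c₀ ^ 2 / (d / 2 + lowDisc c₀ d α (l t * x)))) ^ j *
        ((Real.exp (-(c₀ ^ 2 / (d / 2 + lowDisc c₀ d α (l t * x)) * x ^ q)) -
          Real.exp (-(t / τ))) /
          (1 - τ * (c₀ ^ 2 / (d / 2 + lowDisc c₀ d α (l t * x)) * (l t * x) ^ q))) *
        (1 / (2 * lowDisc c₀ d α (l t * x)))) atTop
      (𝓝 (x ^ (q * j - 2 * α) * (-(c₀ ^ 2 / d)) ^ j *
        ((Real.exp (-(c₀ ^ 2 / d * x ^ q)) - 0) / (1 - τ * 0)) * (1 / (2 * (d / 2))))) := by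
    refine (((hk.neg.pow j).const_mul _).mul (Tendsto.div ?_ ?_ (by norm_num))).mul
      (tendsto_const_nhds.div (hSt.const_mul 2) (by positivity))
    · exact ((Real.continuous_exp.tendsto _).comp (hk.mul_const (x ^ q)).neg).sub hexpt
    · exact (hr₁.const_mul τ).const_sub 1
  have hdata : Tendsto (fun t => (G t 1 + τ * G t 2) +
      ((d / 2 + lowDisc c₀ d α (l t * x)) * (l t * x) ^ (2 * α) : ℝ) * (G t 0 + τ * G t 1)) atTop
      (𝓝 (G₀ 1 + τ * G₀ 2)) := by
    have h1 := (hG 1).add ((hG 2).const_mul (τ : ℂ))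
    have h0 := (hG 0).add ((hG 1).const_mul (τ : ℂ))
    -- The term -λ₂(F₀+τF₁). For α > 0 the factor λ₂ tends to 0; for α = 0 it tends to -d and the
    -- data factor has to vanish instead.
    have h2 : Tendsto (fun t => (((d / 2 + lowDisc c₀ d α (l t * x)) * (l t * x) ^ (2 * α) : ℝ) : ℂ)
        * (G t 0 + τ * G t 1)) atTop (𝓝 0) := by
      rcases hα₀.eq_or_lt with hα' | hα'
      · subst hα'
        rw [or_iff_right (lt_irrefl _)] at hG₀
        rw [hG₀] at h0
        have h3 : Tendsto (fun t => (d / 2 + lowDisc c₀ d 0 (l t * x)) * (l t * x) ^ (2 * (0 : ℝ)))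
            atTop (𝓝 (d / 2 + d / 2)) := by
          simpa using hSt.const_add (d / 2)
        have := ((Complex.continuous_ofReal.tendsto _).comp h3).mul h0
        simpa using this
      · have h3 := (hSt.const_add (d / 2)).mul (hpow (y := 2 * α) (by linarith))
        have := ((Complex.continuous_ofReal.tendsto _).comp h3).mul h0
        simpa using this
    simpa using h1.add h2
  have := ((Complex.continuous_ofReal.tendsto _).comp hreal).mul hdata
  convert! this using 3
  rw [mul_zero, sub_zero, sub_zero, div_one, mul_div_cancel₀ _ (two_ne_zero' ℝ)]

/-! ### Weighted `L²` norms on the frequency side -/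

theorem eLpNorm_comp_smul {n : ℕ} {E : Type*} [NormedAddCommGroup E] (f : Rn n → E) {l : ℝ}
    (hl : 0 < l) :
    eLpNorm (fun η => f (l • η)) 2 volume =
      ENNReal.ofReal (l ^ (-((n : ℝ) / 2))) * eLpNorm f 2 volume := by
  have hemb : MeasurableEmbedding (fun η : Rn n => l • η) :=
    (Homeomorph.smulOfNeZero l hl.ne').measurableEmbedding
  have h := hemb.eLpNorm_map_measure (μ := volume) (g := f) (p := 2)
  rw [Measure.map_addHaar_smul volume hl.ne', finrank_euclideanSpace_fin] at h
  rw [show (fun η => f (l • η)) = f ∘ (fun η => l • η) from rfl, ← h,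
    eLpNorm_smul_measure_of_ne_top (by simp), smul_eq_mul]
  congr 1
  have e : (1 : ℝ≥0∞) / 2 = ENNReal.ofReal (1 / 2) := by
    rw [ENNReal.ofReal_div_of_pos two_pos]; simp
  have hr : (1 / (2 : ℝ≥0∞)).toReal = 1 / 2 := by simp
  rw [hr, ENNReal.ofReal_rpow_of_pos (by positivity), abs_of_pos (by positivity)]
  congr 1
  rw [← Real.rpow_natCast, ← Real.rpow_neg hl.le, ← Real.rpow_mul hl.le]
  congr 1
  ring

theorem rad_smul {n : ℕ} {l : ℝ} (hl : 0 ≤ l) (η : Rn n) : rad (l • η) = l * rad η := by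
  rw [rad, rad, norm_smul, Real.norm_of_nonneg hl]
  ring

theorem measurable_rad {n : ℕ} : Measurable (rad : Rn n → ℝ) := continuous_rad.measurable

/-- Polar coordinates: p+n/2 > 0 is square integrability at the origin, and the exponential handles
infinity. -/
theorem eLpNorm_rpow_mul_exp_lt_top {n : ℕ} (hn : 2 ≤ n) {p γ c : ℝ} (hγ : 0 < γ) (hc : 0 < c)
    (hp : 0 < p + n / 2) :
    eLpNorm (fun η : Rn n => rad η ^ p * Real.exp (-(c * rad η ^ γ))) 2 volume < ⊤ := by
  have := nontrivial_Rn hn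
  have hm : Measurable fun η : Rn n => rad η ^ p * Real.exp (-(c * rad η ^ γ)) := by
    have := measurable_rad (n := n)
    fun_prop
  refine ((memLp_two_iff_integrable_sq hm.aestronglyMeasurable).2 ?_).2
  have h2 := (integrable_fun_norm_addHaar (volume : Measure (Rn n))
    (f := fun y => ((2 * Real.pi * y) ^ p * Real.exp (-(c * (2 * Real.pi * y) ^ γ))) ^ 2)).2
  refine h2 ?_
  have h0 : IntegrableOn (fun y : ℝ => (2 * Real.pi) ^ (2 * p) * (y ^ ((n : ℝ) - 1 + 2 * p) *
      Real.exp (-(2 * c * (2 * Real.pi) ^ γ) * y ^ γ))) (Set.Ioi 0) :=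
    (integrableOn_rpow_mul_exp_neg_mul_rpow (by linarith) hγ (by positivity)).const_mul _
  refine h0.congr_fun (fun y hy => ?_) measurableSet_Ioi
  have hy : 0 < y := hy
  beta_reduce
  rw [finrank_euclideanSpace_fin, smul_eq_mul, mul_pow, ← Real.exp_nat_mul,
    ← Real.rpow_mul_natCast (by positivity), Real.mul_rpow (by positivity) hy.le,
    Real.mul_rpow (by positivity) hy.le, Real.rpow_add hy, ← Real.rpow_natCast y (n - 1),
    Nat.cast_sub (by omega)]
  push_cast
  rw [mul_comm p 2, show -(2 * c * (2 * Real.pi) ^ γ) * y ^ γ =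
    2 * -(c * ((2 * Real.pi) ^ γ * y ^ γ)) by ring]
  ring

/-- The weight `|ξ|^p exp(-c|ξ|^γ t)` restricted to `|ξ| ≤ 1`. -/
def lowWeight {n : ℕ} (p γ c t : ℝ) : Rn n → ℝ :=
  {η | rad η ≤ 1}.indicator fun η => rad η ^ p * Real.exp (-(c * rad η ^ γ * t))

theorem measurableSet_rad_le {n : ℕ} (ε : ℝ) : MeasurableSet {η : Rn n | rad η ≤ ε} :=
  measurableSet_le measurable_rad measurable_const

theorem measurable_lowWeight {n : ℕ} (p γ c t : ℝ) :
    Measurable (lowWeight p γ c t : Rn n → ℝ) := by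
  refine Measurable.indicator ?_ (measurableSet_rad_le 1)
  have := measurable_rad (n := n)
  fun_prop

theorem lowWeight_nonneg {n : ℕ} (p γ c t : ℝ) (η : Rn n) : 0 ≤ lowWeight p γ c t η := by
  refine Set.indicator_nonneg (fun η _ => ?_) η
  have := rad_nonneg η
  positivity

/-- Rescale by (1+t)^{1/γ}. The factor e^c pays for replacing t by 1+t, as cρ^γ ≤ c on ρ ≤ 1, and
makes the bound uniform down to t = 0. -/
theorem exists_eLpNorm_lowWeight_le {n : ℕ} (hn : 2 ≤ n) {p γ c : ℝ} (hγ : 0 < γ) (hc : 0 < c)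
    (hp : 0 < p + n / 2) :
    ∃ K : ℝ, 0 < K ∧ ∀ t : ℝ, 0 ≤ t →
      eLpNorm (lowWeight p γ c t : Rn n → ℝ) 2 volume ≤
        ENNReal.ofReal (K * (1 + t) ^ (-((p + n / 2) / γ))) := by
  set f : Rn n → ℝ := fun η => rad η ^ p * Real.exp (-(c * rad η ^ γ)) with hf
  have hfin : eLpNorm f 2 volume < ⊤ := eLpNorm_rpow_mul_exp_lt_top hn hγ hc hp
  set M := (eLpNorm f 2 volume).toReal
  refine ⟨Real.exp c * (M + 1), by positivity, fun t ht => ?_⟩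
  have hT : 0 < 1 + t := by linarith
  set l := (1 + t) ^ (1 / γ) with hl
  have hl0 : 0 < l := by positivity
  have hlγ : l ^ γ = 1 + t := by
    rw [hl, ← Real.rpow_mul hT.le, one_div_mul_cancel hγ.ne', Real.rpow_one]
  have hpt : ∀ η : Rn n, ‖lowWeight p γ c t η‖ ≤ Real.exp c * l ^ (-p) * f (l • η) := fun η => by
    have hr := rad_nonneg η
    have hfnn : 0 ≤ f (l • η) := by
      have := rad_nonneg (l • η)
      positivity
    rw [Real.norm_of_nonneg (lowWeight_nonneg ..)]
    by_cases hη : η ∈ {η : Rn n | rad η ≤ 1}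
    · rw [lowWeight, Set.indicator_of_mem hη, hf]
      simp only
      rw [rad_smul hl0.le, Real.mul_rpow hl0.le hr, Real.mul_rpow hl0.le hr, hlγ,
        Real.rpow_neg hl0.le]
      have e : Real.exp c * (l ^ p)⁻¹ * (l ^ p * rad η ^ p *
          Real.exp (-(c * ((1 + t) * rad η ^ γ)))) =
          rad η ^ p * (Real.exp c * Real.exp (-(c * ((1 + t) * rad η ^ γ)))) := by
        have : l ^ p ≠ 0 := by positivity
        field_simp
      rw [e, ← Real.exp_add]
      gcongr
      have h1 : rad η ^ γ ≤ 1 := Real.rpow_le_one hr hη hγ.le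
      nlinarith
    · rw [lowWeight, Set.indicator_of_notMem hη]
      positivity
  refine (eLpNorm_mono_real hpt).trans (le_of_eq_of_le
    (eLpNorm_const_smul (Real.exp c * l ^ (-p)) (fun η => f (l • η)) 2 volume) ?_)
  rw [eLpNorm_comp_smul f hl0, Real.enorm_of_nonneg (by positivity),
    ← ENNReal.ofReal_toReal hfin.ne, ← ENNReal.ofReal_mul (by positivity),
    ← ENNReal.ofReal_mul (by positivity)]
  refine ENNReal.ofReal_le_ofReal ?_
  have e : (1 + t) ^ (-((p + n / 2) / γ)) = l ^ (-p) * l ^ (-((n : ℝ) / 2)) := by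
    rw [← Real.rpow_add hl0, hl, ← Real.rpow_mul hT.le]
    congr 1
    field_simp
    ring
  rw [e]
  have : M ≤ M + 1 := by linarith
  calc _ = Real.exp c * M * (l ^ (-p) * l ^ (-((n : ℝ) / 2))) := by ring
    _ ≤ _ := by gcongr

/-- A single term of the exponential series, of order N ≥ κ, dominates the power. -/
theorem exists_exp_neg_le_rpow {c : ℝ} (hc : 0 < c) (κ : ℝ) :
    ∃ K : ℝ, 0 < K ∧ ∀ t : ℝ, 0 ≤ t → Real.exp (-(c * t)) ≤ K * (1 + t) ^ (-κ) := by
  obtain ⟨N, hN⟩ := exists_nat_ge κ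
  refine ⟨Real.exp c * (N.factorial / c ^ N), by positivity, fun t ht => ?_⟩
  have hT : 1 ≤ 1 + t := by linarith
  have h1 := Real.pow_div_factorial_le_exp (c * (1 + t)) (by positivity) N
  have h2 : (1 + t) ^ κ ≤ (1 + t) ^ N := by
    rw [← Real.rpow_natCast]
    exact Real.rpow_le_rpow_of_exponent_le hT hN
  rw [Real.rpow_neg (by positivity), ← div_eq_mul_inv, le_div_iff₀ (by positivity)]
  have e : Real.exp (-(c * t)) = Real.exp c * (Real.exp (c * (1 + t)))⁻¹ := by
    rw [← Real.exp_neg, ← Real.exp_add]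
    congr 1
    ring
  rw [e, mul_assoc]
  refine mul_le_mul_of_nonneg_left ?_ (Real.exp_pos _).le
  rw [inv_mul_le_iff₀ (Real.exp_pos _)]
  rw [div_le_iff₀ (by positivity), mul_pow] at h1
  rw [mul_div_assoc', le_div_iff₀ (by positivity)]
  calc _ ≤ (1 + t) ^ N * c ^ N := by gcongr
    _ ≤ _ := by linarith

/-- For negative `x` the distance from the origin matters: there 1+|η|² ≤ L|η|². -/
theorem exists_rpow_rad_le_bessel {n : ℕ} {ε : ℝ} (hε : 0 < ε) (x : ℝ) :
    ∃ K : ℝ, 0 < K ∧ ∀ η : Rn n, ε ≤ rad η → rad η ^ x ≤ K * bessel x η := by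
  have hsplit : ∀ η : Rn n, rad η ^ x = (2 * Real.pi) ^ x * (‖η‖ ^ 2) ^ (x / 2) := fun η => by
    rw [rad, Real.mul_rpow (by positivity) (norm_nonneg _), ← Real.rpow_natCast,
      ← Real.rpow_mul (norm_nonneg _)]
    congr 2
    push_cast
    ring
  rcases le_total 0 x with hx | hx
  · refine ⟨(2 * Real.pi) ^ x, by positivity, fun η _ => ?_⟩
    rw [hsplit, bessel]
    gcongr
    linarith
  · set L := 1 + (2 * Real.pi / ε) ^ 2
    refine ⟨(2 * Real.pi) ^ x * L ^ (-(x / 2)), by positivity, fun η hη => ?_⟩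
    have hη0 : 0 < ‖η‖ := by
      rw [rad] at hη
      by_contra h
      have : ‖η‖ = 0 := le_antisymm (not_lt.1 h) (norm_nonneg _)
      rw [this] at hη
      linarith
    have h1 : 1 + ‖η‖ ^ 2 ≤ L * ‖η‖ ^ 2 := by
      have h2 : 1 ≤ 2 * Real.pi / ε * ‖η‖ := by
        rw [div_mul_eq_mul_div, le_div_iff₀ hε, one_mul]
        exact hη
      nlinarith [one_le_pow₀ h2 (n := 2), mul_pow (2 * Real.pi / ε) ‖η‖ 2]
    have h2 := Real.rpow_le_rpow_of_nonpos (by positivity) h1 (z := x / 2) (by linarith)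
    rw [Real.mul_rpow (by positivity) (by positivity)] at h2
    rw [hsplit, bessel, mul_assoc, Real.rpow_neg (by positivity)]
    refine mul_le_mul_of_nonneg_left ?_ (by positivity)
    rwa [← div_eq_inv_mul, le_div_iff₀' (by positivity)]

/-! ### Upper bounds for the solution -/

/-- The form in which scaling produces the rate: j from λ₁ʲ, the quotient from the weight
ρ^{s+2-j-2α} in dimension n. -/
theorem rate_eq {n : ℕ} {α s : ℝ} {j : Fin 3} (hα : α < 1 / 2) :
    rate n α s j = j + (s + 2 - j + n / 2 - 2 * α) / (2 - 2 * α) := by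
  obtain ⟨q, rfl⟩ : ∃ q, α = (2 - q) / 2 := ⟨2 - 2 * α, by ring⟩
  have hq : q ≠ 0 := by linarith
  rw [rate, show 2 - 2 * ((2 - q) / 2) = q by ring]
  field_simp
  ring

theorem ofReal_norm_le_dataNorm {n : ℕ} (s : ℝ) (j : Fin 3)
    (φ : Fin 3 → Lp ℂ 1 (volume : Measure (Rn n))) :
    ENNReal.ofReal (‖φ 0‖ + ‖φ 1‖ + ‖φ 2‖) ≤ dataNorm s j (φ 0) (φ 1) (φ 2) := by
  rw [ENNReal.ofReal_add (by positivity) (by positivity),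
    ENNReal.ofReal_add (by positivity) (by positivity), ofReal_norm, ofReal_norm, ofReal_norm,
    dataNorm]
  gcongr <;> exact le_add_self

theorem sum_norm_fourier_le {n : ℕ} (φ : Fin 3 → Lp ℂ 1 (volume : Measure (Rn n))) (η : Rn n) :
    ‖𝓕 (φ 0 : Rn n → ℂ) η‖ + ‖𝓕 (φ 1 : Rn n → ℂ) η‖ + ‖𝓕 (φ 2 : Rn n → ℂ) η‖ ≤
      ‖φ 0‖ + ‖φ 1‖ + ‖φ 2‖ := by
  gcongr <;> exact norm_fourier_le _ _

theorem eLpNorm_const_mul_lowWeight_le {n : ℕ} {p γ c t K κ κ' A N : ℝ} {B : ℝ≥0∞}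
    (hK : eLpNorm (lowWeight p γ c t : Rn n → ℝ) 2 volume ≤ ENNReal.ofReal (K * (1 + t) ^ (-κ)))
    (hA : 0 ≤ A) (hN : 0 ≤ N) (hK0 : 0 ≤ K) (ht : 0 ≤ t) (hκ : κ' ≤ κ)
    (hB : ENNReal.ofReal N ≤ B) :
    eLpNorm (fun η : Rn n => A * N * lowWeight p γ c t η) 2 volume ≤
      ENNReal.ofReal (A * K * (1 + t) ^ (-κ')) * B := by
  have h : (1 + t) ^ (-κ) ≤ (1 + t) ^ (-κ') :=
    Real.rpow_le_rpow_of_exponent_le (by linarith) (by linarith)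
  refine (le_of_eq (eLpNorm_const_smul (A * N) (lowWeight p γ c t) 2 volume)).trans ?_
  rw [Real.enorm_of_nonneg (by positivity)]
  calc _ ≤ ENNReal.ofReal (A * N) * ENNReal.ofReal (K * (1 + t) ^ (-κ)) := by gcongr
    _ ≤ ENNReal.ofReal (A * N) * ENNReal.ofReal (K * (1 + t) ^ (-κ')) := by gcongr
    _ = ENNReal.ofReal (A * K * (1 + t) ^ (-κ')) * ENNReal.ofReal N := by
      rw [← ENNReal.ofReal_mul (by positivity), ← ENNReal.ofReal_mul (by positivity)]
      congr 1
      ring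
    _ ≤ _ := by gcongr

/-- The slow mode of the solution, restricted to low frequencies. -/
def slowSymbol {n : ℕ} (τ c₀ d α ε : ℝ) (φ : Fin 3 → Lp ℂ 1 (volume : Measure (Rn n))) (j : ℕ)
    (t : ℝ) : Rn n → ℂ :=
  {η | rad η ≤ ε}.indicator fun η =>
    slowPart τ (d * rad η ^ (2 * α)) (c₀ ^ 2 * rad η ^ 2) t j fun i => 𝓕 (φ i : Rn n → ℂ) η

section

variable {n : ℕ} {τ c₀ d α ε s : ℝ}

theorem exists_norm_slowSymbol_le (hτ : 0 < τ) (hc₀ : 0 < c₀) (hd : 0 < d)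
    (hα₀ : 0 ≤ α) (j : ℕ) (hε : IsLowRadius τ c₀ d α ε) (σ : ℝ) :
    ∃ A : ℝ, 0 < A ∧ ∀ (φ : Fin 3 → Lp ℂ 1 (volume : Measure (Rn n))) (t : ℝ), 0 ≤ t →
      ∀ η : Rn n, 0 < rad η → ‖((rad η ^ σ : ℝ) : ℂ) * slowSymbol τ c₀ d α ε φ j t η‖ ≤
        A * (‖φ 0‖ + ‖φ 1‖ + ‖φ 2‖) *
          lowWeight (σ + ((2 - 2 * α) * j - 2 * α)) (2 - 2 * α) (c₀ ^ 2 / d) t η := by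
  refine ⟨(2 * c₀ ^ 2 / d) ^ j * 2 * ((1 + τ) * (1 + d)) * (2 / d), by positivity,
    fun φ t ht η hη => ?_⟩
  rw [norm_mul, Complex.norm_real, Real.norm_of_nonneg (by positivity)]
  by_cases h : η ∈ {η : Rn n | rad η ≤ ε}
  · have h1 : η ∈ {η : Rn n | rad η ≤ 1} := le_trans h hε.le_one
    rw [slowSymbol, Set.indicator_of_mem h, lowWeight, Set.indicator_of_mem h1,
      Real.rpow_add hη]
    have hs := norm_slowPart_le hε hτ hc₀ hd hα₀ j hη h ht fun i => 𝓕 (φ i : Rn n → ℂ) η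
    have hN := sum_norm_fourier_le φ η
    set S := (2 * c₀ ^ 2 / d) ^ j * 2 * ((1 + τ) * (1 + d)) * (2 / d)
    have hS : 0 ≤ S := by positivity
    set E := rad η ^ ((2 - 2 * α) * j - 2 * α) *
      Real.exp (-(c₀ ^ 2 / d * rad η ^ (2 - 2 * α) * t))
    have hE : 0 ≤ E := by positivity
    calc _ ≤ rad η ^ σ * (S * (‖φ 0‖ + ‖φ 1‖ + ‖φ 2‖) * E) := by
          gcongr
          refine hs.trans ?_
          gcongr
      _ = _ := by ring
  · rw [slowSymbol, Set.indicator_of_notMem h, norm_zero, mul_zero]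
    have := lowWeight_nonneg (σ + ((2 - 2 * α) * j - 2 * α)) (2 - 2 * α) (c₀ ^ 2 / d) t η
    positivity

theorem exists_eLpNorm_slowSymbol_le (hn : 2 ≤ n) (hτ : 0 < τ) (hc₀ : 0 < c₀) (hd : 0 < d)
    (hα₀ : 0 ≤ α) (hα : α < 1 / 2) (j : Fin 3) (hσ : 0 ≤ s + 2 - j)
    (hε : IsLowRadius τ c₀ d α ε) :
    ∃ C : ℝ, 0 < C ∧ ∀ (φ : Fin 3 → Lp ℂ 1 (volume : Measure (Rn n))) (t : ℝ), 0 ≤ t →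
      eLpNorm (fun η : Rn n => ((rad η ^ (s + 2 - (j : ℝ)) : ℝ) : ℂ) *
          slowSymbol τ c₀ d α ε φ j t η) 2 volume ≤
        ENNReal.ofReal (C * (1 + t) ^ (-rate n α s j)) * dataNorm s j (φ 0) (φ 1) (φ 2) := by
  have hn' : (2 : ℝ) ≤ n := by exact_mod_cast hn
  have hq : 0 < 2 - 2 * α := by linarith
  have hj : (0 : ℝ) ≤ (2 - 2 * α) * (j : ℕ) := by positivity
  obtain ⟨A, hA, h⟩ := exists_norm_slowSymbol_le (n := n) hτ hc₀ hd hα₀ j hε (s + 2 - j)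
  obtain ⟨K, hK, h'⟩ := exists_eLpNorm_lowWeight_le hn (c := c₀ ^ 2 / d)
    (p := s + 2 - j + ((2 - 2 * α) * (j : ℕ) - 2 * α)) hq (by positivity) (by linarith)
  refine ⟨A * K, by positivity, fun φ t ht => (eLpNorm_mono_ae_real
    ((ae_rad_pos hn).mono (h φ t ht))).trans
    (eLpNorm_const_mul_lowWeight_le (h' t ht) hA.le (by positivity) hK.le ht (le_of_eq ?_)
      (ofReal_norm_le_dataNorm s j φ))⟩
  rw [rate_eq hα, eq_div_iff hq.ne', add_mul, div_mul_cancel₀ _ hq.ne']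
  ring

/-- The strict gain `κ` over the rate lets one estimate serve both the upper bound and the
asymptotics. -/
theorem exists_eLpNorm_remainder_le (hn : 2 ≤ n) (hτ : 0 < τ) (hc₀ : 0 < c₀) (hd : 0 < d)
    (hα₀ : 0 ≤ α) (hα : α < 1 / 2) (j : Fin 3) (hσ : 0 ≤ s + 2 - j)
    (hε : IsLowRadius τ c₀ d α ε) :
    ∃ C : ℝ, 0 < C ∧ ∃ κ : ℝ, rate n α s j < κ ∧
      ∀ (φ : Fin 3 → Lp ℂ 1 (volume : Measure (Rn n))) (t : ℝ), 0 ≤ t →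
      eLpNorm (fun η : Rn n => ((rad η ^ (s + 2 - (j : ℝ)) : ℝ) : ℂ) *
          (solSymbol τ (d * rad η ^ (2 * α)) (c₀ ^ 2 * rad η ^ 2) t j
            (fun i => 𝓕 (φ i : Rn n → ℂ) η) - slowSymbol τ c₀ d α ε φ j t η)) 2 volume ≤
        ENNReal.ofReal (C * (1 + t) ^ (-κ)) * dataNorm s j (φ 0) (φ 1) (φ 2) := by
  have hn' : (2 : ℝ) ≤ n := by exact_mod_cast hn
  have hq : 0 < 2 - 2 * α := by linarith
  have hj : (0 : ℝ) ≤ (j : ℕ) := by positivity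
  have hαj : 0 ≤ 2 * α * (j : ℕ) := by positivity
  set σ := s + 2 - j with hσdef
  set q₀ := σ + n / 2 - 2 * α with hq₀def
  have hq₀ : 0 < q₀ := by linarith
  have hrate : rate n α s j = j + q₀ / (2 - 2 * α) := rate_eq hα
  have hκ0 : 0 < rate n α s j := by rw [hrate]; positivity
  -- the exponent for the fast mode
  set δ := (q₀ - 2 * α * q₀ / (2 - 2 * α)) / (2 * rate n α s j) with hδ
  have hδnum : 0 < q₀ - 2 * α * q₀ / (2 - 2 * α) := by
    rw [sub_pos, div_lt_iff₀ hq]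
    nlinarith
  have hδ0 : 0 < δ := by positivity
  set γ := 2 * α + δ with hγ
  have hγ0 : 0 < γ := by positivity
  have hfast : rate n α s j < (σ + (2 * α * (j : ℕ) - 2 * α) + n / 2) / γ := by
    rw [lt_div_iff₀ hγ0, hγ, mul_add]
    have e : rate n α s j * δ = (q₀ - 2 * α * q₀ / (2 - 2 * α)) / 2 := by
      rw [hδ]
      field_simp
    have e' : rate n α s j * (2 * α) = 2 * α * j + 2 * α * q₀ / (2 - 2 * α) := by
      rw [hrate]
      ring
    rw [e, e']
    linarith
  set κ₁ := (σ + (2 * α * (j : ℕ) - 2 * α) + n / 2) / γ with hκ₁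
  -- For the term e^{-t/τ}F_j: on ρ ≤ 1 it is dominated by e^{-ρ^{γ'}t/τ}, and γ' is chosen so that
  -- the resulting decay exponent is the rate plus 1.
  set γ' := (σ + n / 2) / (rate n α s j + 1) with hγ'
  have hσn : 0 < σ + n / 2 := by linarith
  have hγ'0 : 0 < γ' := by positivity
  have hκ₂ : (σ + n / 2) / γ' = rate n α s j + 1 := by
    rw [hγ']
    field_simp
  set κ := min κ₁ (rate n α s j + 1) with hκ
  have hκlt : rate n α s j < κ := lt_min hfast (by linarith)
  have hm : 0 < min (d / 2) (1 / (2 * τ)) := by positivity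
  obtain ⟨K₁, hK₁, h₁⟩ := exists_eLpNorm_lowWeight_le hn (c := min (d / 2) (1 / (2 * τ)))
    (p := σ + (2 * α * (j : ℕ) - 2 * α)) hγ0 hm (by linarith)
  obtain ⟨K₂, hK₂, h₂⟩ := exists_eLpNorm_lowWeight_le hn (c := 1 / τ) (p := σ) hγ'0 (by positivity)
    hσn
  rw [hκ₂] at h₂
  obtain ⟨C₃, hC₃, c, hc, h₃⟩ := exists_norm_solSymbol_le hτ hc₀ hd hα₀ hα hε.pos j
  obtain ⟨K₃, hK₃, h₄⟩ := exists_exp_neg_le_rpow hc κ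
  obtain ⟨L₀, hL₀, hb₀⟩ := exists_rpow_rad_le_bessel (n := n) hε.pos (s + max 1 (2 - (j : ℝ)))
  obtain ⟨L₁, hL₁, hb₁⟩ := exists_rpow_rad_le_bessel (n := n) hε.pos (s + 1)
  obtain ⟨L₂, hL₂, hb₂⟩ := exists_rpow_rad_le_bessel (n := n) hε.pos s
  set A := d ^ (j : ℕ) * 2 * ((1 + τ) * (1 + 2 * c₀ ^ 2 / d)) * (2 / d) with hA
  have hA0 : 0 < A := by positivity
  set L := L₀ + L₁ + L₂ with hL
  refine ⟨A * K₁ + 1 * K₂ + C₃ * K₃ * L, by positivity, κ, hκlt, fun φ t ht => ?_⟩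
  set N := ‖φ 0‖ + ‖φ 1‖ + ‖φ 2‖ with hN
  have hN0 : 0 ≤ N := by positivity
  -- The Sobolev part of the data norm, needed for frequencies above ε; below ε the L¹ norms
  -- suffice.
  set B : Rn n → ℝ := fun η => bessel (s + max 1 (2 - (j : ℝ))) η * ‖𝓕 (φ 0 : Rn n → ℂ) η‖ +
    bessel (s + 1) η * ‖𝓕 (φ 1 : Rn n → ℂ) η‖ + bessel s η * ‖𝓕 (φ 2 : Rn n → ℂ) η‖ with hB
  have hcont : ∀ (r : ℝ) (i : Fin 3), Continuous fun η : Rn n =>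
      bessel r η * ‖𝓕 (φ i : Rn n → ℂ) η‖ := fun r i =>
    ((Complex.continuous_re.comp (hasTemperateGrowth_bessel r).1.continuous).mul (continuous_fourier (φ i)).norm)
  have hBm : AEStronglyMeasurable B volume :=
    (((hcont _ 0).add (hcont _ 1)).add (hcont _ 2)).aestronglyMeasurable
  have hBn : ∀ η, 0 ≤ B η := fun η => by
    have := fun r => (bessel_pos r η).le
    have h0 := this (s + max 1 (2 - (j : ℝ)))
    have h1 := this (s + 1)
    have h2 := this s
    positivity
  have hBle : eLpNorm B 2 volume ≤ dataNorm s j (φ 0) (φ 1) (φ 2) := by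
    have hi : ∀ (r : ℝ) (i : Fin 3), eLpNorm (fun η : Rn n =>
        bessel r η * ‖𝓕 (φ i : Rn n → ℂ) η‖) 2 volume ≤
        sobolevNorm r (φ i : 𝓢'(Rn n, ℂ)) := fun r i => by
      refine le_trans (le_of_eq (eLpNorm_congr_norm_ae (Eventually.of_forall fun η => ?_)))
        (eLpNorm_bessel_mul_le (hasFourierFunction_integral (φ i)) r)
      rw [norm_mul, norm_mul, norm_norm, Complex.norm_real]
    refine (eLpNorm_add_le ((hcont _ 0).add (hcont _ 1)).aestronglyMeasurable
      (hcont _ 2).aestronglyMeasurable one_le_two).trans ?_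
    refine (add_le_add_left (eLpNorm_add_le (hcont _ 0).aestronglyMeasurable
      (hcont _ 1).aestronglyMeasurable one_le_two) _).trans ?_
    rw [dataNorm]
    gcongr
    · exact (hi _ 0).trans le_self_add
    · exact (hi _ 1).trans le_self_add
    · exact (hi _ 2).trans le_self_add
  set w₁ : Rn n → ℝ := lowWeight (σ + (2 * α * (j : ℕ) - 2 * α)) γ (min (d / 2) (1 / (2 * τ))) t
    with hw₁
  set w₂ : Rn n → ℝ := lowWeight σ γ' (1 / τ) t with hw₂
  have hpt : ∀ᵐ η : Rn n, ‖((rad η ^ σ : ℝ) : ℂ) *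
      (solSymbol τ (d * rad η ^ (2 * α)) (c₀ ^ 2 * rad η ^ 2) t j
        (fun i => 𝓕 (φ i : Rn n → ℂ) η) - slowSymbol τ c₀ d α ε φ j t η)‖ ≤
      A * N * w₁ η + 1 * N * w₂ η + C₃ * Real.exp (-(c * t)) * L * B η := by
    filter_upwards [ae_rad_pos hn, ae_root₁_sub_root₂_ne_zero hn hc₀ hd hα] with η hη hne
    have hw₁0 : 0 ≤ w₁ η := lowWeight_nonneg ..
    have hw₂0 : 0 ≤ w₂ η := lowWeight_nonneg ..
    have hB0 := hBn η
    rw [norm_mul, Complex.norm_real, Real.norm_of_nonneg (by positivity)]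
    by_cases h : η ∈ {η : Rn n | rad η ≤ ε}
    · have h1 : η ∈ {η : Rn n | rad η ≤ 1} := le_trans h hε.le_one
      have hη1 : rad η ≤ 1 := h1
      rw [slowSymbol, Set.indicator_of_mem h, solSymbol_eq_slowPart, add_sub_cancel_left]
      have hf := norm_fastPart_le hε hτ hd hα₀ hα j hη h ht fun i => 𝓕 (φ i : Rn n → ℂ) η
      have hsum := sum_norm_fourier_le φ η
      have hFj : ‖𝓕 (φ j : Rn n → ℂ) η‖ ≤ N := by
        refine le_trans ?_ hsum
        have a0 := norm_nonneg (𝓕 (φ 0 : Rn n → ℂ) η)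
        have a1 := norm_nonneg (𝓕 (φ 1 : Rn n → ℂ) η)
        have a2 := norm_nonneg (𝓕 (φ 2 : Rn n → ℂ) η)
        fin_cases j <;> simp <;> linarith
      have e1 : rad η ^ σ * ‖fastPart τ (d * rad η ^ (2 * α)) (c₀ ^ 2 * rad η ^ 2) t j
          fun i => 𝓕 (φ i : Rn n → ℂ) η‖ ≤ A * N * w₁ η := by
        rw [hw₁, lowWeight, Set.indicator_of_mem h1, Real.rpow_add hη]
        have hex : Real.exp (-(min (d / 2) (1 / (2 * τ)) * rad η ^ (2 * α) * t)) ≤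
            Real.exp (-(min (d / 2) (1 / (2 * τ)) * rad η ^ γ * t)) := by
          have : rad η ^ γ ≤ rad η ^ (2 * α) :=
            Real.rpow_le_rpow_of_exponent_ge hη hη1 (by linarith)
          gcongr
        calc _ ≤ rad η ^ σ * (A * N * (rad η ^ (2 * α * (j : ℕ) - 2 * α) *
                Real.exp (-(min (d / 2) (1 / (2 * τ)) * rad η ^ γ * t)))) := by
              gcongr
              refine hf.trans ?_
              gcongr
          _ = _ := by ring
      have e2 : rad η ^ σ * ‖(Real.exp (-(t / τ)) : ℂ) * 𝓕 (φ j : Rn n → ℂ) η‖ ≤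
          1 * N * w₂ η := by
        rw [hw₂, lowWeight, Set.indicator_of_mem h1, norm_mul, Complex.norm_real,
          Real.norm_of_nonneg (Real.exp_pos _).le]
        have hex : Real.exp (-(t / τ)) ≤ Real.exp (-(1 / τ * rad η ^ γ' * t)) := by
          have h2 : rad η ^ γ' ≤ 1 := Real.rpow_le_one hη.le hη1 hγ'0.le
          have h3 : 1 / τ * rad η ^ γ' * t ≤ 1 / τ * 1 * t := by gcongr
          gcongr
          linarith [show 1 / τ * 1 * t = t / τ by ring]
        calc _ ≤ rad η ^ σ * (Real.exp (-(1 / τ * rad η ^ γ' * t)) * N) := by gcongr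
          _ = _ := by ring
      have e3 : rad η ^ σ * ‖(Real.exp (-(t / τ)) : ℂ) * 𝓕 (φ j : Rn n → ℂ) η -
          fastPart τ (d * rad η ^ (2 * α)) (c₀ ^ 2 * rad η ^ 2) t j
          fun i => 𝓕 (φ i : Rn n → ℂ) η‖ ≤ A * N * w₁ η + 1 * N * w₂ η := by
        refine (mul_le_mul_of_nonneg_left (norm_sub_le _ _) (by positivity)).trans ?_
        rw [mul_add]
        linarith
      refine e3.trans (le_add_of_nonneg_right ?_)
      positivity
    · rw [slowSymbol, Set.indicator_of_notMem h, sub_zero]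
      have hεη : ε ≤ rad η := (not_le.1 h).le
      have := h₃ (rad η) hεη t ht (fun i => 𝓕 (φ i : Rn n → ℂ) η) hne
      have e1 : rad η ^ σ = rad η ^ s * rad η ^ (2 - (j : ℝ)) := by
        rw [← Real.rpow_add hη]
        congr 1
        rw [hσdef]
        ring
      rw [e1, mul_assoc]
      have f0 := hb₀ η hεη
      have f1 := hb₁ η hεη
      have f2 := hb₂ η hεη
      rw [Real.rpow_add hη] at f0 f1
      rw [Real.rpow_one] at f1
      have hbp := fun r => (bessel_pos r η).le
      have hlast : rad η ^ s * (rad η ^ max 1 (2 - (j : ℝ)) * ‖𝓕 (φ 0 : Rn n → ℂ) η‖ +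
          rad η * ‖𝓕 (φ 1 : Rn n → ℂ) η‖ + ‖𝓕 (φ 2 : Rn n → ℂ) η‖) ≤ L * B η := by
        have g0 : rad η ^ s * rad η ^ max 1 (2 - (j : ℝ)) ≤
            L * bessel (s + max 1 (2 - (j : ℝ))) η :=
          f0.trans (mul_le_mul_of_nonneg_right (by linarith) (hbp _))
        have g1 : rad η ^ s * rad η ≤ L * bessel (s + 1) η :=
          f1.trans (mul_le_mul_of_nonneg_right (by linarith) (hbp _))
        have g2 : rad η ^ s ≤ L * bessel s η :=
          f2.trans (mul_le_mul_of_nonneg_right (by linarith) (hbp _))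
        have k0 := mul_le_mul_of_nonneg_right g0 (norm_nonneg (𝓕 (φ 0 : Rn n → ℂ) η))
        have k1 := mul_le_mul_of_nonneg_right g1 (norm_nonneg (𝓕 (φ 1 : Rn n → ℂ) η))
        have k2 := mul_le_mul_of_nonneg_right g2 (norm_nonneg (𝓕 (φ 2 : Rn n → ℂ) η))
        rw [hB]
        simp only
        linarith
      calc _ ≤ rad η ^ s * (C₃ * Real.exp (-(c * t)) *
              (rad η ^ max 1 (2 - (j : ℝ)) * ‖𝓕 (φ 0 : Rn n → ℂ) η‖ +
                rad η * ‖𝓕 (φ 1 : Rn n → ℂ) η‖ + ‖𝓕 (φ 2 : Rn n → ℂ) η‖)) :=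
            mul_le_mul_of_nonneg_left this (by positivity)
        _ = C₃ * Real.exp (-(c * t)) * (rad η ^ s *
              (rad η ^ max 1 (2 - (j : ℝ)) * ‖𝓕 (φ 0 : Rn n → ℂ) η‖ +
                rad η * ‖𝓕 (φ 1 : Rn n → ℂ) η‖ + ‖𝓕 (φ 2 : Rn n → ℂ) η‖)) := by ring
        _ ≤ C₃ * Real.exp (-(c * t)) * (L * B η) := by gcongr
        _ = 0 + C₃ * Real.exp (-(c * t)) * L * B η := by ring
        _ ≤ _ := by gcongr; positivity
  have m₁ : AEStronglyMeasurable (fun η => A * N * w₁ η) volume :=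
    ((measurable_lowWeight _ _ _ _).const_mul _).aestronglyMeasurable
  have m₂ : AEStronglyMeasurable (fun η => 1 * N * w₂ η) volume :=
    ((measurable_lowWeight _ _ _ _).const_mul _).aestronglyMeasurable
  refine (eLpNorm_mono_ae_real hpt).trans ?_
  refine (eLpNorm_add_le (m₁.add m₂) (hBm.const_mul _) one_le_two).trans ?_
  refine (add_le_add_left (eLpNorm_add_le m₁ m₂ one_le_two) _).trans ?_
  have hND := ofReal_norm_le_dataNorm s j φ
  have b₁ := eLpNorm_const_mul_lowWeight_le (h₁ t ht) hA0.le hN0 hK₁.le ht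
    (min_le_left κ₁ (rate n α s j + 1)) hND
  have b₂ := eLpNorm_const_mul_lowWeight_le (h₂ t ht) zero_le_one hN0 hK₂.le ht
    (min_le_right κ₁ (rate n α s j + 1)) hND
  have b₃ : eLpNorm (fun η => C₃ * Real.exp (-(c * t)) * L * B η) 2 volume ≤
      ENNReal.ofReal (C₃ * K₃ * L * (1 + t) ^ (-κ)) * dataNorm s j (φ 0) (φ 1) (φ 2) := by
    refine (le_of_eq (eLpNorm_const_smul (C₃ * Real.exp (-(c * t)) * L) B 2 volume)).trans ?_
    rw [Real.enorm_of_nonneg (by positivity)]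
    gcongr ENNReal.ofReal ?_ * ?_
    calc _ ≤ C₃ * (K₃ * (1 + t) ^ (-κ)) * L := by gcongr; exact h₄ t ht
      _ = _ := by ring
  refine (add_le_add (add_le_add b₁ b₂) b₃).trans (le_of_eq ?_)
  have hT : 0 < 1 + t := by linarith
  rw [← add_mul, ← add_mul, ← ENNReal.ofReal_add (by positivity) (by positivity),
    ← ENNReal.ofReal_add (by positivity) (by positivity)]
  congr 2
  ring

end

/-! ### The asymptotic profile on the frequency side -/

theorem eLpNorm_two_eq {X E : Type*} [MeasurableSpace X] (μ : Measure X) [NormedAddCommGroup E]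
    (f : X → E) : eLpNorm f 2 μ = (∫⁻ x, ‖f x‖ₑ ^ (2 : ℝ) ∂μ) ^ (1 / (2 : ℝ)) := by
  rw [eLpNorm_eq_lintegral_rpow_enorm_toReal two_ne_zero (by simp)]
  simp

theorem tendsto_eLpNorm_two_zero {X ι E : Type*} [MeasurableSpace X] {μ : Measure X}
    [NormedAddCommGroup E] {l : Filter ι} [l.IsCountablyGenerated] {F : ι → X → E} {g : X → ℝ}
    (hF : ∀ᶠ t in l, AEStronglyMeasurable (F t) μ) (hle : ∀ᶠ t in l, ∀ᵐ x ∂μ, ‖F t x‖ ≤ g x)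
    (hg : eLpNorm g 2 μ < ⊤) (hlim : ∀ᵐ x ∂μ, Tendsto (fun t => F t x) l (𝓝 0)) :
    Tendsto (fun t => eLpNorm (F t) 2 μ) l (𝓝 0) := by
  have hfin : ∫⁻ x, ‖g x‖ₑ ^ (2 : ℝ) ∂μ ≠ ⊤ := fun h => by
    rw [eLpNorm_two_eq, h, ENNReal.top_rpow_of_pos (by norm_num)] at hg
    exact lt_irrefl _ hg
  have hm : ∀ᶠ t in l, AEMeasurable (fun x => ‖F t x‖ₑ ^ (2 : ℝ)) μ :=
    hF.mono fun t ht => ht.enorm.pow_const _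
  have hb : ∀ᶠ t in l, ∀ᵐ x ∂μ, ‖F t x‖ₑ ^ (2 : ℝ) ≤ ‖g x‖ₑ ^ (2 : ℝ) :=
    hle.mono fun t ht => ht.mono fun x hx => by
      refine ENNReal.rpow_le_rpow ?_ (by norm_num)
      rw [← ofReal_norm, ← ofReal_norm (g x)]
      exact ENNReal.ofReal_le_ofReal (hx.trans (le_abs_self _))
  have hl : ∀ᵐ x ∂μ, Tendsto (fun t => ‖F t x‖ₑ ^ (2 : ℝ)) l (𝓝 0) :=
    hlim.mono fun x hx => by
      have h1 : Tendsto (fun t => ‖F t x‖ₑ) l (𝓝 0) := by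
        have := (continuous_enorm.tendsto (0 : E)).comp hx
        rwa [enorm_zero] at this
      have h2 := ((ENNReal.continuous_rpow_const (y := 2)).tendsto 0).comp h1
      rwa [ENNReal.zero_rpow_of_pos (by norm_num)] at h2
  have h := tendsto_lintegral_filter_of_dominated_convergence' _ hm hb hfin hl
  rw [lintegral_zero] at h
  have h2 := ((ENNReal.continuous_rpow_const (y := 1 / 2)).tendsto 0).comp h
  rw [ENNReal.zero_rpow_of_pos (by norm_num)] at h2
  exact h2.congr fun t => (eLpNorm_two_eq μ (F t)).symm

/-- Change of variables: the power of t is exactly what turns decay at rate (x+n/2)/q into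
boundedness of a rescaled function. -/
theorem ofReal_mul_eLpNorm_eq {n : ℕ} {q t : ℝ} (hq : 0 < q) (ht : 0 < t) (x : ℝ)
    (f : Rn n → ℂ) :
    ENNReal.ofReal (t ^ ((x + n / 2) / q)) * eLpNorm f 2 volume =
      eLpNorm (fun ζ => (((t ^ (-(1 / q))) ^ (-x) : ℝ) : ℂ) * f (t ^ (-(1 / q)) • ζ)) 2
        volume := by
  have hl : 0 < t ^ (-(1 / q)) := by positivity
  have := eLpNorm_const_smul (((t ^ (-(1 / q))) ^ (-x) : ℝ) : ℂ) (fun ζ => f (t ^ (-(1 / q)) • ζ)) 2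
    (volume : Measure (Rn n))
  refine Eq.trans ?_ this.symm
  rw [eLpNorm_comp_smul f hl, ← mul_assoc, ← ofReal_norm, Complex.norm_real,
    Real.norm_of_nonneg (by positivity), ← ENNReal.ofReal_mul (by positivity),
    ← Real.rpow_add hl, ← Real.rpow_mul ht.le]
  congr 3
  field_simp
  ring

theorem lowWeight_smul_le {n : ℕ} {p q c t : ℝ} (hq : 0 < q) (ht : 0 < t) (ζ : Rn n) :
    lowWeight p q c t (t ^ (-(1 / q)) • ζ) ≤
      (t ^ (-(1 / q))) ^ p * (rad ζ ^ p * Real.exp (-(c * rad ζ ^ q))) := by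
  have hr := rad_nonneg ζ
  have hl : 0 < t ^ (-(1 / q)) := by positivity
  refine (Set.indicator_le_self' (fun η _ => ?_) _).trans (le_of_eq ?_)
  · have := rad_nonneg η
    positivity
  · have e : (t ^ (-(1 / q))) ^ q * t = 1 := by
      rw [← Real.rpow_mul ht.le, neg_mul, one_div_mul_cancel hq.ne', Real.rpow_neg_one,
        inv_mul_cancel₀ ht.ne']
    rw [rad_smul hl.le, Real.mul_rpow hl.le hr, Real.mul_rpow hl.le hr, mul_assoc]
    congr 4
    linear_combination c * rad ζ ^ q * e

/-- The symbol of the profile restricted to `|ξ| ≤ ε`. -/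
def lowProfile {n : ℕ} (c₀ d α ε : ℝ) (j : ℕ) (t : ℝ) : Rn n → ℝ :=
  {η | rad η ≤ ε}.indicator fun η => rad η ^ ((2 - 2 * α) * j - 2 * α) * (-(c₀ ^ 2 / d)) ^ j *
    Real.exp (-(c₀ ^ 2 / d * rad η ^ (2 - 2 * α) * t)) * (1 / d)

section

variable {n : ℕ} {τ c₀ d α ε s : ℝ}

theorem norm_lowProfile_le (hd : 0 < d) (hε : ε ≤ 1) (j : ℕ) (σ t : ℝ) {η : Rn n}
    (hη : 0 < rad η) :
    ‖rad η ^ σ * lowProfile c₀ d α ε j t η‖ ≤ (c₀ ^ 2 / d) ^ j * (1 / d) *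
      lowWeight (σ + ((2 - 2 * α) * j - 2 * α)) (2 - 2 * α) (c₀ ^ 2 / d) t η := by
  by_cases h : η ∈ {η : Rn n | rad η ≤ ε}
  · have h1 : η ∈ {η : Rn n | rad η ≤ 1} := le_trans h hε
    rw [lowProfile, Set.indicator_of_mem h, lowWeight, Set.indicator_of_mem h1,
      Real.rpow_add hη, norm_mul, norm_mul, norm_mul, norm_mul, norm_pow, norm_neg,
      Real.norm_of_nonneg (by positivity), Real.norm_of_nonneg (by positivity),
      Real.norm_of_nonneg (by positivity), Real.norm_of_nonneg (by positivity),
      Real.norm_of_nonneg (by positivity)]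
    refine le_of_eq ?_
    ring
  · rw [lowProfile, Set.indicator_of_notMem h, mul_zero, norm_zero]
    have := lowWeight_nonneg (σ + ((2 - 2 * α) * j - 2 * α)) (2 - 2 * α) (c₀ ^ 2 / d) t η
    positivity

theorem measurable_lowProfile (j : ℕ) (t : ℝ) :
    Measurable (lowProfile c₀ d α ε j t : Rn n → ℝ) := by
  refine Measurable.indicator ?_ (measurableSet_rad_le ε)
  have := measurable_rad (n := n)
  fun_prop

theorem measurable_slowSymbol (φ : Fin 3 → Lp ℂ 1 (volume : Measure (Rn n))) (j : ℕ) (t : ℝ) :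
    Measurable (slowSymbol τ c₀ d α ε φ j t) := by
  refine Measurable.indicator ?_ (measurableSet_rad_le ε)
  have hr := measurable_rad (n := n)
  have hφ := fun i => (continuous_fourier (φ i)).measurable
  have hE := fun t => (continuous_expInt t).measurable
  have h₁ : Measurable fun η : Rn n => root₁ (d * rad η ^ (2 * α)) (c₀ ^ 2 * rad η ^ 2) := by
    unfold root₁ sqrtDisc
    fun_prop
  have h₂ : Measurable fun η : Rn n => root₂ (d * rad η ^ (2 * α)) (c₀ ^ 2 * rad η ^ 2) := by
    unfold root₂ sqrtDisc
    fun_prop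
  have h₃ : Measurable fun η : Rn n =>
      duhamel τ (root₁ (d * rad η ^ (2 * α)) (c₀ ^ 2 * rad η ^ 2)) t :=
    ((hE t).comp (h₁.add_const _)).const_mul _
  unfold slowPart
  exact (((h₁.pow_const j).mul h₃).mul (((hφ 1).add ((hφ 2).const_mul _)).sub
    (h₂.mul ((hφ 0).add ((hφ 1).const_mul _))))).div (h₁.sub h₂)

/-- Dominated convergence in the parabolic variable ζ. The dominating function is the self-similar
weight, and the pointwise limit is `tendsto_slowPart`, the transforms of the data being evaluated at
points tending to 0. -/
theorem tendsto_eLpNorm_slowSymbol_sub (hn : 2 ≤ n) (hτ : 0 < τ) (hc₀ : 0 < c₀) (hd : 0 < d)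
    (hα₀ : 0 ≤ α) (hα : α < 1 / 2) (j : Fin 3) (hσ : 0 ≤ s + 2 - j)
    (hε : IsLowRadius τ c₀ d α ε) (φ : Fin 3 → Lp ℂ 1 (volume : Measure (Rn n)))
    (hφ : 0 < α ∨ mass (φ 0 + (τ : ℂ) • φ 1) = 0) :
    Tendsto (fun t : ℝ => ENNReal.ofReal (t ^ rate n α s j) *
      eLpNorm (fun η : Rn n => ((rad η ^ (s + 2 - (j : ℝ)) : ℝ) : ℂ) *
        (slowSymbol τ c₀ d α ε φ j t η -
          mass (φ 1 + (τ : ℂ) • φ 2) * (lowProfile c₀ d α ε j t η : ℝ))) 2 volume)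
      atTop (𝓝 0) := by
  have hn' : (2 : ℝ) ≤ n := by exact_mod_cast hn
  have hj : (0 : ℝ) ≤ (2 - 2 * α) * (j : ℕ) := mul_nonneg (by linarith) (Nat.cast_nonneg _)
  set q := 2 - 2 * α with hq
  have hq0 : 0 < q := by linarith
  set σ := s + 2 - (j : ℝ) with hσdef
  set x := σ + (q * (j : ℕ) - 2 * α) with hx
  set P := mass (φ 1 + (τ : ℂ) • φ 2) with hP
  have hrate : rate n α s j = (x + n / 2) / q := by
    rw [rate_eq hα, ← hq, eq_div_iff hq0.ne', add_mul, div_mul_cancel₀ _ hq0.ne', hx]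
    ring
  set f : ℝ → Rn n → ℂ := fun t η => ((rad η ^ σ : ℝ) : ℂ) *
    (slowSymbol τ c₀ d α ε φ j t η - P * (lowProfile c₀ d α ε j t η : ℝ)) with hf
  have hfm : ∀ t, Measurable (f t) := fun t => by
    have h1 := measurable_slowSymbol (τ := τ) (c₀ := c₀) (d := d) (α := α) (ε := ε) φ j t
    have h2 := measurable_lowProfile (n := n) (c₀ := c₀) (d := d) (α := α) (ε := ε) j t
    have h3 := measurable_rad (n := n)
    fun_prop
  rw [hrate]
  have hev : ∀ᶠ t : ℝ in atTop, eLpNorm (fun ζ => (((t ^ (-(1 / q))) ^ (-x) : ℝ) : ℂ) *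
      f t (t ^ (-(1 / q)) • ζ)) 2 volume =
      ENNReal.ofReal (t ^ ((x + n / 2) / q)) * eLpNorm (f t) 2 volume := by
    filter_upwards [eventually_gt_atTop 0] with t ht
    exact (ofReal_mul_eLpNorm_eq hq0 ht x (f t)).symm
  refine (tendsto_congr' hev).1 ?_
  obtain ⟨A, hA, hslow⟩ := exists_norm_slowSymbol_le (n := n) hτ hc₀ hd hα₀ j hε σ
  set B := A * (‖φ 0‖ + ‖φ 1‖ + ‖φ 2‖) + ‖P‖ * ((c₀ ^ 2 / d) ^ (j : ℕ) * (1 / d)) with hB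
  have hB0 : 0 ≤ B := by positivity
  refine tendsto_eLpNorm_two_zero
    (g := fun ζ => B * (rad ζ ^ x * Real.exp (-(c₀ ^ 2 / d * rad ζ ^ q)))) ?_ ?_ ?_ ?_
  · refine Eventually.of_forall fun t => Measurable.aestronglyMeasurable ?_
    exact ((hfm t).comp (measurable_const_smul _)).const_mul _
  · filter_upwards [eventually_gt_atTop 0] with t ht
    filter_upwards [ae_rad_pos hn] with ζ hζ
    have hl : 0 < t ^ (-(1 / q)) := by positivity
    have hlζ : 0 < rad (t ^ (-(1 / q)) • ζ) := by
      rw [rad_smul hl.le]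
      positivity
    have h1 : ‖f t (t ^ (-(1 / q)) • ζ)‖ ≤
        B * lowWeight x q (c₀ ^ 2 / d) t (t ^ (-(1 / q)) • ζ) := by
      have a1 := hslow φ t ht.le _ hlζ
      have a2 := norm_lowProfile_le (α := α) (c₀ := c₀) hd hε.le_one j σ t hlζ
      rw [hf]
      simp only
      rw [mul_sub, mul_left_comm _ P, ← Complex.ofReal_mul]
      refine (norm_sub_le _ _).trans ?_
      rw [norm_mul P, Complex.norm_real, hB, add_mul, mul_assoc ‖P‖]
      gcongr
    have h2 := lowWeight_smul_le (p := x) (c := c₀ ^ 2 / d) hq0 ht ζ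
    rw [norm_mul, Complex.norm_real, Real.norm_of_nonneg (by positivity)]
    calc _ ≤ (t ^ (-(1 / q))) ^ (-x) * (B * ((t ^ (-(1 / q))) ^ x *
            (rad ζ ^ x * Real.exp (-(c₀ ^ 2 / d * rad ζ ^ q))))) := by
          gcongr
          exact h1.trans (by gcongr)
      _ = ((t ^ (-(1 / q))) ^ (-x) * (t ^ (-(1 / q))) ^ x) *
            (B * (rad ζ ^ x * Real.exp (-(c₀ ^ 2 / d * rad ζ ^ q)))) := by ring
      _ = _ := by rw [← Real.rpow_add hl, neg_add_cancel, Real.rpow_zero, one_mul]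
  · have := eLpNorm_const_smul B
      (fun ζ : Rn n => rad ζ ^ x * Real.exp (-(c₀ ^ 2 / d * rad ζ ^ q))) 2 volume
    refine (le_of_eq this).trans_lt (ENNReal.mul_lt_top (by simp) ?_)
    exact eLpNorm_rpow_mul_exp_lt_top hn hq0 (by positivity) (by linarith)
  · filter_upwards [ae_rad_pos hn] with ζ hζ
    have hlt : Tendsto (fun t : ℝ => t ^ (-(1 / q))) atTop (𝓝 0) :=
      tendsto_rpow_neg_atTop (by positivity)
    have hG : ∀ i, Tendsto (fun t : ℝ => 𝓕 (φ i : Rn n → ℂ) (t ^ (-(1 / q)) • ζ)) atTop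
        (𝓝 (mass (φ i))) := fun i => by
      rw [← fourier_zero_eq_mass]
      have h0 : Tendsto (fun t : ℝ => t ^ (-(1 / q)) • ζ) atTop (𝓝 0) := by
        simpa using hlt.smul_const ζ
      exact ((continuous_fourier (φ i)).tendsto 0).comp h0
    have hmain := tendsto_slowPart (c₀ := c₀) hτ hd hα₀ hα j hζ hG
      (by rwa [← mass_add_smul])
    rw [← mass_add_smul, ← hP, ← hq] at hmain
    have hsub := (hmain.sub_const (((rad ζ ^ (q * (j : ℕ) - 2 * α) * (-(c₀ ^ 2 / d)) ^ (j : ℕ) *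
        Real.exp (-(c₀ ^ 2 / d * rad ζ ^ q)) * (1 / d) : ℝ) : ℂ) * P)).const_mul
        ((rad ζ ^ σ : ℝ) : ℂ)
    rw [sub_self, mul_zero] at hsub
    refine hsub.congr' ?_
    -- For fixed ζ the rescaled frequency eventually enters the ball of radius ε, where the rescaled
    -- `lowProfile` equals its limit exactly.
    have hsmall : ∀ᶠ t : ℝ in atTop, t ^ (-(1 / q)) * rad ζ < ε := by
      have : Tendsto (fun t : ℝ => t ^ (-(1 / q)) * rad ζ) atTop (𝓝 0) := by
        simpa using hlt.mul_const (rad ζ)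
      exact this.eventually_lt_const hε.pos
    filter_upwards [hsmall, eventually_gt_atTop 0] with t hsm ht
    have hl : 0 < t ^ (-(1 / q)) := by positivity
    have hmem : t ^ (-(1 / q)) • ζ ∈ {η : Rn n | rad η ≤ ε} := by
      rw [Set.mem_ofPred_eq, rad_smul hl.le]
      exact hsm.le
    rw [hf]
    simp only
    rw [slowSymbol, lowProfile, Set.indicator_of_mem hmem, Set.indicator_of_mem hmem,
      rad_smul hl.le]
    have e : (t ^ (-(1 / q))) ^ q * t = 1 := by
      rw [← Real.rpow_mul ht.le, neg_mul, one_div_mul_cancel hq0.ne', Real.rpow_neg_one,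
        inv_mul_cancel₀ ht.ne']
    have e1 : Real.exp (-(c₀ ^ 2 / d * (t ^ (-(1 / q)) * rad ζ) ^ q * t)) =
        Real.exp (-(c₀ ^ 2 / d * rad ζ ^ q)) := by
      rw [Real.mul_rpow hl.le hζ.le]
      congr 1
      linear_combination (-(c₀ ^ 2 / d * rad ζ ^ q)) * e
    have hxe : (t ^ (-(1 / q))) ^ (-x) * (t ^ (-(1 / q))) ^ σ =
        (t ^ (-(1 / q))) ^ (-(q * (j : ℕ) - 2 * α)) := by
      rw [← Real.rpow_add hl]
      congr 1
      rw [hx]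
      ring
    have hye : (t ^ (-(1 / q))) ^ (-(q * (j : ℕ) - 2 * α)) *
        (t ^ (-(1 / q))) ^ (q * (j : ℕ) - 2 * α) = 1 := by
      rw [← Real.rpow_add hl, neg_add_cancel, Real.rpow_zero]
    rw [← hq, e1, Real.mul_rpow hl.le hζ.le (z := σ),
      Real.mul_rpow hl.le hζ.le (z := q * (j : ℕ) - 2 * α)]
    set m := t ^ (-(1 / q))
    set S := slowPart τ (d * (m * rad ζ) ^ (2 * α)) (c₀ ^ 2 * (m * rad ζ) ^ 2) t j
      fun i => 𝓕 (φ i : Rn n → ℂ) (m • ζ)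
    rw [← hxe] at hye ⊢
    have hye' : ((m ^ (-x) : ℝ) : ℂ) * ((m ^ σ : ℝ) : ℂ) *
        ((m ^ (q * (j : ℕ) - 2 * α) : ℝ) : ℂ) = 1 := by exact_mod_cast hye
    simp only [Complex.ofReal_mul]
    linear_combination (((rad ζ ^ σ : ℝ) : ℂ) * (rad ζ ^ (q * (j : ℕ) - 2 * α) : ℝ) *
      ((-(c₀ ^ 2 / d)) ^ (j : ℕ) : ℝ) * (Real.exp (-(c₀ ^ 2 / d * rad ζ ^ q)) : ℝ) *
      (1 / d : ℝ) * P) * hye'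

end

/-! ### Decay, profile and lower bound for solutions -/

theorem rate_pos {n : ℕ} (hn : 2 ≤ n) {α s : ℝ} {j : Fin 3} (hα : α < 1 / 2)
    (hσ : 0 ≤ s + 2 - j) : 0 < rate n α s j := by
  have hn' : (2 : ℝ) ≤ n := by exact_mod_cast hn
  have hq : 0 < 2 - 2 * α := by linarith
  have : 0 < s + 2 - j + n / 2 - 2 * α := by linarith
  rw [rate_eq hα]
  positivity

theorem tendsto_rpow_mul_one_add_rpow {κ κ' : ℝ} (hκ : 0 < κ) (h : κ < κ') (C : ℝ) {B : ℝ≥0∞}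
    (hB : B ≠ ⊤) :
    Tendsto (fun t : ℝ => ENNReal.ofReal (t ^ κ) * (ENNReal.ofReal (C * (1 + t) ^ (-κ')) * B))
      atTop (𝓝 0) := by
  have h1 : Tendsto (fun t : ℝ => |C| * t ^ (-(κ' - κ))) atTop (𝓝 0) := by
    simpa using (tendsto_rpow_neg_atTop (sub_pos.2 h)).const_mul |C|
  have h2 : Tendsto (fun t : ℝ => ENNReal.ofReal (|C| * t ^ (-(κ' - κ))) * B) atTop (𝓝 0) := by
    have := ENNReal.Tendsto.mul_const (b := B) (ENNReal.tendsto_ofReal h1) (Or.inr hB)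
    simpa using this
  refine tendsto_of_tendsto_of_tendsto_of_le_of_le' tendsto_const_nhds h2
    (Eventually.of_forall fun _ => zero_le) ?_
  filter_upwards [eventually_gt_atTop 0] with t ht
  rw [← mul_assoc, ← ENNReal.ofReal_mul (by positivity)]
  gcongr ENNReal.ofReal ?_ * _
  have h3 : (1 + t) ^ (-κ') ≤ t ^ (-κ') :=
    Real.rpow_le_rpow_of_nonpos ht (by linarith) (by linarith)
  calc t ^ κ * (C * (1 + t) ^ (-κ')) ≤ t ^ κ * (|C| * t ^ (-κ')) := by
        have := le_abs_self C
        gcongr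
    _ = |C| * (t ^ κ * t ^ (-κ')) := by ring
    _ = _ := by rw [← Real.rpow_add ht]; congr 2; ring_nf

section

variable {n : ℕ} {τ c₀ b ν d α ε s : ℝ}

theorem IsSolution.hasFourierFunction_solSymbol (hn : 2 ≤ n) (hτ : 0 < τ) (hc₀ : 0 < c₀)
    (hb : 0 < b) (hν : 0 < ν) (hα₀ : 0 ≤ α) (hα : α < 1 / 2)
    {φ : Fin 3 → Lp ℂ 1 (volume : Measure (Rn n))} {D : Fin 3 → ℝ → 𝓢'(Rn n, ℂ)}
    (h : IsSolution τ c₀ b ν α (φ 0) (φ 1) (φ 2) D) (j : Fin 3) {t : ℝ} (ht : 0 ≤ t) :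
    HasFourierFunction (D j t) (fun η => solSymbol τ (b * ν * rad η ^ (2 * α))
      (c₀ ^ 2 * rad η ^ 2) t j fun i => 𝓕 (φ i : Rn n → ℂ) η) :=
  h.hasFourierFunction hn hτ hc₀ hb hν hα₀ hα (F := fun i => 𝓕 (φ i : Rn n → ℂ))
    (hasFourierFunction_integral _) (hasFourierFunction_integral _)
    (hasFourierFunction_integral _) j ht

theorem HasFourierFunction.aestronglyMeasurable {u : 𝓢'(Rn n, ℂ)} {g : Rn n → ℂ}
    (h : HasFourierFunction u g) : AEStronglyMeasurable g volume :=
  h.locallyIntegrable.aestronglyMeasurable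

theorem aestronglyMeasurable_rad_rpow_mul {g : Rn n → ℂ} (hg : AEStronglyMeasurable g volume)
    (σ : ℝ) : AEStronglyMeasurable (fun η : Rn n => ((rad η ^ σ : ℝ) : ℂ) * g η) volume := by
  have h : Measurable fun η : Rn n => ((rad η ^ σ : ℝ) : ℂ) := by
    have := measurable_rad (n := n)
    fun_prop
  exact h.aestronglyMeasurable.mul hg

theorem exists_homSobolevNorm_le (hn : 2 ≤ n) (hτ : 0 < τ) (hc₀ : 0 < c₀) (hb : 0 < b)
    (hν : 0 < ν) (hα₀ : 0 ≤ α) (hα : α < 1 / 2) (j : Fin 3) (hσ : 0 ≤ s + 2 - j) :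
    ∃ C : ℝ, 0 < C ∧ ∀ (φ : Fin 3 → Lp ℂ 1 (volume : Measure (Rn n)))
      (D : Fin 3 → ℝ → 𝓢'(Rn n, ℂ)), IsSolution τ c₀ b ν α (φ 0) (φ 1) (φ 2) D →
      ∀ t : ℝ, 0 ≤ t → homSobolevNorm (s + 2 - (j : ℝ)) (D j t) ≤
        ENNReal.ofReal (C * (1 + t) ^ (-rate n α s j)) * dataNorm s j (φ 0) (φ 1) (φ 2) := by
  have hd : 0 < b * ν := mul_pos hb hν
  obtain ⟨ε, hε⟩ := exists_isLowRadius hτ hc₀ hd hα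
  obtain ⟨C₁, hC₁, h₁⟩ := exists_eLpNorm_slowSymbol_le hn hτ hc₀ hd hα₀ hα j hσ hε
  obtain ⟨C₂, hC₂, κ, hκ, h₂⟩ := exists_eLpNorm_remainder_le hn hτ hc₀ hd hα₀ hα j hσ hε
  refine ⟨C₂ + C₁, by positivity, fun φ D h t ht => ?_⟩
  have hF := h.hasFourierFunction_solSymbol hn hτ hc₀ hb hν hα₀ hα j ht
  have hS := (measurable_slowSymbol (τ := τ) (c₀ := c₀) (d := b * ν) (α := α) (ε := ε) φ j
    t).aestronglyMeasurable (μ := volume)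
  rw [homSobolevNorm_eq hF]
  have hT : 1 ≤ 1 + t := by linarith
  have hle : (1 + t) ^ (-κ) ≤ (1 + t) ^ (-rate n α s j) :=
    Real.rpow_le_rpow_of_exponent_le hT (by linarith)
  have key := (eLpNorm_add_le (aestronglyMeasurable_rad_rpow_mul
    (hF.aestronglyMeasurable.sub hS) (s + 2 - j)) (aestronglyMeasurable_rad_rpow_mul hS
    (s + 2 - j)) one_le_two).trans (add_le_add (h₂ φ t ht) (h₁ φ t ht))
  refine le_trans (le_of_eq (congrArg (fun f => eLpNorm f 2 volume) (funext fun η => ?_)))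
    (key.trans ?_)
  · simp only [Pi.add_apply, Pi.sub_apply, rad]
    ring
  · rw [← add_mul, ← ENNReal.ofReal_add (by positivity) (by positivity), add_mul]
    gcongr

theorem tendsto_eLpNorm_sub_lowProfile (hn : 2 ≤ n) (hτ : 0 < τ) (hc₀ : 0 < c₀) (hb : 0 < b)
    (hν : 0 < ν) (hα₀ : 0 ≤ α) (hα : α < 1 / 2) (j : Fin 3) (hσ : 0 ≤ s + 2 - j)
    (hε : IsLowRadius τ c₀ (b * ν) α ε) {φ : Fin 3 → Lp ℂ 1 (volume : Measure (Rn n))}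
    {D : Fin 3 → ℝ → 𝓢'(Rn n, ℂ)} (hD : dataNorm s j (φ 0) (φ 1) (φ 2) ≠ ⊤)
    (h : IsSolution τ c₀ b ν α (φ 0) (φ 1) (φ 2) D)
    (hφ : 0 < α ∨ mass (φ 0 + (τ : ℂ) • φ 1) = 0) :
    Tendsto (fun t : ℝ => ENNReal.ofReal (t ^ rate n α s j) *
      eLpNorm (fun η : Rn n => ((rad η ^ (s + 2 - (j : ℝ)) : ℝ) : ℂ) *
        (solSymbol τ (b * ν * rad η ^ (2 * α)) (c₀ ^ 2 * rad η ^ 2) t j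
            (fun i => 𝓕 (φ i : Rn n → ℂ) η) -
          mass (φ 1 + (τ : ℂ) • φ 2) * (lowProfile c₀ (b * ν) α ε j t η : ℝ))) 2 volume)
      atTop (𝓝 0) := by
  have hd : 0 < b * ν := mul_pos hb hν
  obtain ⟨C, hC, κ, hκ, h₂⟩ := exists_eLpNorm_remainder_le hn hτ hc₀ hd hα₀ hα j hσ hε
  have hlim := (tendsto_rpow_mul_one_add_rpow (rate_pos hn hα hσ) hκ C hD).add
    (tendsto_eLpNorm_slowSymbol_sub hn hτ hc₀ hd hα₀ hα j hσ hε φ hφ)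
  rw [add_zero] at hlim
  refine tendsto_of_tendsto_of_tendsto_of_le_of_le' tendsto_const_nhds hlim
    (Eventually.of_forall fun _ => zero_le) ?_
  filter_upwards [eventually_ge_atTop 0] with t ht
  have hF := (h.hasFourierFunction_solSymbol hn hτ hc₀ hb hν hα₀ hα j ht).aestronglyMeasurable
  have hS := (measurable_slowSymbol (τ := τ) (c₀ := c₀) (d := b * ν) (α := α) (ε := ε) φ j
    t).aestronglyMeasurable (μ := volume)
  have hP : AEStronglyMeasurable (fun η : Rn n => mass (φ 1 + (τ : ℂ) • φ 2) *
      (lowProfile c₀ (b * ν) α ε j t η : ℝ)) volume :=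
    ((Complex.measurable_ofReal.comp (measurable_lowProfile j t)).const_mul _).aestronglyMeasurable
  have key := (eLpNorm_add_le (aestronglyMeasurable_rad_rpow_mul (hF.sub hS) (s + 2 - j))
    (aestronglyMeasurable_rad_rpow_mul (hS.sub hP) (s + 2 - j)) one_le_two)
  rw [← mul_add]
  gcongr
  refine le_trans (le_of_eq (congrArg (fun f => eLpNorm f 2 volume) (funext fun η => ?_)))
    (key.trans (add_le_add_left (h₂ φ t ht) _))
  simp only [Pi.add_apply, Pi.sub_apply]
  ring

theorem profileSymbol_two_pi_smul (χ : Rn n → ℝ) (j : ℕ) (t : ℝ) {η : Rn n} (hη : 0 < rad η) :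
    profileSymbol c₀ b ν α χ j t ((2 * Real.pi) • η) =
      χ ((2 * Real.pi) • η) * (rad η ^ ((2 - 2 * α) * j - 2 * α) * (-(c₀ ^ 2 / (b * ν))) ^ j *
        Real.exp (-(c₀ ^ 2 / (b * ν) * rad η ^ (2 - 2 * α) * t)) * (1 / (b * ν))) := by
  have hr : ‖(2 * Real.pi) • η‖ = rad η := by
    rw [norm_smul, Real.norm_of_nonneg (by positivity), rad]
  have hder : iteratedDeriv j (fun t' : ℝ =>
      Real.exp (-(1 / (b * ν)) * c₀ ^ 2 * rad η ^ (2 - 2 * α) * t')) t =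
      (-(1 / (b * ν)) * c₀ ^ 2 * rad η ^ (2 - 2 * α)) ^ j *
      Real.exp (-(1 / (b * ν)) * c₀ ^ 2 * rad η ^ (2 - 2 * α) * t) :=
    congrFun (iteratedDeriv_exp_const_mul j _) t
  rw [profileSymbol, hr, hder, sub_eq_add_neg ((2 - 2 * α) * j), Real.rpow_add hη,
    Real.rpow_mul_natCast hη.le, mul_pow,
    show -(1 / (b * ν)) * c₀ ^ 2 = -(c₀ ^ 2 / (b * ν)) by ring,
    show -(c₀ ^ 2 / (b * ν)) * rad η ^ (2 - 2 * α) * t =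
      -(c₀ ^ 2 / (b * ν) * rad η ^ (2 - 2 * α) * t) by ring]
  ring

theorem IsLowFreqCutoff.exists_bound {ε₀ : ℝ} {χ : Rn n → ℝ} (hχ : IsLowFreqCutoff ε₀ χ) :
    ∃ M : ℝ, ∀ ξ, ‖χ ξ‖ ≤ M := by
  refine hχ.smooth.continuous.bounded_above_of_compact_support
    (HasCompactSupport.intro (isCompact_closedBall (0 : Rn n) ε₀) fun ξ hξ => hχ.eq_zero ξ ?_)
  simpa using hξ

/-- The two symbols agree on ρ ≤ ε, where χ = 1, and beyond ε the heat-type factor decays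
exponentially; hence the choice of χ is immaterial. -/
theorem tendsto_eLpNorm_profileSymbol_sub (hn : 2 ≤ n) (hc₀ : 0 < c₀) (hb : 0 < b) (hν : 0 < ν)
    (hα : α < 1 / 2) (j : Fin 3) (hσ : 0 ≤ s + 2 - j) (hε : 0 < ε) {ε₀ : ℝ}
    (hεε₀ : ε ≤ ε₀ / 2) {χ : Rn n → ℝ} (hχ : IsLowFreqCutoff ε₀ χ) :
    Tendsto (fun t : ℝ => ENNReal.ofReal (t ^ rate n α s j) *
      eLpNorm (fun η : Rn n => ((rad η ^ (s + 2 - (j : ℝ)) : ℝ) : ℂ) *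
        ((profileSymbol c₀ b ν α χ j t ((2 * Real.pi) • η) : ℝ) -
          (lowProfile c₀ (b * ν) α ε j t η : ℝ))) 2 volume)
      atTop (𝓝 0) := by
  have hn' : (2 : ℝ) ≤ n := by exact_mod_cast hn
  have hj : (0 : ℝ) ≤ (2 - 2 * α) * (j : ℕ) := mul_nonneg (by linarith) (Nat.cast_nonneg _)
  set d := b * ν with hdef
  have hd : 0 < d := mul_pos hb hν
  set q := 2 - 2 * α with hq
  have hq0 : 0 < q := by linarith
  set σ := s + 2 - (j : ℝ) with hσdef
  set x := σ + (q * (j : ℕ) - 2 * α) with hx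
  set k := c₀ ^ 2 / d with hk
  have hk0 : 0 < k := by positivity
  obtain ⟨M, hM⟩ := hχ.exists_bound
  have hM0 : 0 ≤ M := (norm_nonneg _).trans (hM 0)
  set g : Rn n → ℝ := fun η => rad η ^ x * Real.exp (-(k * rad η ^ q)) with hg
  have hgfin : eLpNorm g 2 volume < ⊤ := eLpNorm_rpow_mul_exp_lt_top hn hq0 hk0 (by linarith)
  have hkε : 0 < k * ε ^ q := by positivity
  obtain ⟨K, hK, hexp⟩ := exists_exp_neg_le_rpow hkε (rate n α s j + 1)
  set A := M * k ^ (j : ℕ) * (1 / d) * Real.exp (k * ε ^ q) with hA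
  have hA0 : 0 ≤ A := by positivity
  refine tendsto_of_tendsto_of_tendsto_of_le_of_le' tendsto_const_nhds
    (tendsto_rpow_mul_one_add_rpow (rate_pos hn hα hσ) (lt_add_one _) (A * K) hgfin.ne)
    (Eventually.of_forall fun _ => zero_le) ?_
  filter_upwards [eventually_ge_atTop 1] with t ht
  have ht0 : 0 ≤ t := by linarith
  gcongr
  have hpt : ∀ᵐ η : Rn n, ‖((rad η ^ σ : ℝ) : ℂ) *
      ((profileSymbol c₀ b ν α χ j t ((2 * Real.pi) • η) : ℝ) -
        (lowProfile c₀ d α ε j t η : ℝ))‖ ≤ A * K * (1 + t) ^ (-(rate n α s j + 1)) * g η := by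
    filter_upwards [ae_rad_pos hn] with η hη
    have hr : ‖(2 * Real.pi) • η‖ = rad η := by
      rw [norm_smul, Real.norm_of_nonneg (by positivity), rad]
    rw [profileSymbol_two_pi_smul χ j t hη]
    by_cases h : η ∈ {η : Rn n | rad η ≤ ε}
    · rw [lowProfile, Set.indicator_of_mem h, hχ.eq_one _ (by rw [hr]; exact le_trans h hεε₀),
        one_mul, sub_self, mul_zero, norm_zero]
      positivity
    · have h' : ε ≤ rad η := (not_le.1 h).le
      have hpow : ε ^ q ≤ rad η ^ q := by gcongr
      -- Write t = (t-1)+1: the share t-1 ≥ 0 gives uniform decay from ρ ≥ ε, the share 1 keeps the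
      -- square integrability.
      have hE : Real.exp (-(k * rad η ^ q * t)) ≤
          Real.exp (k * ε ^ q) * Real.exp (-(k * ε ^ q * t)) * Real.exp (-(k * rad η ^ q)) := by
        rw [← Real.exp_add, ← Real.exp_add]
        refine Real.exp_le_exp.2 ?_
        nlinarith [mul_le_mul_of_nonneg_left hpow (mul_nonneg hk0.le (sub_nonneg.2 ht))]
      rw [lowProfile, Set.indicator_of_notMem h, Complex.ofReal_zero, sub_zero,
        ← Complex.ofReal_mul, Complex.norm_real, norm_mul, norm_mul, norm_mul, norm_mul, norm_mul,
        norm_pow, norm_neg, Real.norm_of_nonneg (r := rad η ^ σ) (by positivity),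
        Real.norm_of_nonneg (r := rad η ^ (q * (j : ℕ) - 2 * α)) (by positivity),
        Real.norm_of_nonneg (r := k) (by positivity), Real.norm_of_nonneg (Real.exp_pos _).le,
        Real.norm_of_nonneg (r := 1 / d) (by positivity)]
      calc _ ≤ rad η ^ σ * (M * (rad η ^ (q * (j : ℕ) - 2 * α) * k ^ (j : ℕ) *
              (Real.exp (k * ε ^ q) * (K * (1 + t) ^ (-(rate n α s j + 1))) *
                Real.exp (-(k * rad η ^ q))) * (1 / d))) := by
            have := hM ((2 * Real.pi) • η)
            have h3 := hexp t ht0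
            gcongr
            refine hE.trans ?_
            gcongr
        _ = A * K * (1 + t) ^ (-(rate n α s j + 1)) *
              ((rad η ^ σ * rad η ^ (q * (j : ℕ) - 2 * α)) * Real.exp (-(k * rad η ^ q))) := by
            rw [hA]
            ring
        _ = _ := by rw [← Real.rpow_add hη]
  refine (eLpNorm_mono_ae_real hpt).trans (le_of_eq ?_)
  have := eLpNorm_const_smul (A * K * (1 + t) ^ (-(rate n α s j + 1))) g 2 volume
  rw [Real.enorm_of_nonneg (by positivity)] at this
  exact this

/-- After rescaling only the truncation depends on t: the ball becomes ρ ≤ εt^{1/q}, which grows.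
The value at t = 1 is therefore a lower bound. -/
theorem exists_le_eLpNorm_lowProfile (hn : 2 ≤ n) (hc₀ : 0 < c₀) (hd : 0 < d)
    (hα : α < 1 / 2) (j : Fin 3) (hε : 0 < ε) :
    ∃ K : ℝ, 0 < K ∧ ∀ t : ℝ, 1 ≤ t → ENNReal.ofReal K ≤
      ENNReal.ofReal (t ^ rate n α s j) * eLpNorm (fun η : Rn n =>
        ((rad η ^ (s + 2 - (j : ℝ)) : ℝ) : ℂ) * (lowProfile c₀ d α ε j t η : ℝ)) 2 volume := by
  set q := 2 - 2 * α with hq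
  have hq0 : 0 < q := by linarith
  set σ := s + 2 - (j : ℝ) with hσdef
  set x := σ + (q * (j : ℕ) - 2 * α) with hx
  have hrate : rate n α s j = (x + n / 2) / q := by
    rw [rate_eq hα, ← hq, eq_div_iff hq0.ne', add_mul, div_mul_cancel₀ _ hq0.ne', hx]
    ring
  set f : ℝ → Rn n → ℂ := fun t η => ((rad η ^ σ : ℝ) : ℂ) * (lowProfile c₀ d α ε j t η : ℝ)
    with hf
  have hval : ∀ {η : Rn n} (t : ℝ), 0 < rad η → rad η ≤ ε → ‖f t η‖ = rad η ^ x *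
      ((c₀ ^ 2 / d) ^ (j : ℕ) * Real.exp (-(c₀ ^ 2 / d * rad η ^ q * t)) * (1 / d)) := by
    intro η t hη h
    have h : η ∈ {η : Rn n | rad η ≤ ε} := h
    rw [hf]
    simp only
    rw [lowProfile, Set.indicator_of_mem h, ← Complex.ofReal_mul, Complex.norm_real, norm_mul,
      norm_mul, norm_mul, norm_mul, norm_pow, norm_neg, Real.norm_of_nonneg (by positivity),
      Real.norm_of_nonneg (by positivity), Real.norm_of_nonneg (by positivity),
      Real.norm_of_nonneg (by positivity), Real.norm_of_nonneg (by positivity), hx,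
      Real.rpow_add hη]
    ring
  have hm : Measurable (f 1) := by
    have h2 := measurable_lowProfile (n := n) (c₀ := c₀) (d := d) (α := α) (ε := ε) j 1
    have h3 := measurable_rad (n := n)
    fun_prop
  have hpos : eLpNorm (f 1) 2 volume ≠ 0 := fun h0 => by
    rw [eLpNorm_eq_zero_iff hm.aestronglyMeasurable two_ne_zero] at h0
    have hae : ∀ᵐ η : Rn n, η ∉ {η : Rn n | rad η < ε} := by
      filter_upwards [h0, ae_rad_pos hn] with η h1 h2 h3
      have h4 := hval 1 h2 (le_of_lt h3)
      rw [h1, Pi.zero_apply, norm_zero] at h4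
      have : 0 < rad η ^ x * ((c₀ ^ 2 / d) ^ (j : ℕ) *
          Real.exp (-(c₀ ^ 2 / d * rad η ^ q * 1)) * (1 / d)) := by positivity
      exact this.ne h4
    have hopen : IsOpen {η : Rn n | rad η < ε} := isOpen_lt continuous_rad continuous_const
    refine (hopen.measure_pos volume ⟨0, ?_⟩).ne' (measure_eq_zero_iff_ae_notMem.2 hae)
    simpa [rad] using hε
  -- The minimum with 1 makes the constant finite without bounding the norm at t = 1.
  refine ⟨(min (eLpNorm (f 1) 2 volume) 1).toReal,
    ENNReal.toReal_pos (by simpa using hpos) (by simp), fun t ht => ?_⟩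
  have ht0 : 0 < t := by linarith
  rw [ENNReal.ofReal_toReal (by simp), hrate]
  refine (min_le_left _ _).trans ?_
  have hscale := ofReal_mul_eLpNorm_eq hq0 ht0 x (f t)
  refine le_trans (eLpNorm_mono_ae ?_) hscale.ge
  filter_upwards [ae_rad_pos hn] with ζ hζ
  have hl : 0 < t ^ (-(1 / q)) := by positivity
  have hl1 : t ^ (-(1 / q)) ≤ 1 := Real.rpow_le_one_of_one_le_of_nonpos ht (by
    rw [neg_nonpos]; positivity)
  by_cases h : rad ζ ≤ ε
  · have h1 : rad (t ^ (-(1 / q)) • ζ) = t ^ (-(1 / q)) * rad ζ := rad_smul hl.le ζ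
    have h2 : rad (t ^ (-(1 / q)) • ζ) ≤ ε := by
      rw [h1]
      exact (mul_le_of_le_one_left hζ.le hl1).trans h
    have e : (t ^ (-(1 / q))) ^ q * t = 1 := by
      rw [← Real.rpow_mul ht0.le, neg_mul, one_div_mul_cancel hq0.ne', Real.rpow_neg_one,
        inv_mul_cancel₀ ht0.ne']
    rw [hval 1 hζ h, norm_mul, hval t (by rw [h1]; positivity) h2, h1, Complex.norm_real,
      Real.norm_of_nonneg (by positivity), Real.mul_rpow hl.le hζ.le, Real.mul_rpow hl.le hζ.le,
      show c₀ ^ 2 / d * ((t ^ (-(1 / q))) ^ q * rad ζ ^ q) * t =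
        c₀ ^ 2 / d * rad ζ ^ q * ((t ^ (-(1 / q))) ^ q * t) by ring, e]
    have e2 : (t ^ (-(1 / q))) ^ (-x) * (t ^ (-(1 / q))) ^ x = 1 := by
      rw [← Real.rpow_add hl, neg_add_cancel, Real.rpow_zero]
    refine le_of_eq ?_
    linear_combination (-(rad ζ ^ x * ((c₀ ^ 2 / d) ^ (j : ℕ) *
      Real.exp (-(c₀ ^ 2 / d * rad ζ ^ q * 1)) * (1 / d)))) * e2
  · have h' : ζ ∉ {η : Rn n | rad η ≤ ε} := h
    rw [hf]
    simp only
    rw [lowProfile, Set.indicator_of_notMem h', Complex.ofReal_zero, mul_zero, norm_zero]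
    positivity

theorem tendsto_homSobolevNorm_sub_profile (hn : 2 ≤ n) (hτ : 0 < τ) (hc₀ : 0 < c₀) (hb : 0 < b)
    (hν : 0 < ν) (hα₀ : 0 ≤ α) (hα : α < 1 / 2) (j : Fin 3) (hσ : 0 ≤ s + 2 - j) {ε₀ : ℝ}
    (hε₀ : 0 < ε₀) {χ : Rn n → ℝ} (hχ : IsLowFreqCutoff ε₀ χ)
    {φ : Fin 3 → Lp ℂ 1 (volume : Measure (Rn n))}
    {D : Fin 3 → ℝ → 𝓢'(Rn n, ℂ)} (hD : dataNorm s j (φ 0) (φ 1) (φ 2) ≠ ⊤)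
    (h : IsSolution τ c₀ b ν α (φ 0) (φ 1) (φ 2) D)
    (hφ : 0 < α ∨ mass (φ 0 + (τ : ℂ) • φ 1) = 0) :
    Tendsto (fun t : ℝ => ENNReal.ofReal (t ^ rate n α s j) * homSobolevNorm (s + 2 - (j : ℝ))
      (D j t - mass (φ 1 + (τ : ℂ) • φ 2) • profile c₀ b ν α χ j t)) atTop (𝓝 0) := by
  obtain ⟨ε', hε'⟩ := exists_isLowRadius hτ hc₀ (mul_pos hb hν) hα
  have hε := hε'.mono (ε' := min ε' (ε₀ / 2)) (lt_min hε'.pos (by positivity)) (min_le_left _ _)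
  set ε := min ε' (ε₀ / 2)
  set P := mass (φ 1 + (τ : ℂ) • φ 2) with hP
  have l₁ := tendsto_eLpNorm_sub_lowProfile hn hτ hc₀ hb hν hα₀ hα j hσ hε hD h hφ
  have l₂ := ENNReal.Tendsto.const_mul (a := ‖P‖ₑ)
    (tendsto_eLpNorm_profileSymbol_sub (s := s) hn hc₀ hb hν hα j hσ hε.pos (min_le_right _ _) hχ)
    (Or.inr (by simp))
  have hlim := l₁.add l₂
  rw [mul_zero, add_zero] at hlim
  refine tendsto_of_tendsto_of_tendsto_of_le_of_le' tendsto_const_nhds hlim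
    (Eventually.of_forall fun _ => zero_le) ?_
  filter_upwards [eventually_ge_atTop 0] with t ht
  have hF := h.hasFourierFunction_solSymbol hn hτ hc₀ hb hν hα₀ hα j ht
  have hm := integrable_profileSymbol hn c₀ b ν α hα hχ j t
  have hG := hF.sub ((hasFourierFunction_fourierInv_ofIntegrable hm).smul P)
  have hL : AEStronglyMeasurable (fun η : Rn n => (lowProfile c₀ (b * ν) α ε j t η : ℂ)) volume :=
    (Complex.measurable_ofReal.comp (measurable_lowProfile j t)).aestronglyMeasurable
  rw [profile, homSobolevNorm_eq hG, mul_left_comm, ← mul_add]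
  gcongr
  have m₁ := aestronglyMeasurable_rad_rpow_mul
    (hF.aestronglyMeasurable.sub (hL.const_mul P)) (s + 2 - j)
  have m₂ := aestronglyMeasurable_rad_rpow_mul (hm.1.sub hL) (s + 2 - j)
  have key := eLpNorm_sub_le m₁ (m₂.const_mul P) one_le_two
  have hc := eLpNorm_const_smul P (fun η : Rn n => ((rad η ^ (s + 2 - (j : ℝ)) : ℝ) : ℂ) *
    ((profileSymbol c₀ b ν α χ j t ((2 * Real.pi) • η) : ℝ) -
      (lowProfile c₀ (b * ν) α ε j t η : ℝ))) 2 volume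
  refine le_trans (le_of_eq (congrArg (fun f => eLpNorm f 2 volume) (funext fun η => ?_)))
    (key.trans (add_le_add_right (le_of_eq hc) _))
  simp only [Pi.sub_apply, rad]
  ring

/-- The multiple P of the low profile contributes at least K|P|, and the error eventually drops
below K|P|/2. The constant K/2 involves neither the data nor a cut-off χ; only the waiting time
depends on the solution. -/
theorem exists_le_homSobolevNorm (hn : 2 ≤ n) (hτ : 0 < τ) (hc₀ : 0 < c₀) (hb : 0 < b)
    (hν : 0 < ν) (hα₀ : 0 ≤ α) (hα : α < 1 / 2) (j : Fin 3) (hσ : 0 ≤ s + 2 - j) :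
    ∃ c : ℝ, 0 < c ∧ ∀ (φ : Fin 3 → Lp ℂ 1 (volume : Measure (Rn n)))
      (D : Fin 3 → ℝ → 𝓢'(Rn n, ℂ)), dataNorm s j (φ 0) (φ 1) (φ 2) ≠ ⊤ →
      IsSolution τ c₀ b ν α (φ 0) (φ 1) (φ 2) D →
      (0 < α ∨ mass (φ 0 + (τ : ℂ) • φ 1) = 0) → mass (φ 1 + (τ : ℂ) • φ 2) ≠ 0 →
      ∀ᶠ t : ℝ in atTop,
        ENNReal.ofReal (c * t ^ (-rate n α s j) * ‖mass (φ 1 + (τ : ℂ) • φ 2)‖) ≤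
          homSobolevNorm (s + 2 - (j : ℝ)) (D j t) := by
  have hd : 0 < b * ν := mul_pos hb hν
  obtain ⟨ε, hε⟩ := exists_isLowRadius hτ hc₀ hd hα
  obtain ⟨K, hK, hlow⟩ := exists_le_eLpNorm_lowProfile (s := s) hn hc₀ hd hα j hε.pos
  refine ⟨K / 2, by positivity, fun φ D hD h hφ hP0 => ?_⟩
  have l₁ := tendsto_eLpNorm_sub_lowProfile hn hτ hc₀ hb hν hα₀ hα j hσ hε hD h hφ
  set P := mass (φ 1 + (τ : ℂ) • φ 2) with hP
  have hPn : 0 < ‖P‖ := norm_pos_iff.2 hP0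
  have hhalf : 0 < K / 2 * ‖P‖ := by positivity
  filter_upwards [l₁.eventually_lt_const (ENNReal.ofReal_pos.2 hhalf), eventually_ge_atTop 1]
    with t hsmall ht
  have ht0 : 0 < t := by linarith
  have hF := h.hasFourierFunction_solSymbol hn hτ hc₀ hb hν hα₀ hα j ht0.le
  have hL : AEStronglyMeasurable (fun η : Rn n => (lowProfile c₀ (b * ν) α ε j t η : ℂ)) volume :=
    (Complex.measurable_ofReal.comp (measurable_lowProfile j t)).aestronglyMeasurable
  have key := eLpNorm_sub_le (aestronglyMeasurable_rad_rpow_mul hF.aestronglyMeasurable (s + 2 - j))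
    (aestronglyMeasurable_rad_rpow_mul (hF.aestronglyMeasurable.sub (hL.const_mul P)) (s + 2 - j))
    one_le_two
  have hc := eLpNorm_const_smul P (fun η : Rn n => ((rad η ^ (s + 2 - (j : ℝ)) : ℝ) : ℂ) *
    (lowProfile c₀ (b * ν) α ε j t η : ℝ)) 2 volume
  have key' : ‖P‖ₑ * eLpNorm (fun η : Rn n => ((rad η ^ (s + 2 - (j : ℝ)) : ℝ) : ℂ) *
      (lowProfile c₀ (b * ν) α ε j t η : ℝ)) 2 volume ≤
      eLpNorm (fun η : Rn n => ((rad η ^ (s + 2 - (j : ℝ)) : ℝ) : ℂ) *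
        solSymbol τ (b * ν * rad η ^ (2 * α)) (c₀ ^ 2 * rad η ^ 2) t j
          (fun i => 𝓕 (φ i : Rn n → ℂ) η)) 2 volume +
      eLpNorm (fun η : Rn n => ((rad η ^ (s + 2 - (j : ℝ)) : ℝ) : ℂ) *
        (solSymbol τ (b * ν * rad η ^ (2 * α)) (c₀ ^ 2 * rad η ^ 2) t j
            (fun i => 𝓕 (φ i : Rn n → ℂ) η) -
          P * (lowProfile c₀ (b * ν) α ε j t η : ℝ))) 2 volume := by
    refine le_trans (le_of_eq (hc.symm.trans
      (congrArg (fun f => eLpNorm f 2 volume) (funext fun η => ?_)))) key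
    simp only [Pi.sub_apply, Pi.smul_apply, smul_eq_mul]
    ring
  have hsum : ENNReal.ofReal (K / 2 * ‖P‖) + ENNReal.ofReal (K / 2 * ‖P‖) ≤
      ENNReal.ofReal (t ^ rate n α s j) * homSobolevNorm (s + 2 - (j : ℝ)) (D j t) +
        ENNReal.ofReal (K / 2 * ‖P‖) := by
    rw [homSobolevNorm_eq hF, ← ENNReal.ofReal_add hhalf.le hhalf.le]
    calc ENNReal.ofReal (K / 2 * ‖P‖ + K / 2 * ‖P‖) = ‖P‖ₑ * ENNReal.ofReal K := by
          rw [← ofReal_norm, ← ENNReal.ofReal_mul hPn.le]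
          congr 1
          ring
      _ ≤ ‖P‖ₑ * _ := mul_le_mul_right (hlow t ht) _
      _ = ENNReal.ofReal (t ^ rate n α s j) * _ := mul_left_comm _ _ _
      _ ≤ ENNReal.ofReal (t ^ rate n α s j) * _ := mul_le_mul_right key' _
      _ ≤ _ := by
        rw [mul_add]
        exact add_le_add_right hsmall.le _
  have hfin := ENNReal.le_of_add_le_add_right ENNReal.ofReal_ne_top hsum
  have e : ENNReal.ofReal (K / 2 * t ^ (-rate n α s j) * ‖P‖) =
      ENNReal.ofReal (t ^ (-rate n α s j)) * ENNReal.ofReal (K / 2 * ‖P‖) := by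
    rw [← ENNReal.ofReal_mul (by positivity)]
    congr 1
    ring
  rw [e]
  refine (mul_le_mul_right hfin _).trans (le_of_eq ?_)
  rw [← mul_assoc, ← ENNReal.ofReal_mul (by positivity), ← Real.rpow_add ht0, neg_add_cancel,
    Real.rpow_zero, ENNReal.ofReal_one, one_mul]

end

theorem MemData.dataNorm_ne_top {n : ℕ} {s : ℝ} {j : Fin 3}
    {φ₀ φ₁ φ₂ : Lp ℂ 1 (volume : Measure (Rn n))} (h : MemData s j φ₀ φ₁ φ₂) :
    dataNorm s j φ₀ φ₁ φ₂ ≠ ⊤ := by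
  have hs : ∀ {r : ℝ} {u : 𝓢'(Rn n, ℂ)}, MemSobolev r 2 u → sobolevNorm r u ≠ ⊤ := by
    rintro r u ⟨f, hf⟩
    exact ((iInf₂_le f hf).trans_lt enorm_lt_top).ne
  simp [dataNorm, hs h.1, hs h.2.1, hs h.2.2]

end Cattaneo

end

/-! ### The proposition. -/

open Cattaneo in
theorem mainTheorem4 (n : ℕ) (hn : 2 ≤ n)
    (τ c₀ b ν α : ℝ) (hτ : 0 < τ) (hc₀ : 0 < c₀) (hb : 0 < b) (hν : 0 < ν)
    (hbν : b * ν < 2 * c₀) (hα₀ : 0 ≤ α) (hα : α < 1 / 2)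
    (j : Fin 3) (s : ℝ) (hs : s = (j : ℝ) - 2 ∨ 0 ≤ s) :
    -- upper bound
    (∃ C : ℝ, 0 < C ∧
      ∀ (φ₀ φ₁ φ₂ : Lp ℂ 1 (volume : Measure (Rn n))) (D : Fin 3 → ℝ → 𝓢'(Rn n, ℂ)),
        MemData s j φ₀ φ₁ φ₂ → IsSolution τ c₀ b ν α φ₀ φ₁ φ₂ D →
        ∀ t : ℝ, 0 ≤ t →
          homSobolevNorm (s + 2 - (j : ℝ)) (D j t) ≤
            ENNReal.ofReal (C * (1 + t) ^ (-rate n α s j)) * dataNorm s j φ₀ φ₁ φ₂) ∧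
    -- asymptotic profile
    (∀ (ε₀ : ℝ) (χ : Rn n → ℝ), 0 < ε₀ → IsLowFreqCutoff ε₀ χ →
      ∀ (φ₀ φ₁ φ₂ : Lp ℂ 1 (volume : Measure (Rn n))) (D : Fin 3 → ℝ → 𝓢'(Rn n, ℂ)),
        MemData s j φ₀ φ₁ φ₂ → IsSolution τ c₀ b ν α φ₀ φ₁ φ₂ D →
        (0 < α ∨ mass (φ₀ + (τ : ℂ) • φ₁) = 0) →
        Tendsto (fun t : ℝ => ENNReal.ofReal (t ^ rate n α s j) *
            homSobolevNorm (s + 2 - (j : ℝ))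
              (D j t - mass (φ₁ + (τ : ℂ) • φ₂) • profile c₀ b ν α χ j t))
          atTop (𝓝 0)) ∧
    -- lower bound
    (∃ c : ℝ, 0 < c ∧
      ∀ (φ₀ φ₁ φ₂ : Lp ℂ 1 (volume : Measure (Rn n))) (D : Fin 3 → ℝ → 𝓢'(Rn n, ℂ)),
        MemData s j φ₀ φ₁ φ₂ → IsSolution τ c₀ b ν α φ₀ φ₁ φ₂ D →
        (0 < α ∨ mass (φ₀ + (τ : ℂ) • φ₁) = 0) →
        mass (φ₁ + (τ : ℂ) • φ₂) ≠ 0 →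
        ∀ᶠ t : ℝ in atTop,
          ENNReal.ofReal (c * t ^ (-rate n α s j) * ‖mass (φ₁ + (τ : ℂ) • φ₂)‖) ≤
            homSobolevNorm (s + 2 - (j : ℝ)) (D j t)) := by
  -- With n ≥ 2 and α < 1/2 this gives s+2-j+n/2-2α > 0, which is the integrability at the zero
  -- frequency on which all estimates rest.
  have hσ : 0 ≤ s + 2 - (j : ℝ) := by
    rcases hs with rfl | hs
    · linarith
    · have : ((j : ℕ) : ℝ) ≤ 2 := by exact_mod_cast Nat.le_of_lt_succ j.2
      linarith
  refine ⟨?_, ?_, ?_⟩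
  · obtain ⟨C, hC, h⟩ := exists_homSobolevNorm_le hn hτ hc₀ hb hν hα₀ hα j hσ
    exact ⟨C, hC, fun φ₀ φ₁ φ₂ D _ hD => h ![φ₀, φ₁, φ₂] D hD⟩
  · intro ε₀ χ hε₀ hχ φ₀ φ₁ φ₂ D hdata hD hφ
    exact tendsto_homSobolevNorm_sub_profile (φ := ![φ₀, φ₁, φ₂]) hn hτ hc₀ hb hν hα₀ hα j hσ hε₀ hχ
      hdata.dataNorm_ne_top hD hφ
  · obtain ⟨c, hc, h⟩ := exists_le_homSobolevNorm hn hτ hc₀ hb hν hα₀ hα j hσ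
    exact ⟨c, hc, fun φ₀ φ₁ φ₂ D hdata hD hφ hP =>
      h ![φ₀, φ₁, φ₂] D hdata.dataNorm_ne_top hD hφ hP⟩
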